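/- Let $r \ge 7$ be a prime, $\zeta$ a primitive $r$-th root of unity, $K^+$ the maximal totally real subfield of $\mathbb{Q}(\zeta)$ and $\mathcal{O}$ its ring of integers. Let $\pi_r \in \mathcal{O}$ be such that $r\mathcal{O} = (\pi_r)^{(r-1)/2}$. Fix integers $1 \le k_1 < k_2 < k_3 \le (r-1)/2$ and put $f_k(x,y) = x^2 + (\zeta^k+\zeta^{-k})xy + y^2$. Let $p$ be a prime, let $a,b$ be coprime integers, let $c \in \mathcal{O}$ and $\mu \in \mathcal{O}^\times$, and suppose that either $$ r \nmid a+b \quad\text{and}\quad f_{k_1}(a,b)f_{k_2}(a,b)f_{k_3}(a,b) = \mu c^p, $$ or $$ r \mid a+b \quad\text{and}\quad f_{k_1}(a,b)f_{k_2}(a,b)f_{k_3}(a,b) = \mu \pi_r^3 c^p. $$ Let $\alpha = \zeta^{k_3}+\zeta^{-k_3}-\zeta^{k_2}-\zeta^{-k_2}$, $\beta = \zeta^{k_1}+\zeta^{-k_1}-\zeta^{k_3}-\zeta^{-k_3}$, $A = \alpha f_{k_1}(a,b)$, $B = \beta f_{k_2}(a,b)$, and let $E$ be the Frey curve over $K^+$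 $$ E : Y^2 = X(X-A)(X+B). $$ Then $E$ is an elliptic curve, and there are exponents $s_{\mathfrak{P}} \in \{2,3,4\}$, one for each prime $\mathfrak{P}$ of $K^+$ above $2$, such that the conductor of $E$ is $$ N_E = \Big(\prod_{\mathfrak{P} \mid 2} \mathfrak{P}^{s_{\mathfrak{P}}}\Big)\, (\pi_r)^t\, \mathrm{rad}(c), $$ where $\mathrm{rad}(c)$ is the product of the distinct primes of $K^+$ dividing $c$, and $t = 0$ if $r \mid a+b$, $t = 2$ if $r \nmid a+b$. In particular, $E$ has good reduction at all primes of $K^+$ above $3$. -/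

import Mathlib

open NumberField IsDedekindDomain

open scoped WeierstrassCurve.Affine

noncomputable section

/-! ### The conductor of an elliptic curve over a number field -/

namespace WeierstrassCurve

section Reduction

variable {K : Type*} [Field K] [NumberField K]

/-- `W` has good reduction at the finite place `v`: some minimal Weierstrass equation over the
completion `K_v` has good reduction. -/
def HasGoodReductionAt (W : WeierstrassCurve K) (v : HeightOneSpectrum (𝓞 K)) : Prop :=
  ∃ C : VariableChange (v.adicCompletion K),
    (C • W.baseChange (v.adicCompletion K)).HasGoodReduction (v.adicCompletionIntegers K)

/-- `W` has multiplicative reduction at the finite place `v`: some minimal Weierstrass equation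
over the completion `K_v` has multiplicative reduction. -/
def HasMultiplicativeReductionAt (W : WeierstrassCurve K) (v : HeightOneSpectrum (𝓞 K)) : Prop :=
  ∃ C : VariableChange (v.adicCompletion K),
    (C • W.baseChange (v.adicCompletion K)).HasMultiplicativeReduction (v.adicCompletionIntegers K)

end Reduction

section Torsion

variable {K : Type*} [Field K]

open Classical in
/-- The `ℓ`-division field `K(E[ℓ])`, generated inside an algebraic closure of `K` by the
coordinates of the nonzero points of order dividing `ℓ`. -/
def divisionField (W : WeierstrassCurve K) (ℓ : ℕ) : IntermediateField K (AlgebraicClosure K) :=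
  IntermediateField.adjoin K
    {z | ∃ (x y : AlgebraicClosure K)
      (h : (W.baseChange (AlgebraicClosure K)).toAffine.Nonsingular x y),
      ℓ • Affine.Point.some x y h = 0 ∧ (z = x ∨ z = y)}

variable (L : Type*) [Field L] [Algebra K L]

open Classical in
/-- The subgroup `E(L)[ℓ]^H` of `ℓ`-torsion points of `E(L)` fixed by a group `H` of
`K`-automorphisms of `L`. -/
def torsionFixedBy (W : WeierstrassCurve K) (ℓ : ℕ) (H : Subgroup Gal(L/K)) :
    AddSubgroup (W.baseChange L).toAffine.Point where
  carrier := {P | ℓ • P = 0 ∧ ∀ σ ∈ H,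
    Affine.Point.map (W' := W.toAffine) (σ : L →ₐ[K] L) P = P}
  zero_mem' := ⟨smul_zero _, fun _ _ ↦ map_zero _⟩
  add_mem' := fun {P Q} hP hQ ↦
    ⟨by rw [smul_add, hP.1, hQ.1, add_zero],
      fun σ hσ ↦ by rw [map_add, hP.2 σ hσ, hQ.2 σ hσ]⟩
  neg_mem' := fun {P} hP ↦
    ⟨by rw [smul_neg, hP.1, neg_zero], fun σ hσ ↦ by rw [map_neg, hP.2 σ hσ]⟩

open Classical in
/-- The dimension over `𝔽_ℓ` of `E[ℓ] / E[ℓ]^H`, where `E[ℓ]` consists of `L`-rational points: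
the index of `E[ℓ]^H` in `E[ℓ]` is `ℓ` to the power this dimension. -/
def torsionCodim (W : WeierstrassCurve K) (ℓ : ℕ) (H : Subgroup Gal(L/K)) : ℕ :=
  Nat.log ℓ ((torsionFixedBy L W ℓ H).relIndex (torsionFixedBy L W ℓ ⊥))

end Torsion

section Conductor

variable {K : Type*} [Field K]

/-- The `i`-th ramification group, in the lower numbering, of `L / K` at a prime `w` of `L`:
the automorphisms acting trivially on `𝓞 L / w ^ (i + 1)`. -/
def lowerRamificationGroup (K : Type*) [Field K] {L : Type*} [Field L] [Algebra K L]
    (w : Ideal (𝓞 L)) (i : ℕ) : Subgroup Gal(L/K) :=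
  (w ^ (i + 1)).inertia Gal(L/K)

/-- The Swan term
`∑_{i ≥ 1} (#G_i / #G_0) * dim (E[ℓ] / E[ℓ]^{G_i})`,
where `G_i` are the ramification groups of `L / K` at `w`, and `E[ℓ]` is rational over `L`. -/
def swanTerm (W : WeierstrassCurve K) (ℓ : ℕ) (L : Type*) [Field L] [Algebra K L]
    (w : Ideal (𝓞 L)) : ℚ :=
  ∑ᶠ i : ℕ, (Nat.card (lowerRamificationGroup K w (i + 1)) : ℚ)
    / Nat.card (lowerRamificationGroup K w 0)
    * torsionCodim L W ℓ (lowerRamificationGroup K w (i + 1))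

variable [NumberField K]

/-- A prime of `L` above the finite place `v` of `K` (all choices are conjugate if `L / K` is
Galois). -/
def primeAbove (v : HeightOneSpectrum (𝓞 K)) (L : IntermediateField K (AlgebraicClosure K)) :
    Ideal (𝓞 L) :=
  (Ideal.nonempty_primesOver (S := 𝓞 L) v.asIdeal).some.1

open Classical in
/-- A prime number different from the residue characteristic of `v`. -/
def auxiliaryPrime (v : HeightOneSpectrum (𝓞 K)) : ℕ :=
  if (2 : 𝓞 K) ∈ v.asIdeal then 3 else 2

/-- The wild part `δ_v` of the conductor exponent, computed on `E[ℓ]` for a prime number `ℓ`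
different from the residue characteristic of `v`. It does not depend on `ℓ`. -/
def wildConductorExponent (W : WeierstrassCurve K) (v : HeightOneSpectrum (𝓞 K)) : ℚ :=
  swanTerm W (auxiliaryPrime v) (divisionField W (auxiliaryPrime v))
    (primeAbove v (divisionField W (auxiliaryPrime v)))

open Classical in
/-- The exponent of the conductor of an elliptic curve at `v`: it is `0` for good reduction, `1`
for multiplicative reduction, and `2 + δ_v` for additive reduction. The rational number `δ_v` is
a nonnegative integer, so that the floor only reads it as a natural number. -/
def conductorExponent (W : WeierstrassCurve K) (v : HeightOneSpectrum (𝓞 K)) : ℕ :=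
  if W.HasGoodReductionAt v then 0
  else if W.HasMultiplicativeReductionAt v then 1
  else 2 + ⌊wildConductorExponent W v⌋₊

/-- The conductor of an elliptic curve over a number field. -/
def conductor (W : WeierstrassCurve K) : Ideal (𝓞 K) :=
  ∏ᶠ v : HeightOneSpectrum (𝓞 K), v.asIdeal ^ W.conductorExponent v

end Conductor

end WeierstrassCurve

/-! ### The Frey curves -/

namespace Frey

variable {F : Type*} [Field F] {r : ℕ} [NeZero r] {ζ : F}

lemma pow_add_inv_pow_mem [NumberField F] (hζ : IsPrimitiveRoot ζ r) (k : ℕ) :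
    ζ ^ k + (ζ ^ k)⁻¹ ∈ maximalRealSubfield F := by
  rw [mem_maximalRealSubfield_iff]
  intro φ
  have h1 : ‖φ (ζ ^ k)‖ = 1 := by
    refine Complex.norm_eq_one_of_pow_eq_one (n := r) ?_ (NeZero.ne r)
    rw [← map_pow, ← pow_mul, mul_comm, pow_mul, hζ.pow_eq_one, one_pow, map_one]
  have h2 : star (φ (ζ ^ k)) = (φ (ζ ^ k))⁻¹ := (Complex.inv_eq_conj h1).symm
  rw [map_add, map_inv₀, star_add, star_inv₀, h2, inv_inv, add_comm]

variable [NumberField F]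

/-- The element `ζ ^ k + ζ ^ (-k)` of the maximal totally real subfield of `ℚ(ζ)`. -/
def theta (hζ : IsPrimitiveRoot ζ r) (k : ℕ) : maximalRealSubfield F :=
  ⟨ζ ^ k + (ζ ^ k)⁻¹, pow_add_inv_pow_mem hζ k⟩

/-- The value `f_k(a, b) = a ^ 2 + (ζ ^ k + ζ ^ (-k)) a b + b ^ 2`. -/
def f (hζ : IsPrimitiveRoot ζ r) (k : ℕ) (a b : ℤ) : maximalRealSubfield F :=
  (a : maximalRealSubfield F) ^ 2 + theta hζ k * a * b + (b : maximalRealSubfield F) ^ 2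

/-- The Frey curve `Y ^ 2 = X (X - A) (X + B)` attached to `(k₁, k₂, k₃)` and `(a, b)`, where
`A = α f_{k₁}(a, b)` and `B = β f_{k₂}(a, b)`. -/
def curve (hζ : IsPrimitiveRoot ζ r) (k₁ k₂ k₃ : ℕ) (a b : ℤ) :
    WeierstrassCurve (maximalRealSubfield F) :=
  let A := (theta hζ k₃ - theta hζ k₂) * f hζ k₁ a b
  let B := (theta hζ k₁ - theta hζ k₃) * f hζ k₂ a b
  { a₁ := 0, a₂ := B - A, a₃ := 0, a₄ := -(A * B), a₆ := 0 }

end Frey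

end

/-! The curve has the form `Y ^ 2 = X (X - A) (X + B)`, with discriminant `2 ^ 4 * (A * B * (A + B))
^ 2` and `c₄ = 2 ^ 4 * (A ^ 2 + A * B + B ^ 2)`. The linear relation between the three quadratic
forms makes `A + B` equal to `-γ f_{k₃}` with `γ = θ_{k₂} - θ_{k₁}`, where `θ_k = ζ ^ k + ζ ^ (-k)`.
So everything is governed by the orders of the three values `f_k(a, b)` and of the differences of
the `θ_k`. These differences are units away from `r` and uniformizers at the unique place above `r`.

Away from `2r`, the `f_k(a, b)` are pairwise coprime. Hence `c₄` is a unit wherever one of them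
vanishes: the reduction is multiplicative there and good elsewhere. At `r`, the elements `A`, `B`,
`A + B` all have order `2` if `r ∣ a + b`, and scaling gives good reduction. Otherwise they all have
order `1`, and the reduction is additive with no wild part, since the 2-torsion is rational.
Comparing orders at `r` in the given equation shows that `c` is prime to `r`. At places above `2` or
`3`, no `f_k(a, b)` vanishes: `a` and `b` reduce to elements of `{0, 1, -1}`, and `2 ± θ_k` are
units there.

The main work is at places above `2`. There `2` is unramified and `A`, `B`, `A + B` are units. The
discriminant has order `4`, and `c₄` has order at least `4` if it is nonzero, so the reduction is
additive. The exponent is `2 + ⌊δ⌋`, and `δ < 3` must be shown for the Swan term of `E[3]`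
(`swanTerm_lt_three`). A shift of `X` brings the cubic to `z ^ 3 + a₂ z ^ 2 + a₄ z + a₆` with `a₂`
integral, `a₄` even and `a₆` a unit.

Let `e` be the order of `2` in the 3-division field. Dominance of terms shows that the abscissae of
the 3-torsion have order at least `e / 2` and that distinct ones differ by order exactly `2e / 3`
(`ord_sub`). Approximating an ordinate by `s z + t` with `s`, `t` in the base field
(`exists_approx`) gives elements of large order that a wild automorphism moves only slightly. This
bounds how deep in the lower numbering it can lie: by some `N₁` if it moves an abscissa, by some
`N₂` if it acts as `-1` (`exists_ramification_bounds`). Wild groups have order at most `16` in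
general, and at most `2` beyond `N₁`. All codimensions are at most `2`, so `δ ≤ (28 N₁ + 4 N₂) / e <
3`. -/

open NumberField IsDedekindDomain

open scoped WeierstrassCurve.Affine

noncomputable section

/-! ### Additive notation for integer valued valuations -/

namespace Valuation

variable {L : Type*} [Field L] (w : Valuation L (WithZero (Multiplicative ℤ)))

/-- The additive form of `w`, with the junk value `0` at `0`. -/
def ord (x : L) : ℚ := ((-WithZero.log (w x) : ℤ) : ℚ)

/-- The element `x` has order at least `q`, where `0` has infinite order. -/
def OrdGE (q : ℚ) (x : L) : Prop := x = 0 ∨ q ≤ w.ord x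

variable {w}

lemma ord_mul {x y : L} (hx : x ≠ 0) (hy : y ≠ 0) : w.ord (x * y) = w.ord x + w.ord y := by
  simp only [ord, map_mul, WithZero.log_mul (w.ne_zero_iff.2 hx) (w.ne_zero_iff.2 hy)]
  push_cast; ring

@[simp] lemma ord_one : w.ord 1 = 0 := by simp [ord]

@[simp] lemma ord_zero : w.ord 0 = 0 := by simp [ord]

@[simp] lemma ord_neg (x : L) : w.ord (-x) = w.ord x := by simp [ord, Valuation.map_neg]

lemma ord_sub_comm (x y : L) : w.ord (x - y) = w.ord (y - x) := by rw [← neg_sub, ord_neg]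

@[simp] lemma ord_pow (x : L) (n : ℕ) : w.ord (x ^ n) = n * w.ord x := by
  simp [ord, WithZero.log_pow]

@[simp] lemma ord_inv (x : L) : w.ord x⁻¹ = -w.ord x := by
  simp [ord, WithZero.log_inv]

lemma ord_div {x y : L} (hx : x ≠ 0) (hy : y ≠ 0) : w.ord (x / y) = w.ord x - w.ord y := by
  rw [div_eq_mul_inv, ord_mul hx (inv_ne_zero hy), ord_inv, sub_eq_add_neg]

lemma ne_zero_of_ord_ne_zero {x : L} (h : w.ord x ≠ 0) : x ≠ 0 := by
  rintro rfl; simp at h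

lemma exists_int_ord (x : L) : ∃ n : ℤ, w.ord x = n := ⟨_, rfl⟩

lemma ord_le_ord_iff {x y : L} (hx : x ≠ 0) (hy : y ≠ 0) : w.ord x ≤ w.ord y ↔ w y ≤ w x := by
  rw [ord, ord, Int.cast_le, neg_le_neg_iff,
    WithZero.log_le_log (w.ne_zero_iff.2 hy) (w.ne_zero_iff.2 hx)]

lemma ord_eq_ord_iff {x y : L} (hx : x ≠ 0) (hy : y ≠ 0) : w.ord x = w.ord y ↔ w x = w y := by
  rw [le_antisymm_iff, le_antisymm_iff, ord_le_ord_iff hx hy, ord_le_ord_iff hy hx, and_comm]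

lemma ord_eq_zero_iff {x : L} (hx : x ≠ 0) : w.ord x = 0 ↔ w x = 1 := by
  simpa using ord_eq_ord_iff (w := w) hx one_ne_zero

lemma ord_nonneg_iff {x : L} (hx : x ≠ 0) : 0 ≤ w.ord x ↔ w x ≤ 1 := by
  simpa using ord_le_ord_iff (w := w) one_ne_zero hx

lemma ord_pos_iff {x : L} (hx : x ≠ 0) : 0 < w.ord x ↔ w x < 1 := by
  rw [← not_le, ← not_le]
  simpa using (ord_le_ord_iff (w := w) hx one_ne_zero).not

namespace OrdGE

variable {x y : L} {q r : ℚ}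

lemma zero : w.OrdGE q 0 := Or.inl rfl

lemma le_ord (h : w.OrdGE q x) (hx : x ≠ 0) : q ≤ w.ord x := h.resolve_left hx

lemma refl (x : L) : w.OrdGE (w.ord x) x := Or.inr le_rfl

lemma of_eq (h : w.ord x = q) : w.OrdGE q x := Or.inr h.ge

lemma mono (h : w.OrdGE q x) (hr : r ≤ q) : w.OrdGE r x := h.imp_right hr.trans

lemma neg (h : w.OrdGE q x) : w.OrdGE q (-x) := by
  simpa [OrdGE] using h

lemma sub_comm (h : w.OrdGE q (x - y)) : w.OrdGE q (y - x) := by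
  simpa using h.neg

lemma add (hx : w.OrdGE q x) (hy : w.OrdGE q y) : w.OrdGE q (x + y) := by
  rcases eq_or_ne x 0 with rfl | hx0
  · simpa using hy
  rcases eq_or_ne y 0 with rfl | hy0
  · simpa using hx
  rcases eq_or_ne (x + y) 0 with h | h
  · exact Or.inl h
  refine Or.inr ?_
  rcases le_total (w x) (w y) with hle | hle
  · refine (hy.le_ord hy0).trans ((ord_le_ord_iff hy0 h).2 ?_)
    simpa [hle] using w.map_add x y
  · refine (hx.le_ord hx0).trans ((ord_le_ord_iff hx0 h).2 ?_)
    simpa [hle] using w.map_add x y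

lemma sub (hx : w.OrdGE q x) (hy : w.OrdGE q y) : w.OrdGE q (x - y) := by
  simpa [sub_eq_add_neg] using hx.add hy.neg

lemma mul (hx : w.OrdGE q x) (hy : w.OrdGE r y) : w.OrdGE (q + r) (x * y) := by
  rcases eq_or_ne x 0 with rfl | hx0
  · exact Or.inl (zero_mul _)
  rcases eq_or_ne y 0 with rfl | hy0
  · exact Or.inl (mul_zero _)
  exact Or.inr (by rw [ord_mul hx0 hy0]; exact add_le_add (hx.le_ord hx0) (hy.le_ord hy0))

lemma pow (hx : w.OrdGE q x) (n : ℕ) (hn : n ≠ 0) : w.OrdGE (n * q) (x ^ n) := by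
  rcases eq_or_ne x 0 with rfl | hx0
  · exact Or.inl (zero_pow hn)
  exact Or.inr (by rw [ord_pow]; exact mul_le_mul_of_nonneg_left (hx.le_ord hx0) n.cast_nonneg)

lemma of_sq (h : w.OrdGE q (x ^ 2)) : w.OrdGE (q / 2) x := by
  rcases eq_or_ne x 0 with rfl | hx0
  · exact zero
  have := h.le_ord (pow_ne_zero 2 hx0)
  rw [ord_pow] at this
  push_cast at this
  exact Or.inr (by linarith)

lemma of_pos (h : w.OrdGE q x) (hq : 0 < q) : w.OrdGE 1 x := by
  refine h.imp_right fun h ↦ ?_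
  obtain ⟨n, hn⟩ := exists_int_ord (w := w) x
  rw [hn] at h ⊢
  have : (0 : ℚ) < n := hq.trans_le h
  have : 0 < n := by exact_mod_cast this
  exact_mod_cast this

end OrdGE

lemma ord_int_nonneg (n : ℤ) : w.OrdGE 0 (n : L) := by
  rcases eq_or_ne (n : L) 0 with h | h
  · exact Or.inl h
  refine Or.inr ((ord_nonneg_iff h).2 ?_)
  exact (Valuation.mem_integer_iff _ _).1 (intCast_mem w.integer n)

lemma ordGE_nat (n : ℕ) : w.OrdGE 0 (n : L) := by simpa using ord_int_nonneg (w := w) n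

lemma ordGE_ofNat (n : ℕ) [n.AtLeastTwo] : w.OrdGE 0 (OfNat.ofNat n : L) := by
  simpa using ordGE_nat (w := w) (OfNat.ofNat n)

lemma ordGE_one : w.OrdGE 0 (1 : L) := OrdGE.of_eq ord_one

lemma ordGE_zero_iff {x : L} : w.OrdGE 0 x ↔ w x ≤ 1 := by
  rcases eq_or_ne x 0 with rfl | h
  · simp [OrdGE]
  · simp [OrdGE, h, ord_nonneg_iff h]

lemma ordGE_one_iff {x : L} : w.OrdGE 1 x ↔ w x < 1 := by
  rcases eq_or_ne x 0 with rfl | h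
  · simp [OrdGE]
  · rw [← ord_pos_iff h]
    exact ⟨fun h' ↦ zero_lt_one.trans_le (h'.le_ord h), fun h' ↦ (OrdGE.refl x).of_pos h'⟩

/-- If `x` is strictly dominant over `y`, then `x + y` has the order of `x`. -/
lemma ord_add_eq {x y : L} {q : ℚ} (hx : x ≠ 0) (hy : w.OrdGE q y) (h : w.ord x < q) :
    x + y ≠ 0 ∧ w.ord (x + y) = w.ord x := by
  have h1 : x + y ≠ 0 := fun h0 ↦ by
    have : x = -y := eq_neg_of_add_eq_zero_left h0
    have := (this ▸ hy.neg : w.OrdGE q x).le_ord hx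
    linarith
  refine ⟨h1, le_antisymm ?_ ?_⟩
  · by_contra! hlt
    have h2 : w.OrdGE (min q (w.ord (x + y))) (x + y - y) :=
      ((OrdGE.refl _).mono (min_le_right _ _)).sub (hy.mono (min_le_left _ _))
    rw [add_sub_cancel_right] at h2
    exact absurd (h2.le_ord hx) (not_le.2 (lt_min h hlt))
  · exact (((OrdGE.refl x).add (hy.mono h.le)).le_ord h1)

lemma ord_eq_of_sub {x y : L} {q : ℚ} (hx : x ≠ 0) (hxy : w.OrdGE q (y - x)) (h : w.ord x < q) :
    y ≠ 0 ∧ w.ord y = w.ord x := by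
  simpa using ord_add_eq hx hxy h

end Valuation

namespace Valuation

variable {L : Type*} [Field L] {w : Valuation L (WithZero (Multiplicative ℤ))}

variable (w) in
/-- The element `x` has order greater than `q`. -/
def OrdGT (q : ℚ) (x : L) : Prop := ∃ r, q < r ∧ w.OrdGE r x

lemma OrdGE.gt {q r : ℚ} {x : L} (h : w.OrdGE r x) (hq : q < r) : w.OrdGT q x := ⟨r, hq, h⟩

lemma OrdGT.add {q : ℚ} {x y : L} (hx : w.OrdGT q x) (hy : w.OrdGT q y) : w.OrdGT q (x + y) := by
  obtain ⟨r, hr, hx⟩ := hx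
  obtain ⟨s, hs, hy⟩ := hy
  exact ⟨min r s, lt_min hr hs, (hx.mono (min_le_left _ _)).add (hy.mono (min_le_right _ _))⟩

/-- This is the Newton polygon argument in its simplest form: a polynomial relation cannot hold if
one term has strictly smaller order than all the others. Bounds on roots are obtained from it by
contradiction. -/
lemma OrdGT.add_ne_zero {x y : L} (hx : x ≠ 0) (hy : w.OrdGT (w.ord x) y) : x + y ≠ 0 := by
  obtain ⟨r, hr, hy⟩ := hy
  exact (ord_add_eq hx hy hr).1

end Valuation

/-! ### Roots of the 3-division polynomial over a dyadic field -/

namespace DyadicCurve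

open Valuation

/-- A valued field whose residue characteristic is `2`, with a subfield `k` in which `2` is a
uniformizer and every integral element is a square modulo `2`; the order of `2` is `e`. -/
structure Base {L : Type*} [Field L] (w : Valuation L (WithZero (Multiplicative ℤ)))
    (k : Subfield L) (e : ℚ) : Prop where
  pos : 0 < e
  ord_two : w.ord 2 = e
  disc : ∀ a ∈ k, ∀ q > 0, w.OrdGE q a → w.OrdGE e a
  sq : ∀ a ∈ k, w.OrdGE 0 a → ∃ s ∈ k, w.OrdGE e (s ^ 2 - a)

/-- Conditions on the coefficients of `y ^ 2 = z ^ 3 + a₂ z ^ 2 + a₄ z + a₆`. -/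
structure Coeffs {L : Type*} [Field L] (w : Valuation L (WithZero (Multiplicative ℤ)))
    (k : Subfield L) (e : ℚ) (a₂ a₄ a₆ : L) : Prop where
  mem₂ : a₂ ∈ k
  mem₄ : a₄ ∈ k
  mem₆ : a₆ ∈ k
  ge₂ : w.OrdGE 0 a₂
  ge₄ : w.OrdGE e a₄
  ne₆ : a₆ ≠ 0
  ord₆ : w.ord a₆ = 0

/-- The polynomial whose roots are the abscissae of the points of order `3`. -/
def psi {L : Type*} [Field L] (a₂ a₄ a₆ z : L) : L :=
  3 * z ^ 4 + 4 * a₂ * z ^ 3 + 6 * a₄ * z ^ 2 + 12 * a₆ * z + (4 * a₂ * a₆ - a₄ ^ 2)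

variable {L : Type*} [Field L] {w : Valuation L (WithZero (Multiplicative ℤ))}
  {k : Subfield L} {e : ℚ} {a₂ a₄ a₆ : L}

namespace Base

variable (B : Base w k e)
include B

lemma two_ne_zero : (2 : L) ≠ 0 :=
  ne_zero_of_ord_ne_zero (w := w) (by rw [B.ord_two]; exact B.pos.ne')

lemma ge_two : w.OrdGE e (2 : L) := .of_eq B.ord_two

lemma ge_four : w.OrdGE (2 * e) (4 : L) := by
  have := B.ge_two.mul B.ge_two
  norm_num at this
  exact this.mono (by linarith)

lemma three : (3 : L) ≠ 0 ∧ w.ord 3 = 0 := by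
  have := ord_add_eq (w := w) one_ne_zero B.ge_two (by simpa using B.pos)
  norm_num at this
  exact this

lemma ge_six : w.OrdGE e (6 : L) := by
  have := (OrdGE.of_eq B.three.2).mul B.ge_two
  norm_num at this
  exact this

lemma ord_twelve : w.ord (12 : L) = 2 * e := by
  rw [show (12 : L) = 3 * (2 ^ 2) by norm_num, ord_mul B.three.1 (pow_ne_zero 2 B.two_ne_zero),
    ord_pow, B.three.2, B.ord_two]
  push_cast; ring

lemma twelve_ne_zero : (12 : L) ≠ 0 :=
  ne_zero_of_ord_ne_zero (w := w) (by rw [B.ord_twelve]; linarith [B.pos])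

lemma ord_three_mul {z : L} (hz : z ≠ 0) :
    3 * z ^ 4 ≠ 0 ∧ w.ord (3 * z ^ 4) = 4 * w.ord z := by
  refine ⟨mul_ne_zero B.three.1 (pow_ne_zero 4 hz), ?_⟩
  rw [ord_mul B.three.1 (pow_ne_zero 4 hz), ord_pow, B.three.2]
  push_cast; ring

/-- If `(y + s z + t) ^ 2 = z ^ 3 + a₂ z ^ 2 + a₄ z + a₆`, then a lower bound for the terms without
`y` gives one for `y`. -/
lemma ge_of_quadratic {x u R : L} {q : ℚ} (hq : q ≤ 2 * e) (hu : w.OrdGE 0 u)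
    (hR : w.OrdGE q R) (h : x ^ 2 + 2 * u * x = R) : w.OrdGE (q / 2) x := by
  refine or_iff_not_imp_left.2 fun hx ↦ ?_
  by_contra! hlt
  refine OrdGT.add_ne_zero (w := w) (pow_ne_zero 2 hx) ?_
    (show x ^ 2 + (2 * u * x + -R) = 0 by rw [← h]; ring)
  rw [ord_pow]
  refine (((B.ge_two.mul hu).mul (.refl x)).gt ?_).add (hR.neg.gt ?_) <;> push_cast <;> linarith

end Base

variable (B : Base w k e) (C : Coeffs w k e a₂ a₄ a₆)
include B C

lemma ge_twelve_mul {z : L} {q : ℚ} (hz : w.OrdGE q z) : w.OrdGE (2 * e + q) (12 * a₆ * z) := by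
  have := ((OrdGE.of_eq B.ord_twelve).mul (OrdGE.of_eq C.ord₆)).mul hz
  exact this.mono (by linarith)

lemma ge_four_mul {z : L} {q : ℚ} (hz : w.OrdGE q z) :
    w.OrdGE (2 * e + 3 * q) (4 * a₂ * z ^ 3) :=
  ((B.ge_four.mul C.ge₂).mul (hz.pow 3 (by norm_num))).mono (by norm_num)

lemma ge_six_mul {z : L} {q : ℚ} (hz : w.OrdGE q z) :
    w.OrdGE (2 * e + 2 * q) (6 * a₄ * z ^ 2) :=
  ((B.ge_six.mul C.ge₄).mul (hz.pow 2 (by norm_num))).mono (by norm_num; linarith)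

lemma ge_const : w.OrdGE (2 * e) (4 * a₂ * a₆ - a₄ ^ 2) :=
  (((B.ge_four.mul C.ge₂).mul (.of_eq C.ord₆)).mono (by linarith)).sub
    ((C.ge₄.pow 2 (by norm_num)).mono (by norm_num))

/-- The roots have order at least `e / 2`. -/
lemma ge_half_of_psi {z : L} (hz : psi a₂ a₄ a₆ z = 0) : w.OrdGE (e / 2) z := by
  have he := B.pos
  refine or_iff_not_imp_left.2 fun hz0 ↦ ?_
  by_contra! hlt
  obtain ⟨h0, ho⟩ := B.ord_three_mul hz0
  refine OrdGT.add_ne_zero (w := w) h0 ?_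
    (show 3 * z ^ 4 + (4 * a₂ * z ^ 3 + 6 * a₄ * z ^ 2 + 12 * a₆ * z +
      (4 * a₂ * a₆ - a₄ ^ 2)) = 0 by rw [← hz, psi]; ring)
  rw [ho]
  refine ((((ge_four_mul B C (.refl z)).gt ?_).add ((ge_six_mul B C (.refl z)).gt ?_)).add
    ((ge_twelve_mul B C (.refl z)).gt ?_)).add ((ge_const B C).gt ?_) <;> linarith

/-- If the constant term is divisible by `8`, the roots have order at least `2 e / 3`. -/
lemma ge_two_thirds_of_psi {z : L} (hz : psi a₂ a₄ a₆ z = 0)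
    (hc : w.OrdGE (3 * e) (4 * a₂ * a₆ - a₄ ^ 2)) : w.OrdGE (2 * e / 3) z := by
  have he := B.pos
  refine or_iff_not_imp_left.2 fun hz0 ↦ ?_
  by_contra! hlt
  obtain ⟨h0, ho⟩ := B.ord_three_mul hz0
  refine OrdGT.add_ne_zero (w := w) h0 ?_
    (show 3 * z ^ 4 + (4 * a₂ * z ^ 3 + 6 * a₄ * z ^ 2 + 12 * a₆ * z +
      (4 * a₂ * a₆ - a₄ ^ 2)) = 0 by rw [← hz, psi]; ring)
  rw [ho]
  refine ((((ge_four_mul B C (.refl z)).gt ?_).add ((ge_six_mul B C (.refl z)).gt ?_)).add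
    ((ge_twelve_mul B C (.refl z)).gt ?_)).add (hc.gt ?_) <;> linarith

/-- If the constant term has order exactly `2 e`, the roots have order `e / 2`. -/
lemma ord_eq_half_of_psi {z : L} (hz : psi a₂ a₄ a₆ z = 0)
    (hc0 : 4 * a₂ * a₆ - a₄ ^ 2 ≠ 0) (hc : w.ord (4 * a₂ * a₆ - a₄ ^ 2) = 2 * e) :
    z ≠ 0 ∧ w.ord z = e / 2 := by
  have he := B.pos
  have hge := ge_half_of_psi B C hz
  have hz0 : z ≠ 0 := by
    rintro rfl
    apply hc0
    simpa [psi] using hz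
  refine ⟨hz0, le_antisymm ?_ (hge.le_ord hz0)⟩
  by_contra! hlt
  refine OrdGT.add_ne_zero (w := w) hc0 ?_
    (show 4 * a₂ * a₆ - a₄ ^ 2 + (3 * z ^ 4 + (4 * a₂ * z ^ 3 + 6 * a₄ * z ^ 2 +
      12 * a₆ * z)) = 0 by rw [← hz, psi]; ring)
  rw [hc]
  refine ((OrdGE.of_eq (B.ord_three_mul hz0).2).gt ?_).add
    ((((ge_four_mul B C (.refl z)).gt ?_).add ((ge_six_mul B C (.refl z)).gt ?_)).add
    ((ge_twelve_mul B C (.refl z)).gt ?_)) <;> linarith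

/-- The ordinate of a point of positive abscissa is a unit. -/
lemma ord_y {y z : L} {q : ℚ} (hq : 0 < q) (hz : w.OrdGE q z)
    (h : y ^ 2 = z ^ 3 + a₂ * z ^ 2 + a₄ * z + a₆) : y ≠ 0 ∧ w.ord y = 0 := by
  have he := B.pos
  have h1 : w.OrdGT (w.ord a₆) (z ^ 3 + a₂ * z ^ 2 + a₄ * z) := by
    rw [C.ord₆]
    refine (((hz.pow 3 (by norm_num)).gt ?_).add ((C.ge₂.mul (hz.pow 2 (by norm_num))).gt ?_)).add
      ((C.ge₄.mul hz).gt ?_) <;> norm_num <;> linarith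
  obtain ⟨r, hr, h1⟩ := h1
  have h2 := ord_add_eq C.ne₆ h1 hr
  rw [show a₆ + (z ^ 3 + a₂ * z ^ 2 + a₄ * z) = y ^ 2 by rw [h]; ring, ord_pow, C.ord₆] at h2
  push_cast at h2
  exact ⟨fun h0 ↦ h2.1 (by rw [h0]; ring), by linarith [h2.2]⟩

/-- Distinct roots differ by an element of order `2 e / 3`. -/
lemma ord_sub {y₁ z₁ z₂ : L} (h₁ : y₁ ^ 2 = z₁ ^ 3 + a₂ * z₁ ^ 2 + a₄ * z₁ + a₆)
    (hz₁ : psi a₂ a₄ a₆ z₁ = 0) (hz₂ : psi a₂ a₄ a₆ z₂ = 0) (hne : z₁ ≠ z₂) :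
    w.ord (z₂ - z₁) = 2 * e / 3 := by
  have he := B.pos
  have hge := ge_half_of_psi B C hz₁
  obtain ⟨hy0, hy⟩ := ord_y B C (by linarith) hge h₁
  set d := z₂ - z₁ with hd
  have hd0 : d ≠ 0 := sub_ne_zero.2 hne.symm
  set c₂ := a₂ + 3 * z₁
  set c₄ := 3 * z₁ ^ 2 + 2 * a₂ * z₁ + a₄
  have hc₂ : w.OrdGE 0 c₂ :=
    C.ge₂.add (((OrdGE.of_eq B.three.2).mul hge).mono (by linarith))
  -- With the origin moved to `z₁`, the constant term of `psi` is `4 c₂ y₁ ^ 2 - c₄ ^ 2`. It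
  -- vanishes because `z₁` is a root, which forces `c₄` to be even.
  have hc₄ : w.OrdGE e c₄ := by
    have : c₄ ^ 2 = 4 * y₁ ^ 2 * c₂ := by
      rw [h₁]; simp only [c₄, c₂]; rw [psi] at hz₁; linear_combination -hz₁
    have h2 : w.OrdGE (2 * e) (c₄ ^ 2) := by
      rw [this]
      exact ((B.ge_four.mul ((OrdGE.of_eq hy).pow 2 (by norm_num))).mul hc₂).mono (by norm_num)
    exact h2.of_sq.mono (by linarith)
  have hy12 : 12 * y₁ ^ 2 ≠ 0 := mul_ne_zero B.twelve_ne_zero (pow_ne_zero 2 hy0)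
  have hoy12 : w.ord (12 * y₁ ^ 2) = 2 * e := by
    rw [ord_mul B.twelve_ne_zero (pow_ne_zero 2 hy0), ord_pow, hy, B.ord_twelve]; ring
  have hd3 : 3 * d ^ 3 ≠ 0 := mul_ne_zero B.three.1 (pow_ne_zero 3 hd0)
  have hod3 : w.ord (3 * d ^ 3) = 3 * w.ord d := by
    rw [ord_mul B.three.1 (pow_ne_zero 3 hd0), ord_pow, B.three.2]; push_cast; ring
  -- This is `psi (z₁ + d)` divided by `d`. The two middle terms never dominate, so `3 d ^ 3` and
  -- `12 y₁ ^ 2` must have equal order, that is `3 ord d = 2 e`.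
  have hrel : 3 * d ^ 3 + (4 * c₂ * d ^ 2 + 6 * c₄ * d + 12 * y₁ ^ 2) = 0 := by
    have : d * (3 * d ^ 3 + (4 * c₂ * d ^ 2 + 6 * c₄ * d + 12 * y₁ ^ 2)) = 0 := by
      rw [h₁]; simp only [c₄, c₂, d]; rw [psi] at hz₁ hz₂
      linear_combination hz₂ - hz₁
    exact (mul_eq_zero.1 this).resolve_left hd0
  have t₂ : w.OrdGE (2 * e + 2 * w.ord d) (4 * c₂ * d ^ 2) :=
    ((B.ge_four.mul hc₂).mul ((OrdGE.refl d).pow 2 (by norm_num))).mono (by norm_num)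
  have t₄ : w.OrdGE (2 * e + w.ord d) (6 * c₄ * d) :=
    ((B.ge_six.mul hc₄).mul (OrdGE.refl d)).mono (by linarith)
  rcases lt_trichotomy (w.ord d) (2 * e / 3) with hlt | heq | hlt
  · refine absurd hrel (OrdGT.add_ne_zero (w := w) hd3 ?_)
    rw [hod3]
    refine ((t₂.gt ?_).add (t₄.gt ?_)).add ((OrdGE.of_eq hoy12).gt ?_) <;> linarith
  · exact heq
  · refine absurd ((by linear_combination hrel :
      12 * y₁ ^ 2 + (3 * d ^ 3 + (4 * c₂ * d ^ 2 + 6 * c₄ * d)) = 0))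
      (OrdGT.add_ne_zero (w := w) hy12 ?_)
    rw [hoy12]
    refine ((OrdGE.of_eq hod3).gt ?_).add ((t₂.gt ?_).add (t₄.gt ?_)) <;> linarith

end DyadicCurve

/-! ### Automorphisms acting trivially to a given order, and approximation of ordinates -/

namespace Valuation

variable {L : Type*} [Field L] {w : Valuation L (WithZero (Multiplicative ℤ))}

lemma OrdGE.div {q : ℚ} {x y : L} (hx : w.OrdGE q x) : w.OrdGE (q - w.ord y) (x / y) := by
  have := hx.mul (OrdGE.refl (w := w) y⁻¹)
  rwa [ord_inv, ← sub_eq_add_neg, ← div_eq_mul_inv] at this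

variable (w) in
/-- The endomorphism `σ` satisfies `σ z / z ≡ 1` up to order `n` for all nonzero `z`. -/
def ActsTriviallyTo (σ : L →+* L) (n : ℚ) : Prop :=
  ∀ z, w.OrdGE (w.ord z + n) (σ z - z)

/-- An upper bound for `n` when `σ` moves `x` by `d`. -/
lemma ActsTriviallyTo.le {σ : L →+* L} {n q : ℚ} (h : w.ActsTriviallyTo σ n) {x d : L}
    (hx : w.OrdGE q x) (hd : σ x - x = d) (hd0 : d ≠ 0) : n ≤ w.ord d - q := by
  have hx0 : x ≠ 0 := by
    rintro rfl
    simp [hd0.symm] at hd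
  have h1 := (hd ▸ h x).le_ord hd0
  linarith [hx.le_ord hx0]

end Valuation

namespace DyadicCurve

open Valuation

variable {L : Type*} [Field L] {w : Valuation L (WithZero (Multiplicative ℤ))}
  {k : Subfield L} {e : ℚ} {a₂ a₄ a₆ : L} {σ : L →+* L} {n : ℚ}

lemma psi_map (hσ : ∀ a ∈ k, σ a = a) (C : Coeffs w k e a₂ a₄ a₆) {z : L}
    (hz : psi a₂ a₄ a₆ z = 0) : psi a₂ a₄ a₆ (σ z) = 0 := by
  have := congrArg σ hz
  simpa only [psi, map_add, _root_.map_sub, map_mul, map_pow, map_ofNat, map_zero, hσ _ C.mem₂,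
    hσ _ C.mem₄, hσ _ C.mem₆] using this

variable (B : Base w k e) (C : Coeffs w k e a₂ a₄ a₆)
include B C

/-- If the constant term of `psi` is divisible by `8`, wild automorphisms fix its roots. -/
lemma fixes_root (hσ : ∀ a ∈ k, σ a = a) (hn : w.ActsTriviallyTo σ n) (hn0 : 0 < n)
    (hc : w.OrdGE (3 * e) (4 * a₂ * a₆ - a₄ ^ 2)) {y z : L}
    (h : y ^ 2 = z ^ 3 + a₂ * z ^ 2 + a₄ * z + a₆) (hz : psi a₂ a₄ a₆ z = 0) : σ z = z := by
  by_contra! hne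
  have h1 := ord_sub B C h hz (psi_map hσ C hz) hne.symm
  -- The root has order at least `2 e / 3`, and its displacement has exactly that order, so `n ≤ 0`.
  have h2 := hn.le (ge_two_thirds_of_psi B C hz hc) rfl (sub_ne_zero.2 hne)
  linarith

/-- The automorphism changing the sign of an ordinate has ramification bounded by the quality of an
approximation of that ordinate. -/
lemma le_of_neg {s t y z : L} {q p : ℚ} (hs : s ∈ k) (ht : t ∈ k) (hσ : ∀ a ∈ k, σ a = a)
    (hn : w.ActsTriviallyTo σ n) (hp : 0 < p) (hz : w.OrdGE p z)
    (h : y ^ 2 = z ^ 3 + a₂ * z ^ 2 + a₄ * z + a₆) (hσz : σ z = z) (hσy : σ y = -y)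
    (hq : w.OrdGE q (y - s * z - t)) : n ≤ e - q := by
  obtain ⟨hy0, hy⟩ := ord_y B C hp hz h
  have h2y : -(2 * y) ≠ 0 := neg_ne_zero.2 (mul_ne_zero B.two_ne_zero hy0)
  have := hn.le hq (d := -(2 * y)) (by
    simp only [_root_.map_sub, map_mul, hσz, hσy, hσ _ hs, hσ _ ht]; ring) h2y
  rwa [ord_neg, ord_mul B.two_ne_zero hy0, hy, B.ord_two, add_zero] at this

omit C in
lemma exists_sqrt {a : L} (ha : a ∈ k) (ha0 : w.OrdGE 0 a) :
    ∃ s ∈ k, w.OrdGE 0 s ∧ w.OrdGE e (s ^ 2 - a) := by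
  obtain ⟨s, hs, h⟩ := B.sq a ha ha0
  refine ⟨s, hs, ?_, h⟩
  have h2 : w.OrdGE 0 (s ^ 2) := by simpa using (h.mono B.pos.le).add ha0
  simpa using h2.of_sq

-- With `x = y - s z - t`, the curve equation becomes `x ^ 2 + 2 (s z + t) x = R`. By
-- `Base.ge_of_quadratic`, half a lower bound for the order of `R` bounds the order of `x`.
omit B C in
lemma equation_sub {s t y z : L} (h : y ^ 2 = z ^ 3 + a₂ * z ^ 2 + a₄ * z + a₆) :
    (y - s * z - t) ^ 2 + 2 * (s * z + t) * (y - s * z - t) =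
      z ^ 3 + (a₂ - s ^ 2) * z ^ 2 + (a₄ - 2 * s * t) * z + (a₆ - t ^ 2) := by
  linear_combination h

/-- Choose `s ^ 2 ≡ a₂` and `t ^ 2 ≡ a₆` modulo `2`. Since `z` has order at least `2 e / 3`, every
term of the remainder has order at least `e`; the term `a₆ - t ^ 2` is the limiting one. -/
lemma exists_approx_of_dvd (hc : w.OrdGE (3 * e) (4 * a₂ * a₆ - a₄ ^ 2)) :
    ∃ s ∈ k, ∃ t ∈ k, ∀ y z, y ^ 2 = z ^ 3 + a₂ * z ^ 2 + a₄ * z + a₆ →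
      psi a₂ a₄ a₆ z = 0 → w.OrdGE (e / 2) (y - s * z - t) := by
  have he := B.pos
  obtain ⟨s, hs, hs0, hs2⟩ := exists_sqrt B C.mem₂ C.ge₂
  obtain ⟨t, ht, ht0, ht2⟩ := exists_sqrt B C.mem₆ (.of_eq C.ord₆)
  refine ⟨s, hs, t, ht, fun y z h hz ↦ ?_⟩
  have hz := ge_two_thirds_of_psi B C hz hc
  refine B.ge_of_quadratic (by linarith) ?_ ?_ (equation_sub h)
  · exact ((hs0.mul hz).mono (by linarith)).add ht0
  · refine (((((hz.pow 3 (by norm_num)).mono ?_).add ((hs2.sub_comm.mul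
      (hz.pow 2 (by norm_num))).mono ?_)).add (((C.ge₄.sub
        (((B.ge_two.mul hs0).mul ht0).mono ?_)).mul hz).mono ?_))).add ht2.sub_comm <;>
    norm_num <;> linarith

/-- The roots nearly satisfy `z ^ 2 = 2 q`, where `q ^ 2 ≡ a₂ a₆ - (a₄ / 2) ^ 2` modulo `2`. Writing
`a₆ - t ^ 2 = 2 m`, the constant error `2 m` can therefore be absorbed into the coefficient of `z ^
2` by taking `s ^ 2 ≡ a₂ + m / q`. If `m` is even, then `s ^ 2 ≡ a₂`, and the linear term also
improves, which raises the quality from `5 e / 8` to `7 e / 8`. If `m` is a unit, then so is `a₂ - s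
^ 2`. `le_of_moves` needs exactly this alternative. -/
lemma exists_approx (hc0 : 4 * a₂ * a₆ - a₄ ^ 2 ≠ 0)
    (hc : w.ord (4 * a₂ * a₆ - a₄ ^ 2) = 2 * e) :
    ∃ s ∈ k, ∃ t ∈ k, w.OrdGE 0 s ∧
      (∀ y z, y ^ 2 = z ^ 3 + a₂ * z ^ 2 + a₄ * z + a₆ →
        psi a₂ a₄ a₆ z = 0 → w.OrdGE (5 * e / 8) (y - s * z - t)) ∧
      ((a₂ - s ^ 2 ≠ 0 ∧ w.ord (a₂ - s ^ 2) = 0) ∨ (w.OrdGE e (a₂ - s ^ 2) ∧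
        ∀ y z, y ^ 2 = z ^ 3 + a₂ * z ^ 2 + a₄ * z + a₆ →
        psi a₂ a₄ a₆ z = 0 → w.OrdGE (7 * e / 8) (y - s * z - t))) := by
  have he := B.pos
  have h20 := B.two_ne_zero
  have h2k : (2 : L) ∈ k := ofNat_mem k 2
  set β := a₂ * a₆ - (a₄ / 2) ^ 2 with hβ
  have hcβ : 4 * a₂ * a₆ - a₄ ^ 2 = 2 ^ 2 * β := by rw [hβ]; field_simp; ring
  have hβ0 : β ≠ 0 := by rintro h0; rw [hcβ, h0] at hc0; simp at hc0
  have hβo : w.ord β = 0 := by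
    rw [hcβ, ord_mul (pow_ne_zero 2 h20) hβ0, ord_pow, B.ord_two] at hc
    push_cast at hc; linarith
  have ha₄2 : w.OrdGE 0 (a₄ / 2) := by
    have := C.ge₄.div (y := 2)
    rwa [B.ord_two, sub_self] at this
  have ha₄k : a₄ / 2 ∈ k := div_mem C.mem₄ h2k
  obtain ⟨q, hq, hqge, hq2⟩ := exists_sqrt B
    (sub_mem (mul_mem C.mem₂ C.mem₆) (pow_mem ha₄k 2)) (hβ ▸ OrdGE.of_eq hβo)
  obtain ⟨hq0, hqo⟩ : q ≠ 0 ∧ w.ord q = 0 := by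
    have h1 := ord_eq_of_sub hβ0 hq2 (by rw [hβo]; exact he)
    rw [hβo, ord_pow] at h1
    push_cast at h1
    exact ⟨fun h0 ↦ h1.1 (by rw [h0]; ring), by linarith [h1.2]⟩
  obtain ⟨t, ht, ht0, ht2⟩ := exists_sqrt B C.mem₆ (.of_eq C.ord₆)
  set m := (a₆ - t ^ 2) / 2 with hm
  have hmk : m ∈ k := div_mem (sub_mem C.mem₆ (pow_mem ht 2)) h2k
  have hm0 : w.OrdGE 0 m := by
    have := ht2.sub_comm.div (y := 2)
    rwa [B.ord_two, sub_self] at this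
  have hmq : w.OrdGE 0 (m / q) := by simpa [hqo] using hm0.div (y := q)
  obtain ⟨s, hs, hs0, hs2⟩ := exists_sqrt B (add_mem C.mem₂ (div_mem hmk hq)) (C.ge₂.add hmq)
  -- The product `z ^ 4 - 4 q ^ 2` has order at least `5 e / 2`, limited by `12 a₆ z`. Its two
  -- factors differ by `4 q`, so if the first had order below `5 e / 4`, the second would have the
  -- same order.
  have hzq : ∀ z, psi a₂ a₄ a₆ z = 0 → w.OrdGE (5 * e / 4) (z ^ 2 - 2 * q) := by
    intro z hz
    have hzge := ge_half_of_psi B C hz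
    have hprod : w.OrdGE (5 * e / 2) ((z ^ 2 - 2 * q) * (z ^ 2 - 2 * q + 4 * q)) := by
      rw [show (z ^ 2 - 2 * q) * (z ^ 2 - 2 * q + 4 * q) =
        4 * z ^ 4 + (4 * a₂ * z ^ 3 + 6 * a₄ * z ^ 2 + 12 * a₆ * z) - 4 * (q ^ 2 - β) by
          rw [psi] at hz; rw [show 4 * (q ^ 2 - β) = 4 * q ^ 2 - (4 * a₂ * a₆ - a₄ ^ 2) by
            rw [hcβ]; ring]
          linear_combination -hz]
      refine OrdGE.sub (OrdGE.add ?_ (OrdGE.add (OrdGE.add ?_ ?_) ?_)) ?_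
      · exact (B.ge_four.mul (hzge.pow 4 (by norm_num))).mono (by norm_num; linarith)
      · exact (ge_four_mul B C hzge).mono (by linarith)
      · exact (ge_six_mul B C hzge).mono (by linarith)
      · exact (ge_twelve_mul B C hzge).mono (by linarith)
      · exact (B.ge_four.mul hq2).mono (by linarith)
    refine or_iff_not_imp_left.2 fun h0 ↦ ?_
    by_contra! hlt
    have h1 := ord_add_eq h0 (B.ge_four.mul hqge) (by linarith)
    have h2 := hprod.le_ord (mul_ne_zero h0 h1.1)
    rw [ord_mul h0 h1.1, h1.2] at h2
    linarith
  refine ⟨s, hs, t, ht, hs0, fun y z h hz ↦ ?_, ?_⟩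
  · have hzge := ge_half_of_psi B C hz
    have hst : w.OrdGE 0 (s * z + t) := ((hs0.mul hzge).mono (by linarith)).add ht0
    have hR := equation_sub (s := s) (t := t) h
    refine (B.ge_of_quadratic (q := 5 * e / 4) (by linarith) hst ?_ hR).mono (by linarith)
    rw [show z ^ 3 + (a₂ - s ^ 2) * z ^ 2 + (a₄ - 2 * s * t) * z + (a₆ - t ^ 2) =
      z ^ 3 + (a₂ + m / q - s ^ 2) * z ^ 2 + (a₄ - 2 * s * t) * z
        - m / q * (z ^ 2 - 2 * q) by rw [hm]; field_simp; ring]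
    refine OrdGE.sub (OrdGE.add (OrdGE.add ?_ ?_) ?_) ?_
    · exact (hzge.pow 3 (by norm_num)).mono (by norm_num; linarith)
    · exact (hs2.sub_comm.mul (hzge.pow 2 (by norm_num))).mono (by norm_num; linarith)
    · exact ((C.ge₄.sub (((B.ge_two.mul hs0).mul ht0).mono (by linarith))).mul hzge).mono
        (by linarith)
    · exact (hmq.mul (hzq z hz)).mono (by linarith)
  · by_cases hme : w.OrdGE e m
    · right
      have hmqe : w.OrdGE e (m / q) := by simpa [hqo] using hme.div (y := q)
      have has : w.OrdGE e (a₂ - s ^ 2) := by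
        have := hs2.sub_comm.sub hmqe
        rwa [show a₂ + m / q - s ^ 2 - m / q = a₂ - s ^ 2 by ring] at this
      refine ⟨has, fun y z h hz ↦ ?_⟩
      have hzge := ge_half_of_psi B C hz
      have hst : w.OrdGE 0 (s * z + t) := ((hs0.mul hzge).mono (by linarith)).add ht0
      have hu0 : w.OrdGE 0 (s * t - (q + a₄ / 2)) :=
        ((hs0.mul ht0).mono (by linarith)).sub (hqge.add ha₄2)
      -- Modulo `2`, both `(s t) ^ 2` and `(q + a₄ / 2) ^ 2` are congruent to `a₂ a₆`. The square
      -- root loses a factor of two in the bound, but `disc` restores it because the element lies in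
      -- the base field.
      have hu2 : w.OrdGE e ((s * t - (q + a₄ / 2)) ^ 2) := by
        rw [show (s * t - (q + a₄ / 2)) ^ 2 = s ^ 2 * (t ^ 2 - a₆) - (a₂ - s ^ 2) * a₆
          - (q ^ 2 - β) - 2 * (q * (a₄ / 2)) - 2 * ((q + a₄ / 2) * (s * t - (q + a₄ / 2)))
          by rw [hβ]; ring]
        refine OrdGE.sub (OrdGE.sub (OrdGE.sub (OrdGE.sub ?_ ?_) hq2) ?_) ?_
        · exact ((hs0.pow 2 (by norm_num)).mul ht2).mono (by linarith)
        · exact (has.mul (.of_eq C.ord₆)).mono (by linarith)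
        · exact (B.ge_two.mul (hqge.mul ha₄2)).mono (by linarith)
        · exact (B.ge_two.mul ((hqge.add ha₄2).mul hu0)).mono (by linarith)
      have hu : w.OrdGE e (s * t - (q + a₄ / 2)) :=
        B.disc _ (sub_mem (mul_mem hs ht) (add_mem hq ha₄k)) (e / 2) (by linarith) hu2.of_sq
      have hR := equation_sub (s := s) (t := t) h
      refine (B.ge_of_quadratic (q := 7 * e / 4) (by linarith) hst ?_ hR).mono (by linarith)
      rw [show z ^ 3 + (a₂ - s ^ 2) * z ^ 2 + (a₄ - 2 * s * t) * z + (a₆ - t ^ 2) =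
        z * (z ^ 2 - 2 * q) + (a₂ - s ^ 2) * z ^ 2 - 2 * (s * t - (q + a₄ / 2)) * z + 2 * m by
          rw [hm]; field_simp; ring]
      refine OrdGE.add (OrdGE.sub (OrdGE.add ?_ ?_) ?_) ?_
      · exact (hzge.mul (hzq z hz)).mono (by linarith)
      · exact (has.mul (hzge.pow 2 (by norm_num))).mono (by norm_num; linarith)
      · exact ((B.ge_two.mul hu).mul hzge).mono (by linarith)
      · exact (B.ge_two.mul hme).mono (by linarith)
    · left
      have hmne : m ≠ 0 := fun h0 ↦ hme (Or.inl h0)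
      have hmo : w.ord m = 0 := by
        refine le_antisymm ?_ (hm0.le_ord hmne)
        by_contra! hlt
        exact hme (B.disc m hmk _ hlt (.refl m))
      have h1 := ord_eq_of_sub (y := a₂ - s ^ 2) (x := -(m / q)) (q := e)
        (neg_ne_zero.2 (div_ne_zero hmne hq0))
        (by rw [show a₂ - s ^ 2 - -(m / q) = a₂ + m / q - s ^ 2 by ring]; exact hs2.sub_comm)
        (by rw [ord_neg, ord_div hmne hq0, hmo, hqo]; linarith)
      rw [ord_neg, ord_div hmne hq0, hmo, hqo, sub_self] at h1
      exact h1

/-- If the constant term of `psi` has order exactly `2 e`, an automorphism moving the abscissa of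
a point `P` acts trivially to order at most `e / 24`. Here `z₃` is the abscissa of `P + σ P`. -/
lemma le_of_moves (hσ : ∀ a ∈ k, σ a = a) (hn : w.ActsTriviallyTo σ n)
    (hc0 : 4 * a₂ * a₆ - a₄ ^ 2 ≠ 0) (hc : w.ord (4 * a₂ * a₆ - a₄ ^ 2) = 2 * e)
    {y z z₃ : L} (h : y ^ 2 = z ^ 3 + a₂ * z ^ 2 + a₄ * z + a₆) (hz : psi a₂ a₄ a₆ z = 0)
    (hne : σ z ≠ z) (hz₃ : psi a₂ a₄ a₆ z₃ = 0)
    (hl : ((σ y - y) / (σ z - z)) ^ 2 = a₂ + z + σ z + z₃) : n ≤ e / 24 := by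
  have he := B.pos
  obtain ⟨s, hs, t, ht, hs0, h58, hor⟩ := exists_approx B C hc0 hc
  set l := (σ y - y) / (σ z - z) with hl'
  have hd0 : σ z - z ≠ 0 := sub_ne_zero.2 hne
  have hd : w.ord (σ z - z) = 2 * e / 3 := ord_sub B C h hz (psi_map hσ C hz) hne.symm
  -- Here `l` is the slope of the line through `P` and `σ P`. The bound sought is `2 e / 3 + ord (l
  -- - s) - q`, which is `2/3 + 0 - 5/8` or `2/3 + 1/4 - 7/8` times `e`, that is `e / 24` in both
  -- cases.
  have hmove : σ (y - s * z - t) - (y - s * z - t) = (σ z - z) * (l - s) := by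
    rw [hl']
    simp only [_root_.map_sub, map_mul, hσ _ hs, hσ _ ht]
    field_simp; ring
  have hzge := ge_half_of_psi B C hz
  have hz2ge := ge_half_of_psi B C (psi_map hσ C hz)
  have hz3ge := ge_half_of_psi B C hz₃
  rcases hor with ⟨h0, ho⟩ | ⟨hge, h78⟩
  · have hls : w.OrdGE (e / 2) (l ^ 2 - s ^ 2 - (a₂ - s ^ 2)) := by
      rw [hl, show a₂ + z + σ z + z₃ - s ^ 2 - (a₂ - s ^ 2) = z + σ z + z₃ by ring]
      exact (hzge.add hz2ge).add hz3ge
    obtain ⟨h1, h2⟩ := ord_eq_of_sub h0 hls (by linarith)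
    rw [ho] at h2
    have hls0 : l - s ≠ 0 := fun h' ↦ h1 (by linear_combination (l + s) * h')
    have hlso : w.ord (l - s) ≤ 0 := by
      by_contra! hpos
      have h3 : w.OrdGE (min (w.ord (l - s)) e) (l - s + 2 * s) :=
        ((OrdGE.refl _).mono (min_le_left _ _)).add
          ((B.ge_two.mul hs0).mono (by simp))
      have h4 := ((OrdGE.refl (w := w) (l - s)).mul h3)
      rw [show (l - s) * (l - s + 2 * s) = l ^ 2 - s ^ 2 by ring] at h4
      have h5 := h4.le_ord h1
      have : 0 < min (w.ord (l - s)) e := lt_min hpos he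
      linarith
    have := hn.le (h58 y z h hz) hmove (mul_ne_zero hd0 hls0)
    rw [ord_mul hd0 hls0, hd] at this
    linarith
  · obtain ⟨hz0, hzo⟩ := ord_eq_half_of_psi B C hz hc0 hc
    have h23 : w.OrdGE (2 * e / 3) (z₃ - z) := by
      rcases eq_or_ne z₃ z with h' | h'
      · exact Or.inl (sub_eq_zero.2 h')
      · exact .of_eq (ord_sub B C h hz hz₃ h'.symm)
    -- The three abscissae agree to order `2 e / 3`, so their sum is `3 z` to that precision and `l
    -- ^ 2 - s ^ 2` has order `e / 2`. As `l + s` and `l - s` differ by the even element `2 s`, the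
    -- factor `l - s` has order at most `e / 4`.
    have hls : w.OrdGE (2 * e / 3) (l ^ 2 - s ^ 2 - 3 * z) := by
      rw [hl, show a₂ + z + σ z + z₃ - s ^ 2 - 3 * z =
        (a₂ - s ^ 2) + (σ z - z) + (z₃ - z) by ring]
      exact ((hge.mono (by linarith)).add (.of_eq hd)).add h23
    have h3z : w.ord (3 * z) = e / 2 := by rw [ord_mul B.three.1 hz0, B.three.2, hzo, zero_add]
    obtain ⟨h1, h2⟩ := ord_eq_of_sub (mul_ne_zero B.three.1 hz0) hls (by linarith)
    rw [h3z] at h2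
    have hls0 : l - s ≠ 0 := fun h' ↦ h1 (by linear_combination (l + s) * h')
    have hlso : w.ord (l - s) ≤ e / 4 := by
      by_contra! hpos
      have h3 : w.OrdGE (min (w.ord (l - s)) e) (l - s + 2 * s) :=
        ((OrdGE.refl _).mono (min_le_left _ _)).add
          ((B.ge_two.mul hs0).mono (by simp))
      have h4 := ((OrdGE.refl (w := w) (l - s)).mul h3)
      rw [show (l - s) * (l - s + 2 * s) = l ^ 2 - s ^ 2 by ring] at h4
      have h5 := h4.le_ord h1
      have : e / 4 < min (w.ord (l - s)) e := lt_min hpos (by linarith)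
      linarith
    have := hn.le (h78 y z h hz) hmove (mul_ne_zero hd0 hls0)
    rw [ord_mul hd0 hls0, hd] at this
    linarith

end DyadicCurve

/-! ### Points of order 3 on `y ^ 2 = cubic` -/

namespace WeierstrassCurve

open DyadicCurve (psi)

section ThreeTorsion

variable {L : Type*} [Field L] [DecidableEq L] {W : WeierstrassCurve L}

omit [DecidableEq L] in
lemma equation_of_nonsingular (h₁ : W.a₁ = 0) (h₃ : W.a₃ = 0) {x y : L}
    (h : W.toAffine.Nonsingular x y) : y ^ 2 = x ^ 3 + W.a₂ * x ^ 2 + W.a₄ * x + W.a₆ := by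
  have := (Affine.equation_iff _ _).1 h.1
  rw [h₁, h₃] at this
  linear_combination this

/-- From `2 P = -P`, the duplication formula must return the abscissa `x`; clearing the denominator
`(2 y) ^ 2` gives `psi`. -/
lemma psi_eq_zero_of_three_nsmul (h2 : (2 : L) ≠ 0) (h₁ : W.a₁ = 0) (h₃ : W.a₃ = 0) {x y : L}
    {h : W.toAffine.Nonsingular x y} (hP : 3 • Affine.Point.some x y h = 0) :
    psi W.a₂ W.a₄ W.a₆ x = 0 := by
  have heq := equation_of_nonsingular h₁ h₃ h
  have h2P : Affine.Point.some x y h + Affine.Point.some x y h = -Affine.Point.some x y h := by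
    rw [eq_neg_iff_add_eq_zero, ← hP]; abel
  by_cases hy : y = W.toAffine.negY x y
  · rw [Affine.Point.add_self_of_Y_eq hy] at h2P
    exact absurd (neg_eq_zero.1 h2P.symm) (Affine.Point.some_ne_zero h)
  · rw [Affine.Point.add_self_of_Y_ne hy, Affine.Point.neg_some, Affine.Point.some.injEq,
      Affine.slope_of_Y_ne rfl hy] at h2P
    simp only [Affine.negY, h₁, h₃, zero_mul, sub_zero, Affine.addX, add_zero] at h2P hy
    have hy0 : y ≠ 0 := by rintro rfl; simp at hy
    have h3 := h2P.1
    rw [sub_neg_eq_add, ← two_mul, div_pow, sub_sub, sub_sub, sub_eq_iff_eq_add,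
      div_eq_iff (pow_ne_zero 2 (mul_ne_zero h2 hy0))] at h3
    rw [psi]
    linear_combination -h3 - (4 * (3 * x + W.a₂)) * heq

/-- The witness is the abscissa of the sum of the two points, which is again a 3-torsion point; the
second claim is the chord formula. -/
lemma exists_sum_of_three_nsmul (h2 : (2 : L) ≠ 0) (h₁ : W.a₁ = 0) (h₃ : W.a₃ = 0)
    {x₁ y₁ x₂ y₂ : L} {hn₁ : W.toAffine.Nonsingular x₁ y₁} {hn₂ : W.toAffine.Nonsingular x₂ y₂}
    (hP : 3 • Affine.Point.some x₁ y₁ hn₁ = 0) (hQ : 3 • Affine.Point.some x₂ y₂ hn₂ = 0)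
    (hne : x₁ ≠ x₂) : ∃ x₃, psi W.a₂ W.a₄ W.a₆ x₃ = 0 ∧
      ((y₂ - y₁) / (x₂ - x₁)) ^ 2 = W.a₂ + x₁ + x₂ + x₃ := by
  have hadd := Affine.Point.add_of_X_ne (h₁ := hn₁) (h₂ := hn₂) hne
  have hPQ : 3 • (Affine.Point.some x₁ y₁ hn₁ + Affine.Point.some x₂ y₂ hn₂) = 0 := by
    rw [smul_add, hP, hQ, add_zero]
  rw [hadd] at hPQ
  refine ⟨_, psi_eq_zero_of_three_nsmul h2 h₁ h₃ hPQ, ?_⟩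
  rw [Affine.slope_of_X_ne hne, Affine.addX, h₁, ← neg_div_neg_eq, neg_sub, neg_sub]
  ring

open Polynomial in
/-- The `3`-division polynomial of `y ^ 2 = x ^ 3 + a₂ x ^ 2 + a₄ x + a₆`. -/
def psiPoly {R : Type*} [Field R] (W : WeierstrassCurve R) : R[X] :=
  C 3 * X ^ 4 + C (4 * W.a₂) * X ^ 3 + C (6 * W.a₄) * X ^ 2 + C (12 * W.a₆) * X +
    C (4 * W.a₂ * W.a₆ - W.a₄ ^ 2)

omit [DecidableEq L] in
open Polynomial in
lemma natDegree_psiPoly_le : W.psiPoly.natDegree ≤ 4 := by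
  unfold psiPoly; compute_degree

omit [DecidableEq L] in
open Polynomial in
lemma psiPoly_ne_zero (h3 : (3 : L) ≠ 0) : W.psiPoly ≠ 0 := by
  intro h
  have : W.psiPoly.coeff 4 = 3 := by unfold psiPoly; compute_degree!
  rw [h] at this
  exact h3 (by simpa using this.symm)

omit [DecidableEq L] in
open Polynomial in
lemma eval_psiPoly (x : L) : W.psiPoly.eval x = psi W.a₂ W.a₄ W.a₆ x := by
  simp [psiPoly, psi]

open Polynomial in
/-- A finite set containing the coordinates of all points of order `3`. -/
def threeTorsionCoords (W : WeierstrassCurve L) : Finset (L × L) :=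
  W.psiPoly.roots.toFinset.biUnion fun x ↦
    (nthRoots 2 (x ^ 3 + W.a₂ * x ^ 2 + W.a₄ * x + W.a₆)).toFinset.image (Prod.mk x)

open Polynomial in
lemma card_threeTorsionCoords_le : W.threeTorsionCoords.card ≤ 8 := by
  refine (Finset.card_biUnion_le_card_mul _ _ 2 fun x _ ↦ ?_).trans ?_
  · refine Finset.card_image_le.trans ?_
    exact (Multiset.toFinset_card_le _).trans (card_nthRoots _ _)
  · have : W.psiPoly.roots.toFinset.card ≤ 4 :=
      (Multiset.toFinset_card_le _).trans ((card_roots' _).trans natDegree_psiPoly_le)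
    omega

lemma mem_threeTorsionCoords (h2 : (2 : L) ≠ 0) (h3 : (3 : L) ≠ 0) (h₁ : W.a₁ = 0)
    (h₃ : W.a₃ = 0) {x y : L} {h : W.toAffine.Nonsingular x y}
    (hP : 3 • Affine.Point.some x y h = 0) : (x, y) ∈ W.threeTorsionCoords := by
  rw [threeTorsionCoords, Finset.mem_biUnion]
  refine ⟨x, ?_, Finset.mem_image.2 ⟨y, ?_, rfl⟩⟩
  · rw [Multiset.mem_toFinset, Polynomial.mem_roots (psiPoly_ne_zero h3), Polynomial.IsRoot,
      eval_psiPoly, psi_eq_zero_of_three_nsmul h2 h₁ h₃ hP]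
  · rw [Multiset.mem_toFinset, Polynomial.mem_nthRoots two_pos, equation_of_nonsingular h₁ h₃ h]

/-- There are at most `9` points of order dividing `3`. -/
lemma card_threeTorsion_le (h2 : (2 : L) ≠ 0) (h3 : (3 : L) ≠ 0) (h₁ : W.a₁ = 0)
    (h₃ : W.a₃ = 0) :
    Finite {P : W.toAffine.Point | 3 • P = 0} ∧
      Nat.card {P : W.toAffine.Point | 3 • P = 0} ≤ 9 := by
  let g : {P : W.toAffine.Point | 3 • P = 0} → Option W.threeTorsionCoords
    | ⟨.zero, _⟩ => none
    | ⟨.some x y h, hP⟩ => some ⟨(x, y), mem_threeTorsionCoords h2 h3 h₁ h₃ hP⟩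
  have hg : Function.Injective g := by
    rintro ⟨_ | ⟨x, y, h⟩, hP⟩ ⟨_ | ⟨x', y', h'⟩, hP'⟩ heq
    · rfl
    · simp [g] at heq
    · simp [g] at heq
    · simp only [g, Option.some.injEq, Subtype.mk.injEq, Prod.mk.injEq] at heq
      obtain ⟨rfl, rfl⟩ := heq
      rfl
  refine ⟨Finite.of_injective g hg, (Nat.card_le_card_of_injective g hg).trans ?_⟩
  rw [Nat.card_eq_fintype_card, Fintype.card_option, Fintype.card_coe]
  have := card_threeTorsionCoords_le (W := W)
  omega

end ThreeTorsion

/-- If an endomorphism acts on the `3`-torsion by signs, it acts by a single sign. -/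
lemma eq_neg_of_forall_eq_or_eq_neg {G : Type*} [AddCommGroup G] (f : G →+ G)
    (hf : ∀ P, 3 • P = 0 → f P = P ∨ f P = -P) {P Q : G} (hP : 3 • P = 0) (hPf : f P ≠ P)
    (hQ : 3 • Q = 0) : f Q = -Q := by
  have hP' := (hf P hP).resolve_left hPf
  rcases hf Q hQ with h | h
  · rcases hf (P + Q) (by rw [smul_add, hP, hQ, add_zero]) with h' | h'
    · rw [map_add, hP', h, add_left_inj] at h'
      exact absurd (hP'.trans h') hPf
    · rw [map_add, hP', h, neg_add, add_right_inj] at h'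
      rw [h, ← h']
  · exact h

end WeierstrassCurve

/-! ### Division fields and torsion codimensions -/

namespace WeierstrassCurve

open DyadicCurve (psi)

variable {K : Type*} [Field K] {W : WeierstrassCurve K}

lemma torsionCodim_bot (L : Type*) [Field L] [Algebra K L] (ℓ : ℕ) :
    torsionCodim L W ℓ ⊥ = 0 := by
  simp [torsionCodim]

lemma swanTerm_eq_zero_of_subsingleton (ℓ : ℕ) (L : Type*) [Field L] [Algebra K L]
    [Subsingleton Gal(L/K)] (w : Ideal (𝓞 L)) : swanTerm W ℓ L w = 0 := by
  rw [swanTerm, ← finsum_zero (M := ℚ) (α := ℕ)]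
  refine finsum_congr fun i ↦ ?_
  rw [Subsingleton.elim (lowerRamificationGroup K w (i + 1)) ⊥, torsionCodim_bot]
  simp

/-- The `2`-division field is trivial if the cubic polynomial splits. -/
lemma divisionField_two_eq_bot (h2 : (2 : K) ≠ 0) (h₁ : W.a₁ = 0) (h₃ : W.a₃ = 0) {A B : K}
    (ha₂ : W.a₂ = B - A) (ha₄ : W.a₄ = -(A * B)) (ha₆ : W.a₆ = 0) :
    divisionField W 2 = ⊥ := by
  classical
  rw [divisionField, IntermediateField.adjoin_eq_bot_iff]
  rintro z ⟨x, y, h, hP, hz⟩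
  have h2' : (2 : AlgebraicClosure K) ≠ 0 := by
    rw [← map_ofNat (algebraMap K (AlgebraicClosure K)) 2]
    exact (map_ne_zero _).2 h2
  have heq := equation_of_nonsingular (W := W.baseChange (AlgebraicClosure K))
    (by simp [baseChange, h₁]) (by simp [baseChange, h₃]) h
  have hneg : Affine.Point.some x y h = -Affine.Point.some x y h := by
    rw [eq_neg_iff_add_eq_zero, ← hP, two_nsmul]
  rw [Affine.Point.neg_some, Affine.Point.some.injEq, Affine.negY] at hneg
  have hy : y = 0 := by
    have := hneg.2
    simp only [baseChange, map_a₁, map_a₃, h₁, h₃, map_zero] at this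
    have h0 : 2 * y = 0 := by linear_combination this
    exact (mul_eq_zero.1 h0).resolve_left h2'
  simp only [baseChange, map_a₂, map_a₄, map_a₆, ha₂, ha₄, ha₆, hy, map_sub, map_neg, map_mul,
    map_zero] at heq
  have hx : x * (x - algebraMap _ _ A) * (x + algebraMap _ _ B) = 0 := by linear_combination -heq
  rcases hz with rfl | rfl
  · rcases mul_eq_zero.1 hx with hx | hx
    · rcases mul_eq_zero.1 hx with hx | hx
      · rw [hx]; exact zero_mem _
      · rw [sub_eq_zero.1 hx]; exact algebraMap_mem _ A
    · rw [eq_neg_of_add_eq_zero_left hx, ← map_neg]; exact algebraMap_mem _ _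
  · rw [hy]; exact zero_mem _

section Three

/-- Endomorphisms of the algebraic closure over `K` permute the torsion points, hence preserve the
set of generators. -/
lemma divisionField_normal (ℓ : ℕ) : Normal K (divisionField W ℓ) := by
  classical
  rw [IntermediateField.normal_iff_forall_map_le]
  intro σ
  rw [divisionField, IntermediateField.adjoin_map]
  refine IntermediateField.adjoin.mono _ _ _ ?_
  rintro _ ⟨z, ⟨x, y, h, hP, hz⟩, rfl⟩
  refine ⟨σ x, σ y, (Affine.baseChange_nonsingular (W := W) σ.injective ..).2 h, ?_, ?_⟩
  · rw [← Affine.Point.map_some (W' := W.toAffine) σ h]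
    have := congrArg (Affine.Point.map (W' := W.toAffine) σ) hP
    rw [map_nsmul, map_zero] at this
    exact this
  · rcases hz with rfl | rfl
    · exact Or.inl rfl
    · exact Or.inr rfl

variable [CharZero K] (h₁ : W.a₁ = 0) (h₃ : W.a₃ = 0)
include h₁ h₃

lemma divisionField_three_finiteDimensional : FiniteDimensional K (divisionField W 3) := by
  classical
  have : CharZero (AlgebraicClosure K) := charZero_of_injective_algebraMap
    (algebraMap K (AlgebraicClosure K)).injective
  have hfin : ({z | ∃ (x y : AlgebraicClosure K)
      (h : (W.baseChange (AlgebraicClosure K)).toAffine.Nonsingular x y),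
      3 • Affine.Point.some x y h = 0 ∧ (z = x ∨ z = y)}).Finite := by
    refine ((W.baseChange (AlgebraicClosure K)).threeTorsionCoords.image Prod.fst ∪
      (W.baseChange (AlgebraicClosure K)).threeTorsionCoords.image Prod.snd).finite_toSet.subset ?_
    rintro z ⟨x, y, h, hP, hz⟩
    have hmem := mem_threeTorsionCoords (by norm_num) (by norm_num)
      (by simp [baseChange, h₁]) (by simp [baseChange, h₃]) hP
    rw [Finset.mem_coe, Finset.mem_union, Finset.mem_image, Finset.mem_image]
    rcases hz with rfl | rfl
    · exact Or.inl ⟨_, hmem, rfl⟩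
    · exact Or.inr ⟨_, hmem, rfl⟩
  have := hfin.to_subtype
  rw [divisionField]
  refine IntermediateField.finiteDimensional_adjoin fun x _ ↦ ?_
  exact (Algebra.IsAlgebraic.isAlgebraic x).isIntegral

omit [CharZero K] h₁ h₃ in
/-- An automorphism of the division field fixing all torsion points is trivial. -/
lemma eq_one_of_forall_map_eq {ℓ : ℕ} [DecidableEq (divisionField W ℓ)]
    (σ : Gal(divisionField W ℓ/K))
    (hσ : ∀ P : (W.baseChange (divisionField W ℓ)).toAffine.Point, ℓ • P = 0 →
      Affine.Point.map (W' := W.toAffine) (σ : divisionField W ℓ →ₐ[K] divisionField W ℓ) P = P) :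
    σ = 1 := by
  classical
  have : (σ : divisionField W ℓ →ₐ[K] divisionField W ℓ) = AlgHom.id K _ := by
    refine IntermediateField.algHom_ext_of_eq_adjoin K (S := divisionField W ℓ) rfl ?_
    rintro z ⟨x, y, h, hP, hz⟩
    have hx : x ∈ divisionField W ℓ :=
      IntermediateField.subset_adjoin _ _ ⟨x, y, h, hP, Or.inl rfl⟩
    have hy : y ∈ divisionField W ℓ :=
      IntermediateField.subset_adjoin _ _ ⟨x, y, h, hP, Or.inr rfl⟩
    have hL : (W.baseChange (divisionField W ℓ)).toAffine.Nonsingular ⟨x, hx⟩ ⟨y, hy⟩ :=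
      (Affine.baseChange_nonsingular (W := W) (f := (divisionField W ℓ).val)
        (divisionField W ℓ).val.injective ⟨x, hx⟩ ⟨y, hy⟩).1 h
    have hPL : ℓ • Affine.Point.some _ _ hL = 0 := by
      apply Affine.Point.map_injective (W' := W.toAffine) (divisionField W ℓ).val
      rw [map_nsmul, Affine.Point.map_some, map_zero]
      exact hP
    have := hσ _ hPL
    rw [Affine.Point.map_some, Affine.Point.some.injEq] at this
    rcases hz with rfl | rfl
    · exact this.1
    · exact this.2
  ext x
  exact congrArg Subtype.val (DFunLike.congr_fun this x)

-- There are at most nine points killed by `3`, so the index is at most `9 = 3 ^ 2`.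
omit [CharZero K] in
lemma torsionCodim_three_le (L : Type*) [Field L] [CharZero L] [Algebra K L]
    (H : Subgroup Gal(L/K)) : torsionCodim L W 3 H ≤ 2 := by
  classical
  obtain ⟨hfin, hcard⟩ := card_threeTorsion_le (L := L) (W := W.baseChange L) (by norm_num)
    (by norm_num) (by simp [baseChange, h₁]) (by simp [baseChange, h₃])
  rw [torsionCodim]
  have hle : (torsionFixedBy L W 3 H).relIndex (torsionFixedBy L W 3 ⊥) ≤ 9 := by
    rw [AddSubgroup.relIndex, AddSubgroup.index]
    let g : {P : (W.baseChange L).toAffine.Point | 3 • P = 0} → torsionFixedBy L W 3 ⊥ :=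
      fun P ↦ ⟨P.1, by
        refine ⟨?_, fun σ hσ ↦ ?_⟩
        · exact P.2
        · rw [Subgroup.mem_bot.1 hσ]
          exact Affine.Point.map_id _⟩
    have hg : Function.Surjective g := by
      rintro ⟨P, hP⟩
      exact ⟨⟨P, hP.1⟩, rfl⟩
    exact (Nat.card_le_card_of_surjective _ ((QuotientAddGroup.mk_surjective).comp hg)).trans hcard
  calc Nat.log 3 _ ≤ Nat.log 3 9 := Nat.log_mono_right hle
    _ = 2 := by norm_num

end Three

end WeierstrassCurve

/-! ### Ramification groups and extensions of places -/

namespace IsDedekindDomain.HeightOneSpectrum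

open Valuation WeierstrassCurve

lemma ordGE_iff_mem_pow {R K : Type*} [CommRing R] [IsDedekindDomain R] [Field K] [Algebra R K]
    [IsFractionRing R K] (v : HeightOneSpectrum R) (x : R) (n : ℕ) :
    (v.valuation K).OrdGE n (algebraMap R K x) ↔ x ∈ v.asIdeal ^ n := by
  rw [← v.intValuation_le_pow_iff_mem, ← v.valuation_of_algebraMap (K := K), OrdGE]
  rcases eq_or_ne x 0 with rfl | hx
  · simp
  have hx' : algebraMap R K x ≠ 0 := by simpa using hx
  simp only [hx', false_or, ord]
  rw [← Int.cast_natCast, Int.cast_le, le_neg,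
    WithZero.log_le_iff_le_exp ((v.valuation K).ne_zero_iff.2 hx')]

lemma ordGE_one_iff_mem {R K : Type*} [CommRing R] [IsDedekindDomain R] [Field K] [Algebra R K]
    [IsFractionRing R K] (v : HeightOneSpectrum R) (x : R) :
    (v.valuation K).OrdGE 1 (algebraMap R K x) ↔ x ∈ v.asIdeal := by
  simpa using v.ordGE_iff_mem_pow (K := K) x 1

/-- Elements outside of a prime have order `0`. -/
lemma ord_eq_zero {R K : Type*} [CommRing R] [IsDedekindDomain R] [Field K] [Algebra R K]
    [IsFractionRing R K] (v : HeightOneSpectrum R) {x : R} (hx : x ∉ v.asIdeal) :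
    algebraMap R K x ≠ 0 ∧ (v.valuation K).ord (algebraMap R K x) = 0 := by
  have h0 : algebraMap R K x ≠ 0 := by
    rw [Ne, FaithfulSMul.algebraMap_eq_zero_iff]
    rintro rfl; exact hx (zero_mem _)
  exact ⟨h0, (ord_eq_zero_iff h0).2 ((v.valuation_eq_one_iff_notMem).2 hx)⟩

section Ramification

variable {K L : Type*} [Field K] [Field L] [Algebra K L]

/-- Elements of the higher ramification groups act trivially to the corresponding order. -/
lemma actsTriviallyTo [NumberField L] (w : HeightOneSpectrum (𝓞 L)) {i : ℕ} (hi : 1 ≤ i)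
    {σ : Gal(L/K)} (hσ : σ ∈ lowerRamificationGroup K w.asIdeal i) :
    (w.valuation L).ActsTriviallyTo (σ : L →+* L) i := by
  have hi' : (1 : ℚ) ≤ i := by exact_mod_cast hi
  have hint : ∀ x : 𝓞 L, (w.valuation L).OrdGE (i + 1)
      (σ (algebraMap (𝓞 L) L x) - algebraMap (𝓞 L) L x) := fun x ↦ by
    have := (w.ordGE_iff_mem_pow (K := L) (σ • x - x) (i + 1)).2 (hσ x)
    rw [_root_.map_sub] at this
    exact_mod_cast this
  -- The elements with `σ z / z ≡ 1` to order `i` form a multiplicative group. It contains every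
  -- nonzero integer `x` of order at most `1`, because `σ x - x` has order at least `i + 1`. A
  -- uniformizer and quotients of integers prime to `w` are thus in it, and these generate all of
  -- `Lˣ`.
  let T : Submonoid L :=
    { carrier := {z | (w.valuation L).OrdGE i (σ z / z - 1) ∧ z ≠ 0}
      one_mem' := by simp [OrdGE]
      mul_mem' := by
        rintro y z ⟨hy, hy0⟩ ⟨hz, hz0⟩
        refine ⟨?_, mul_ne_zero hy0 hz0⟩
        rw [map_mul, show σ y * σ z / (y * z) - 1 =
          (σ y / y - 1) * (σ z / z - 1) + (σ y / y - 1) + (σ z / z - 1) by field_simp; ring]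
        exact (((hy.mul hz).mono (by linarith)).add hy).add hz }
  have hinv : ∀ z ∈ T, z⁻¹ ∈ T := by
    rintro z ⟨hz, hz0⟩
    refine ⟨?_, inv_ne_zero hz0⟩
    have hσz : σ z ≠ 0 := by simpa using hz0
    obtain ⟨h1, h2⟩ := ord_eq_of_sub one_ne_zero hz (by rw [ord_one]; linarith)
    have h3 := (hz.div (y := σ z / z)).neg
    rw [h2, ord_one, sub_zero] at h3
    convert h3 using 1
    rw [map_inv₀]; field_simp; ring
  have hone : ∀ x : 𝓞 L, algebraMap (𝓞 L) L x ≠ 0 →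
      (w.valuation L).ord (algebraMap (𝓞 L) L x) ≤ 1 → algebraMap (𝓞 L) L x ∈ T := by
    intro x hx0 hx
    refine ⟨?_, hx0⟩
    have := (hint x).div (y := algebraMap (𝓞 L) L x)
    rw [sub_div, div_self hx0] at this
    exact this.mono (by linarith)
  obtain ⟨π, hπ⟩ := w.valuation_exists_uniformizer' L
  change w.valuation L (algebraMap (𝓞 L) L π) = _ at hπ
  have hπ0 : algebraMap (𝓞 L) L π ≠ 0 := by
    rintro h0
    rw [h0, map_zero] at hπ
    exact WithZero.exp_ne_zero hπ.symm
  have hπT : algebraMap (𝓞 L) L π ∈ T := hone π hπ0 (by simp [ord, hπ])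
  have hzpow : ∀ n : ℤ, algebraMap (𝓞 L) L π ^ n ∈ T := by
    rintro (n | n)
    · simpa using pow_mem hπT n
    · rw [zpow_negSucc]; exact hinv _ (pow_mem hπT _)
  have hunit : ∀ u : L, u ≠ 0 → w.valuation L u = 1 → u ∈ T := by
    intro u hu0 hu
    obtain ⟨n, d, hnd⟩ := w.exists_primeCompl_mul_eq_of_integer u hu.le
    have hd := w.ord_eq_zero (K := L) d.2
    have hn0 : algebraMap (𝓞 L) L n ≠ 0 := by
      rw [← hnd]; exact mul_ne_zero hu0 hd.1
    have hn : (w.valuation L).ord (algebraMap (𝓞 L) L n) = 0 := by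
      rw [← hnd, ord_mul hu0 hd.1, hd.2, (ord_eq_zero_iff hu0).2 hu, add_zero]
    rw [eq_div_of_mul_eq hd.1 hnd, div_eq_mul_inv]
    exact T.mul_mem (hone n hn0 (by rw [hn]; exact zero_le_one))
      (hinv _ (hone d hd.1 (by rw [hd.2]; exact zero_le_one)))
  intro z
  rcases eq_or_ne z 0 with rfl | hz0
  · exact Or.inl (by simp)
  have hz : z ∈ T := by
    have hval : w.valuation L z ≠ 0 := (w.valuation L).ne_zero_iff.2 hz0
    have : w.valuation L (z * algebraMap (𝓞 L) L π ^ WithZero.log (w.valuation L z)) = 1 := by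
      rw [map_mul, map_zpow₀, hπ, ← WithZero.exp_zsmul, smul_neg, zsmul_one, WithZero.exp_neg]
      rw [Int.cast_id, WithZero.exp_log hval, mul_inv_cancel₀ hval]
    have h1 := T.mul_mem (hunit _ (mul_ne_zero hz0 (zpow_ne_zero _ hπ0)) this)
      (hzpow (-WithZero.log (w.valuation L z)))
    rwa [mul_assoc, ← zpow_add₀ hπ0, add_neg_cancel, zpow_zero, mul_one] at h1
  have := (OrdGE.refl (w := w.valuation L) z).mul hz.1
  rw [mul_sub, mul_div_cancel₀ _ hz0, mul_one] at this
  exact this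

variable [NumberField K] [NumberField L]

lemma ord_algebraMap (v : HeightOneSpectrum (𝓞 K)) (w : HeightOneSpectrum (𝓞 L))
    [w.asIdeal.LiesOver v.asIdeal] (x : K) :
    (w.valuation L).ord (algebraMap K L x) =
      w.asIdeal.ramificationIdx (𝓞 K) * (v.valuation K).ord x := by
  rw [← Ideal.ramificationIdx'_eq_ramificationIdx v.asIdeal w.asIdeal v.ne_bot, ord,
    ← valuation_liesOver L v w x, WithZero.log_pow, ord]
  push_cast
  simp

/-- The residue field is finite of characteristic `2`, so every residue is a square. -/
lemma exists_sq_sub (v : HeightOneSpectrum (𝓞 K)) (h2 : (2 : 𝓞 K) ∈ v.asIdeal) {a : K}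
    (ha : (v.valuation K).OrdGE 0 a) : ∃ s : K, (v.valuation K).OrdGE 1 (s ^ 2 - a) := by
  obtain ⟨n, hn⟩ := v.exists_valuation_sub_lt_of_integer (ordGE_zero_iff.1 ha) 1
  rw [Units.val_one, ← ordGE_one_iff] at hn
  let := Ideal.Quotient.field v.asIdeal
  have : Finite (𝓞 K ⧸ v.asIdeal) := Ideal.finiteQuotientOfFreeOfNeBot _ v.ne_bot
  have hchar : ringChar (𝓞 K ⧸ v.asIdeal) = 2 := by
    have : CharP (𝓞 K ⧸ v.asIdeal) 2 := CharTwo.of_one_ne_zero_of_two_eq_zero one_ne_zero (by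
      rw [← map_ofNat (Ideal.Quotient.mk v.asIdeal) 2]
      exact Ideal.Quotient.eq_zero_iff_mem.2 h2)
    exact ringChar.eq _ 2
  obtain ⟨t, ht⟩ := FiniteField.isSquare_of_char_two hchar (Ideal.Quotient.mk v.asIdeal n)
  obtain ⟨s, rfl⟩ := Ideal.Quotient.mk_surjective t
  rw [← map_mul, Ideal.Quotient.eq] at ht
  refine ⟨algebraMap (𝓞 K) K s, ?_⟩
  have h3 := ((v.ordGE_one_iff_mem (K := K) _).2 ht).neg.add hn
  convert h3 using 1
  rw [_root_.map_sub, map_mul]; ring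

/-- The field `K` satisfies the axioms of `DyadicCurve.Base` if `2` is unramified. -/
lemma dyadicBase (v : HeightOneSpectrum (𝓞 K)) (w : HeightOneSpectrum (𝓞 L))
    [w.asIdeal.LiesOver v.asIdeal] (h2 : (v.valuation K).ord 2 = 1) :
    DyadicCurve.Base (w.valuation L) (algebraMap K L).fieldRange
      (w.asIdeal.ramificationIdx (𝓞 K)) := by
  have he : (0 : ℚ) < w.asIdeal.ramificationIdx (𝓞 K) := by
    exact_mod_cast Ideal.ramificationIdx_pos _ _
  have hge : ∀ (q : ℚ) (x : K), (v.valuation K).OrdGE q x →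
      (w.valuation L).OrdGE (w.asIdeal.ramificationIdx (𝓞 K) * q) (algebraMap K L x) := by
    rintro q x (rfl | h)
    · exact Or.inl (map_zero _)
    · exact Or.inr (by rw [ord_algebraMap v w]; exact mul_le_mul_of_nonneg_left h he.le)
  have hge' : ∀ (q : ℚ) (x : K), (w.valuation L).OrdGE (w.asIdeal.ramificationIdx (𝓞 K) * q)
      (algebraMap K L x) → (v.valuation K).OrdGE q x := by
    rintro q x (h | h)
    · exact Or.inl ((map_eq_zero _).1 h)
    · rw [ord_algebraMap v w] at h
      exact Or.inr (le_of_mul_le_mul_left h he)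
  have hmem2 : (2 : 𝓞 K) ∈ v.asIdeal := by
    rw [← v.ordGE_one_iff_mem (K := K), map_ofNat]
    exact OrdGE.of_eq h2
  refine ⟨he, ?_, ?_, ?_⟩
  · rw [← map_ofNat (algebraMap K L) 2, ord_algebraMap v w, h2, mul_one]
  · rintro _ ⟨x, rfl⟩ q hq h
    have := hge' (q / w.asIdeal.ramificationIdx (𝓞 K)) x (h.mono (by field_simp; exact le_rfl))
    simpa using hge 1 x (this.of_pos (div_pos hq he))
  · rintro _ ⟨x, rfl⟩ h
    obtain ⟨s, hs⟩ := v.exists_sq_sub hmem2 (hge' 0 x (by simpa using h))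
    refine ⟨algebraMap K L s, ⟨s, rfl⟩, ?_⟩
    simpa using hge 1 _ hs

/-- The order of the inertia group is the ramification index. -/
lemma card_lowerRamificationGroup_zero [IsGalois K L] (v : HeightOneSpectrum (𝓞 K))
    (w : HeightOneSpectrum (𝓞 L)) [w.asIdeal.LiesOver v.asIdeal] :
    Nat.card (lowerRamificationGroup K w.asIdeal 0) = w.asIdeal.ramificationIdx (𝓞 K) := by
  have : FiniteDimensional K L := Module.Finite.of_restrictScalars_finite ℚ K L
  have : IsGaloisGroup Gal(L/K) (𝓞 K) (𝓞 L) := IsGaloisGroup.of_isFractionRing _ _ _ K L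
  have : Finite (𝓞 K ⧸ v.asIdeal) := Ideal.finiteQuotientOfFreeOfNeBot _ v.ne_bot
  rw [lowerRamificationGroup, zero_add, pow_one,
    Ideal.card_inertia_eq_ramificationIdxIn (G := Gal(L/K)) v.asIdeal,
    Ideal.ramificationIdxIn_eq_ramificationIdx v.asIdeal w.asIdeal Gal(L/K)]

end Ramification

end IsDedekindDomain.HeightOneSpectrum

lemma Subgroup.card_le_two_of_forall {G : Type*} [Group G] (H : Subgroup G)
    (h : ∀ σ ∈ H, ∀ τ ∈ H, σ ≠ 1 → τ ≠ 1 → σ = τ) : Nat.card H ≤ 2 := by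
  classical
  have hinj : Function.Injective fun σ : H ↦ decide (σ = 1) := by
    rintro σ τ hστ
    by_cases h1 : σ = 1
    · subst h1
      exact (by simpa using hστ : τ = 1).symm
    · have h2 : τ ≠ 1 := by rintro rfl; simp [h1] at hστ
      exact Subtype.ext (h σ σ.2 τ τ.2 (by simpa using h1) (by simpa using h2))
  simpa using Nat.card_le_card_of_injective _ hinj

/-! ### Wild ramification groups acting on the 3-torsion -/

namespace WeierstrassCurve

open Valuation DyadicCurve

section Pairs

variable {K : Type*} [Field K] (W : WeierstrassCurve K) (L : Type*) [Field L] [Algebra K L]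

open Classical in
/-- The set of coordinates of `L`-rational points of order `3`. -/
def threeTorsionPairs : Set (L × L) :=
  {P | ∃ h : (W.baseChange L).toAffine.Nonsingular P.1 P.2,
    3 • Affine.Point.some P.1 P.2 h = 0}

/-- The automorphism `σ` fixes the abscissae of all `L`-rational points of order `3`. -/
def FixesAbscissae (σ : Gal(L/K)) : Prop := ∀ P ∈ W.threeTorsionPairs L, σ P.1 = P.1

variable {W L} (h₁ : W.a₁ = 0) (h₃ : W.a₃ = 0)

lemma map_mem_threeTorsionPairs (σ : Gal(L/K)) {P : L × L} (hP : P ∈ W.threeTorsionPairs L) :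
    (σ P.1, σ P.2) ∈ W.threeTorsionPairs L := by
  classical
  obtain ⟨h, hP⟩ := hP
  refine ⟨(Affine.baseChange_nonsingular (W := W) (f := (σ : L →ₐ[K] L))
    (σ : L →ₐ[K] L).injective ..).2 h, ?_⟩
  have := congrArg (Affine.Point.map (W' := W.toAffine) (σ : L →ₐ[K] L)) hP
  rw [map_nsmul, map_zero] at this
  exact this

/-- The abscissae of the points of order `3`, as a type. -/
def Abscissa (W : WeierstrassCurve K) (L : Type*) [Field L] [Algebra K L] : Type _ :=
  {x : L // ∃ y, (x, y) ∈ W.threeTorsionPairs L}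

instance : MulAction Gal(L/K) (W.Abscissa L) where
  smul σ x := ⟨σ x.1, x.2.imp' σ fun _ hy ↦ map_mem_threeTorsionPairs σ hy⟩
  one_smul _ := rfl
  mul_smul _ _ _ := rfl

include h₁ h₃

lemma equation_of_mem_threeTorsionPairs {P : L × L} (hP : P ∈ W.threeTorsionPairs L) :
    P.2 ^ 2 = P.1 ^ 3 + algebraMap K L W.a₂ * P.1 ^ 2 + algebraMap K L W.a₄ * P.1 +
      algebraMap K L W.a₆ := by
  obtain ⟨h, -⟩ := hP
  exact equation_of_nonsingular (W := W.baseChange L) (by simp [baseChange, h₁])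
    (by simp [baseChange, h₃]) h

variable [CharZero L]

lemma psi_of_mem_threeTorsionPairs {P : L × L} (hP : P ∈ W.threeTorsionPairs L) :
    psi (algebraMap K L W.a₂) (algebraMap K L W.a₄) (algebraMap K L W.a₆) P.1 = 0 := by
  classical
  obtain ⟨h, hP⟩ := hP
  exact psi_eq_zero_of_three_nsmul (W := W.baseChange L) two_ne_zero (by simp [baseChange, h₁])
    (by simp [baseChange, h₃]) hP

lemma exists_sum_of_mem_threeTorsionPairs {P Q : L × L} (hP : P ∈ W.threeTorsionPairs L)
    (hQ : Q ∈ W.threeTorsionPairs L) (hne : P.1 ≠ Q.1) :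
    ∃ x₃, psi (algebraMap K L W.a₂) (algebraMap K L W.a₄) (algebraMap K L W.a₆) x₃ = 0 ∧
      ((Q.2 - P.2) / (Q.1 - P.1)) ^ 2 = algebraMap K L W.a₂ + P.1 + Q.1 + x₃ := by
  classical
  obtain ⟨h, hP⟩ := hP
  obtain ⟨h', hQ⟩ := hQ
  exact exists_sum_of_three_nsmul (W := W.baseChange L) two_ne_zero (by simp [baseChange, h₁])
    (by simp [baseChange, h₃]) hP hQ hne

lemma card_abscissa_le : Finite (W.Abscissa L) ∧ Nat.card (W.Abscissa L) ≤ 4 := by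
  classical
  let g : W.Abscissa L → (W.baseChange L).psiPoly.roots.toFinset := fun x ↦ ⟨x.1, by
    obtain ⟨y, hy⟩ := x.2
    rw [Multiset.mem_toFinset, Polynomial.mem_roots (psiPoly_ne_zero (by norm_num)),
      Polynomial.IsRoot, eval_psiPoly]
    exact psi_of_mem_threeTorsionPairs h₁ h₃ hy⟩
  have hg : Function.Injective g := fun x y hxy ↦
    Subtype.ext (congrArg Subtype.val hxy :)
  refine ⟨Finite.of_injective g hg, (Nat.card_le_card_of_injective g hg).trans ?_⟩
  rw [Nat.card_eq_fintype_card, Fintype.card_coe]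
  exact (Multiset.toFinset_card_le _).trans
    ((Polynomial.card_roots' _).trans natDegree_psiPoly_le)

omit [CharZero L] in
open Classical in
lemma map_eq_or_eq_neg {σ : Gal(L/K)} (hσ : W.FixesAbscissae L σ)
    (P : (W.baseChange L).toAffine.Point) (hP : 3 • P = 0) :
    Affine.Point.map (W' := W.toAffine) (σ : L →ₐ[K] L) P = P ∨
      Affine.Point.map (W' := W.toAffine) (σ : L →ₐ[K] L) P = -P := by
  rcases P with _ | ⟨x, y, h⟩
  · exact Or.inl rfl
  have hmem : (x, y) ∈ W.threeTorsionPairs L := ⟨h, hP⟩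
  have hx : σ x = x := hσ _ hmem
  have e₁ := equation_of_mem_threeTorsionPairs h₁ h₃ hmem
  have e₂ := equation_of_mem_threeTorsionPairs h₁ h₃ (map_mem_threeTorsionPairs σ hmem)
  simp only [hx] at e₁ e₂
  rw [Affine.Point.map_some, Affine.Point.neg_some, Affine.Point.some.injEq,
    Affine.Point.some.injEq, Affine.negY]
  simp only [baseChange, map_a₁, map_a₃, h₁, h₃, map_zero, zero_mul, sub_zero]
  rcases sq_eq_sq_iff_eq_or_eq_neg.1 (e₂.trans e₁.symm) with h | h
  · exact Or.inl ⟨hx, h⟩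
  · exact Or.inr ⟨hx, h⟩

omit [CharZero L] in
open Classical in
/-- An automorphism fixing the abscissae but not all points changes the sign of an ordinate. -/
lemma exists_map_eq_neg {σ : Gal(L/K)} (hσ : W.FixesAbscissae L σ)
    {P : (W.baseChange L).toAffine.Point} (hP : 3 • P = 0)
    (hne : Affine.Point.map (W' := W.toAffine) (σ : L →ₐ[K] L) P ≠ P) :
    ∃ P ∈ W.threeTorsionPairs L, σ P.2 = -P.2 := by
  have := (map_eq_or_eq_neg h₁ h₃ hσ P hP).resolve_left hne
  rcases P with _ | ⟨x, y, h⟩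
  · exact absurd rfl hne
  refine ⟨(x, y), ⟨h, hP⟩, ?_⟩
  rw [Affine.Point.map_some, Affine.Point.neg_some, Affine.Point.some.injEq, Affine.negY] at this
  simpa [baseChange, h₁, h₃] using this.2

end Pairs

section Wild

variable {K L : Type*} [Field K] [Field L] [Algebra K L] [NumberField L]
  (w : HeightOneSpectrum (𝓞 L))

/-- Wild ramification groups contain no elements of prime order different from the residue
characteristic. -/
lemma eq_one_of_pow_eq_one {i p : ℕ} (hi : 1 ≤ i) {σ : Gal(L/K)}
    (hσ : σ ∈ lowerRamificationGroup K w.asIdeal i)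
    (hp : (p : L) ≠ 0 ∧ (w.valuation L).ord (p : L) = 0) (hσp : σ ^ p = 1) : σ = 1 := by
  have hi' : (0 : ℚ) < i := by exact_mod_cast hi
  ext z
  by_contra hne
  have hd : σ z - z ≠ 0 := sub_ne_zero.2 hne
  -- The sum telescopes. Every summand agrees with `d = σ z - z` up to order `ord d + i`, so `p d`
  -- has at least that order, which is impossible when `p` is a unit at `w`.
  have hsum : ∑ j ∈ Finset.range p, (σ ^ j) (σ z - z) = 0 := by
    have : ∀ j, (σ ^ j) (σ z - z) = (σ ^ (j + 1)) z - (σ ^ j) z := fun j ↦ by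
      rw [_root_.map_sub, pow_succ]; rfl
    simp_rw [this]
    rw [Finset.sum_range_sub (fun j ↦ (σ ^ j) z), hσp, pow_zero, sub_self]
  have hge : ∀ s : Finset ℕ, (w.valuation L).OrdGE ((w.valuation L).ord (σ z - z) + i)
      (∑ j ∈ s, ((σ ^ j) (σ z - z) - (σ z - z))) := by
    intro s
    induction s using Finset.induction_on with
    | empty => exact Or.inl rfl
    | insert j s hj ih =>
      rw [Finset.sum_insert hj]
      exact (w.actsTriviallyTo hi (pow_mem hσ j) (σ z - z)).add ih
  have h1 := hge (Finset.range p)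
  rw [Finset.sum_sub_distrib, hsum, Finset.sum_const, Finset.card_range, nsmul_eq_mul,
    zero_sub] at h1
  have h2 := h1.neg
  rw [neg_neg] at h2
  have h3 := h2.le_ord (mul_ne_zero hp.1 hd)
  rw [ord_mul hp.1 hd, hp.2] at h3
  linarith

variable [FiniteDimensional K L]

/-- By Cauchy, an odd prime divisor of the order would give an element of that prime order, and an
odd prime is a unit at a place above `2`. -/
lemma exists_card_eq_two_pow (h2 : 0 < (w.valuation L).ord 2) {i : ℕ} (hi : 1 ≤ i) :
    ∃ k, Nat.card (lowerRamificationGroup K w.asIdeal i) = 2 ^ k := by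
  refine ⟨_, Nat.eq_prime_pow_of_unique_prime_dvd Nat.card_pos.ne' fun {p} hp hdvd ↦ ?_⟩
  by_contra hp2
  have := Fact.mk hp
  obtain ⟨σ, hσ⟩ := exists_prime_orderOf_dvd_card' p hdvd
  obtain ⟨m, hm⟩ := hp.odd_of_ne_two hp2
  have hord : (p : L) ≠ 0 ∧ (w.valuation L).ord (p : L) = 0 := by
    have := ord_add_eq (w := w.valuation L) one_ne_zero
      ((OrdGE.refl (w := w.valuation L) (2 : L)).mul (ordGE_nat m)) (by simpa using h2)
    rw [hm]
    push_cast
    rw [add_comm]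
    simpa using this
  have h1 := eq_one_of_pow_eq_one w hi σ.2 hord (by
    have := pow_orderOf_eq_one σ
    rw [hσ] at this
    exact congrArg Subtype.val this)
  have : σ = 1 := Subtype.ext h1
  rw [this, orderOf_one] at hσ
  exact hp.one_lt.ne hσ

variable {W : WeierstrassCurve K} (h₁ : W.a₁ = 0) (h₃ : W.a₃ = 0)
include h₁ h₃

-- Both automorphisms act as `-1` on the whole 3-torsion, so `τ⁻¹ σ` fixes it pointwise.
-- Faithfulness of the action is the hypothesis `hgen`.
omit [NumberField L] [FiniteDimensional K L] in
open Classical in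
lemma eq_of_fixesAbscissae (hgen : ∀ σ : Gal(L/K),
    (∀ P : (W.baseChange L).toAffine.Point, 3 • P = 0 →
      Affine.Point.map (W' := W.toAffine) (σ : L →ₐ[K] L) P = P) → σ = 1)
    {σ τ : Gal(L/K)} (hσ : W.FixesAbscissae L σ) (hτ : W.FixesAbscissae L τ) (hσ1 : σ ≠ 1)
    (hτ1 : τ ≠ 1) : σ = τ := by
  have key : ∀ σ : Gal(L/K), W.FixesAbscissae L σ → σ ≠ 1 →
      ∀ Q : (W.baseChange L).toAffine.Point, 3 • Q = 0 →
      Affine.Point.map (W' := W.toAffine) (σ : L →ₐ[K] L) Q = -Q := by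
    intro σ hσ hσ1 Q hQ
    have := mt (hgen σ) hσ1
    push Not at this
    obtain ⟨P, hP, hne⟩ := this
    exact eq_neg_of_forall_eq_or_eq_neg _ (map_eq_or_eq_neg h₁ h₃ hσ) hP hne hQ
  have hone : τ⁻¹ * σ = 1 := hgen _ fun P hP ↦ by
    apply Affine.Point.map_injective (W' := W.toAffine) (τ : L →ₐ[K] L)
    have hcomp : (τ : L →ₐ[K] L).comp ((τ⁻¹ * σ : Gal(L/K)) : L →ₐ[K] L) = σ :=
      AlgHom.ext fun x ↦ AlgEquiv.apply_symm_apply τ (σ x)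
    rw [Affine.Point.map_map, hcomp, key σ hσ hσ1 P hP, key τ hτ hτ1 P hP]
  exact (inv_mul_eq_one.1 hone).symm

/-- Wild ramification groups over `2` have order at most `16` on the `3`-torsion. -/
lemma card_lowerRamificationGroup_le (h2 : 0 < (w.valuation L).ord 2)
    (heq : ∀ σ τ : Gal(L/K), W.FixesAbscissae L σ → W.FixesAbscissae L τ → σ ≠ 1 → τ ≠ 1 →
      σ = τ) {i : ℕ} (hi : 1 ≤ i) :
    Nat.card (lowerRamificationGroup K w.asIdeal i) ≤ 16 := by
  obtain ⟨hfin, hcard⟩ := card_abscissa_le (L := L) h₁ h₃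
  obtain ⟨k, hk⟩ := exists_card_eq_two_pow (K := K) w h2 hi
  set H := lowerRamificationGroup K w.asIdeal i
  let ρ : H →* Equiv.Perm (W.Abscissa L) :=
    (MulAction.toPermHom Gal(L/K) (W.Abscissa L)).comp H.subtype
  have hker : Nat.card ρ.ker ≤ 2 := by
    refine ρ.ker.card_le_two_of_forall fun σ hσ τ hτ hσ1 hτ1 ↦ ?_
    have hfix : ∀ σ ∈ ρ.ker, W.FixesAbscissae L σ := fun σ hσ P hP ↦
      congrArg Subtype.val (Equiv.congr_fun (MonoidHom.mem_ker.1 hσ) ⟨P.1, P.2, hP⟩)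
    exact Subtype.ext (heq _ _ (hfix σ hσ) (hfix τ hτ) (by simpa using hσ1) (by simpa using hτ1))
  -- The image is a 2-group acting on at most four abscissae, so its order is a power of `2`
  -- dividing `24`.
  have hrange : Nat.card ρ.range ≤ 8 := by
    have hd1 : Nat.card ρ.range ∣ 2 ^ k := hk ▸ Subgroup.card_range_dvd ρ
    have hd2 : Nat.card ρ.range ∣ 24 := by
      refine (Subgroup.card_subgroup_dvd_card ρ.range).trans ?_
      rw [Nat.card_perm]
      exact Nat.factorial_dvd_factorial hcard
    obtain ⟨j, -, hj⟩ := (Nat.dvd_prime_pow Nat.prime_two).1 hd1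
    rw [hj] at hd2 ⊢
    have hj3 : j ≤ 3 := by
      by_contra! hlt
      have := (pow_dvd_pow 2 (by omega : 4 ≤ j)).trans hd2
      norm_num at this
    exact (Nat.pow_le_pow_right two_pos hj3).trans (by norm_num)
  have := ρ.ker.card_mul_index
  rw [Subgroup.index_ker] at this
  rw [← this]
  exact (Nat.mul_le_mul hker hrange).trans (by norm_num)

end Wild

end WeierstrassCurve

/-! ### The Swan term at a dyadic place -/

namespace WeierstrassCurve

open Valuation DyadicCurve

lemma psi_sub {L : Type*} [Field L] (a₂ a₄ a₆ x x₀ : L) :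
    psi (a₂ + 3 * x₀) (3 * x₀ ^ 2 + 2 * a₂ * x₀ + a₄) (x₀ ^ 3 + a₂ * x₀ ^ 2 + a₄ * x₀ + a₆)
      (x - x₀) = psi a₂ a₄ a₆ x := by
  simp only [psi]; ring

lemma equation_sub {L : Type*} [Field L] {a₂ a₄ a₆ x y : L} (x₀ : L)
    (h : y ^ 2 = x ^ 3 + a₂ * x ^ 2 + a₄ * x + a₆) :
    y ^ 2 = (x - x₀) ^ 3 + (a₂ + 3 * x₀) * (x - x₀) ^ 2 +
      (3 * x₀ ^ 2 + 2 * a₂ * x₀ + a₄) * (x - x₀) + (x₀ ^ 3 + a₂ * x₀ ^ 2 + a₄ * x₀ + a₆) := by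
  rw [h]; ring

variable {K L : Type*} [Field K] [Field L] [Algebra K L] [NumberField K] [NumberField L]
  {W : WeierstrassCurve K} (h₁ : W.a₁ = 0) (h₃ : W.a₃ = 0)
  (v : HeightOneSpectrum (𝓞 K)) (w : HeightOneSpectrum (𝓞 L)) [w.asIdeal.LiesOver v.asIdeal]

include h₁ h₃

/-- Bounds for the ramification on the `3`-torsion. -/
lemma exists_ramification_bounds
    (hgen : ∀ σ : Gal(L/K), W.FixesAbscissae L σ → σ ≠ 1 →
      ∃ P ∈ W.threeTorsionPairs L, σ P.2 = -P.2)
    (h2 : (v.valuation K).ord 2 = 1) (x₀ : K) (hc₂ : (v.valuation K).OrdGE 0 (W.a₂ + 3 * x₀))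
    (hc₄ : (v.valuation K).OrdGE 1 (3 * x₀ ^ 2 + 2 * W.a₂ * x₀ + W.a₄))
    (hc₆ : x₀ ^ 3 + W.a₂ * x₀ ^ 2 + W.a₄ * x₀ + W.a₆ ≠ 0 ∧
      (v.valuation K).ord (x₀ ^ 3 + W.a₂ * x₀ ^ 2 + W.a₄ * x₀ + W.a₆) = 0) :
    ∃ N₁ N₂ : ℚ, 0 ≤ N₁ ∧ N₁ ≤ N₂ ∧ 28 * N₁ + 4 * N₂ < 3 * w.asIdeal.ramificationIdx (𝓞 K) ∧
      ∀ i : ℕ, 1 ≤ i → ∀ σ ∈ lowerRamificationGroup K w.asIdeal i,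
        (¬ W.FixesAbscissae L σ → (i : ℚ) ≤ N₁) ∧
        (W.FixesAbscissae L σ → σ ≠ 1 → (i : ℚ) ≤ N₂) := by
  have B := v.dyadicBase w h2
  set e : ℚ := ((w.asIdeal.ramificationIdx (𝓞 K) : ℕ) : ℚ) with he
  have hpos := B.pos
  set k := (algebraMap K L).fieldRange
  have hge : ∀ (q : ℚ) (x : K), (v.valuation K).OrdGE q x →
      (w.valuation L).OrdGE (e * q) (algebraMap K L x) := by
    rintro q x (rfl | h)
    · exact Or.inl (map_zero _)
    · exact Or.inr (by rw [v.ord_algebraMap w]; exact mul_le_mul_of_nonneg_left h hpos.le)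
  set X₀ := algebraMap K L x₀ with hX₀
  set A₂ := algebraMap K L W.a₂ with hA₂
  set A₄ := algebraMap K L W.a₄ with hA₄
  set A₆ := algebraMap K L W.a₆ with hA₆
  have C : Coeffs (w.valuation L) k e (A₂ + 3 * X₀) (3 * X₀ ^ 2 + 2 * A₂ * X₀ + A₄)
      (X₀ ^ 3 + A₂ * X₀ ^ 2 + A₄ * X₀ + A₆) := by
    have e₂ : A₂ + 3 * X₀ = algebraMap K L (W.a₂ + 3 * x₀) := by
      rw [map_add, map_mul, map_ofNat]
    have e₄ : 3 * X₀ ^ 2 + 2 * A₂ * X₀ + A₄ =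
        algebraMap K L (3 * x₀ ^ 2 + 2 * W.a₂ * x₀ + W.a₄) := by
      rw [map_add, map_add, map_mul, map_mul, map_mul, map_pow, map_ofNat, map_ofNat]
    have e₆ : X₀ ^ 3 + A₂ * X₀ ^ 2 + A₄ * X₀ + A₆ =
        algebraMap K L (x₀ ^ 3 + W.a₂ * x₀ ^ 2 + W.a₄ * x₀ + W.a₆) := by
      simp [hX₀, hA₂, hA₄, hA₆]
    rw [e₂, e₄, e₆]
    refine ⟨⟨_, rfl⟩, ⟨_, rfl⟩, ⟨_, rfl⟩, ?_, ?_, ?_, ?_⟩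
    · simpa using hge 0 _ hc₂
    · simpa using hge 1 _ hc₄
    · exact (map_ne_zero _).2 hc₆.1
    · rw [v.ord_algebraMap w, hc₆.2, mul_zero]
  have hσk : ∀ σ : Gal(L/K), ∀ a ∈ k, (σ : L →+* L) a = a := by
    rintro σ _ ⟨a, rfl⟩
    exact σ.commutes a
  have hpsi : ∀ P ∈ W.threeTorsionPairs L, psi (A₂ + 3 * X₀) (3 * X₀ ^ 2 + 2 * A₂ * X₀ + A₄)
      (X₀ ^ 3 + A₂ * X₀ ^ 2 + A₄ * X₀ + A₆) (P.1 - X₀) = 0 := fun P hP ↦ by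
    rw [psi_sub]; exact psi_of_mem_threeTorsionPairs h₁ h₃ hP
  have heqn : ∀ P ∈ W.threeTorsionPairs L, _ := fun P hP ↦
    equation_sub X₀ (equation_of_mem_threeTorsionPairs h₁ h₃ hP)
  have hσX : ∀ σ : Gal(L/K), ∀ x : L, (σ : L →+* L) (x - X₀) = σ x - X₀ := fun σ x ↦ by
    rw [_root_.map_sub, hσk σ X₀ ⟨x₀, rfl⟩]; rfl
  have hneg : ∀ (s t : L) (q : ℚ), s ∈ k → t ∈ k →
      (∀ y z, y ^ 2 = z ^ 3 + (A₂ + 3 * X₀) * z ^ 2 + (3 * X₀ ^ 2 + 2 * A₂ * X₀ + A₄) * z +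
        (X₀ ^ 3 + A₂ * X₀ ^ 2 + A₄ * X₀ + A₆) → psi (A₂ + 3 * X₀)
        (3 * X₀ ^ 2 + 2 * A₂ * X₀ + A₄) (X₀ ^ 3 + A₂ * X₀ ^ 2 + A₄ * X₀ + A₆) z = 0 →
        (w.valuation L).OrdGE q (y - s * z - t)) → ∀ i : ℕ, 1 ≤ i →
      ∀ σ ∈ lowerRamificationGroup K w.asIdeal i, W.FixesAbscissae L σ → σ ≠ 1 →
      (i : ℚ) ≤ e - q := by
    intro s t q hs ht happ i hi σ hσ hfix hσ1
    obtain ⟨P, hP, hσP⟩ := hgen σ hfix hσ1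
    exact le_of_neg B C hs ht (hσk σ) (w.actsTriviallyTo hi hσ) (half_pos hpos)
      (ge_half_of_psi B C (hpsi P hP)) (heqn P hP) (by rw [hσX, hfix P hP]) hσP
      (happ _ _ (heqn P hP) (hpsi P hP))
  have hmoves : ∀ σ : Gal(L/K), ¬ W.FixesAbscissae L σ →
      ∃ P ∈ W.threeTorsionPairs L, (σ : L →+* L) (P.1 - X₀) ≠ P.1 - X₀ := by
    intro σ hσ
    rw [FixesAbscissae] at hσ
    push Not at hσ
    obtain ⟨P, hP, hne⟩ := hσ
    exact ⟨P, hP, by rwa [hσX, Ne, sub_left_inj]⟩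
  have hcge := ge_const B C
  set c := 4 * (A₂ + 3 * X₀) * (X₀ ^ 3 + A₂ * X₀ ^ 2 + A₄ * X₀ + A₆) -
    (3 * X₀ ^ 2 + 2 * A₂ * X₀ + A₄) ^ 2 with hc
  have hck : c ∈ k := by
    have h4 : (4 : L) ∈ k := ofNat_mem k 4
    exact sub_mem (mul_mem (mul_mem h4 C.mem₂) C.mem₆) (pow_mem C.mem₄ 2)
  by_cases hc3 : (w.valuation L).OrdGE (3 * e) c
  · obtain ⟨s, hs, t, ht, happ⟩ := exists_approx_of_dvd B C hc3
    -- No wild automorphism moves an abscissa, so `N₁ = 0`; with quality `e / 2` the Swan term is at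
    -- most `4 / 2 = 2`.
    refine ⟨0, e - e / 2, le_rfl, by linarith, by linarith, fun i hi σ hσ ↦ ⟨fun h ↦ ?_, ?_⟩⟩
    · obtain ⟨P, hP, hne⟩ := hmoves σ h
      exact absurd (fixes_root B C (hσk σ) (w.actsTriviallyTo hi hσ) (by exact_mod_cast hi) hc3
        (heqn P hP) (hpsi P hP)) hne
    · exact hneg s t _ hs ht happ i hi σ hσ
  · have hc0 : c ≠ 0 := fun h ↦ hc3 (Or.inl h)
    -- The constant term lies in the base field, where orders jump by `e`: an order above `2 e` is
    -- at least `3 e`.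
    have hco : (w.valuation L).ord c = 2 * e := by
      refine le_antisymm ?_ (hcge.le_ord hc0)
      by_contra! hlt
      have h4k : (4 : L) ∈ k := ofNat_mem k 4
      have h4 : (4 : L) = 2 ^ 2 := by norm_num
      have h40 : (4 : L) ≠ 0 := by norm_num
      have h4o : (w.valuation L).ord 4 = 2 * e := by
        rw [h4, ord_pow, B.ord_two]; norm_num
      have h5 := B.disc (c / 4) (div_mem hck h4k) ((w.valuation L).ord (c / 4))
        (by rw [ord_div hc0 h40, h4o]; linarith) (.refl _)
      have h6 := h5.mul (OrdGE.of_eq h4o)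
      rw [div_mul_cancel₀ _ h40] at h6
      exact hc3 (h6.mono (by linarith))
    obtain ⟨s, hs, t, ht, -, happ, -⟩ := exists_approx B C hc0 hco
    -- Here `28 / 24 + 4 * (3 / 8) = 8 / 3 < 3`.
    refine ⟨e / 24, e - 5 * e / 8, by positivity, by linarith, by linarith,
      fun i hi σ hσ ↦ ⟨fun h ↦ ?_, ?_⟩⟩
    · obtain ⟨P, hP, hne⟩ := hmoves σ h
      have hne' : P.1 ≠ σ P.1 := fun h ↦ hne (by rw [hσX, ← h])
      obtain ⟨x₃, hx₃, hsum⟩ := exists_sum_of_mem_threeTorsionPairs h₁ h₃ hP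
        (map_mem_threeTorsionPairs σ hP) hne'
      refine le_of_moves B C (hσk σ) (w.actsTriviallyTo hi hσ) hc0 hco (heqn P hP) (hpsi P hP) hne
        (z₃ := x₃ - X₀) (by rw [psi_sub]; exact hx₃) ?_
      rw [hσX, sub_sub_sub_cancel_right]
      refine hsum.trans ?_
      simp only
      ring
    · exact hneg s t _ hs ht happ i hi σ hσ

variable [IsGalois K L]

open Classical in
/-- The Swan term of the `3`-torsion at a prime above `2` is less than `3`. -/
theorem swanTerm_lt_three
    (hgen : ∀ σ : Gal(L/K), (∀ P : (W.baseChange L).toAffine.Point, 3 • P = 0 →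
      Affine.Point.map (W' := W.toAffine) (σ : L →ₐ[K] L) P = P) → σ = 1)
    (h2 : (v.valuation K).ord 2 = 1) (x₀ : K) (hc₂ : (v.valuation K).OrdGE 0 (W.a₂ + 3 * x₀))
    (hc₄ : (v.valuation K).OrdGE 1 (3 * x₀ ^ 2 + 2 * W.a₂ * x₀ + W.a₄))
    (hc₆ : x₀ ^ 3 + W.a₂ * x₀ ^ 2 + W.a₄ * x₀ + W.a₆ ≠ 0 ∧
      (v.valuation K).ord (x₀ ^ 3 + W.a₂ * x₀ ^ 2 + W.a₄ * x₀ + W.a₆) = 0) :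
    swanTerm W 3 L w.asIdeal < 3 := by
  have : FiniteDimensional K L := Module.Finite.of_restrictScalars_finite ℚ K L
  have heq := fun σ τ ↦ eq_of_fixesAbscissae h₁ h₃ hgen (σ := σ) (τ := τ)
  have hgen' : ∀ σ : Gal(L/K), W.FixesAbscissae L σ → σ ≠ 1 →
      ∃ P ∈ W.threeTorsionPairs L, σ P.2 = -P.2 := by
    intro σ hσ hσ1
    have := mt (hgen σ) hσ1
    push Not at this
    obtain ⟨P, hP, hne⟩ := this
    exact exists_map_eq_neg h₁ h₃ hσ hP hne
  obtain ⟨N₁, N₂, hN₁, hN₁₂, hN, hbound⟩ :=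
    exists_ramification_bounds h₁ h₃ v w hgen' h2 x₀ hc₂ hc₄ hc₆
  have B := v.dyadicBase w h2
  have hcard0 := v.card_lowerRamificationGroup_zero w
  set e := w.asIdeal.ramificationIdx (𝓞 K)
  have hpos : (0 : ℚ) < e := B.pos
  -- The index `i` stands for the group `G_{i+1}`, so `i < ⌊N₁⌋₊` means `i + 1 ≤ N₁`. The numerator
  -- is at most `16 * 2 = 28 + 4` up to `N₁` and `2 * 2 = 4` beyond it.
  have hterm : ∀ i : ℕ, (Nat.card (lowerRamificationGroup K w.asIdeal (i + 1)) : ℚ)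
      / Nat.card (lowerRamificationGroup K w.asIdeal 0)
      * torsionCodim L W 3 (lowerRamificationGroup K w.asIdeal (i + 1)) ≤
      ((if i ∈ Finset.range ⌊N₁⌋₊ then 28 else 0) + 4) / e := by
    intro i
    rw [hcard0, div_mul_eq_mul_div]
    refine div_le_div_of_nonneg_right ?_ hpos.le
    have hcod : (torsionCodim L W 3 (lowerRamificationGroup K w.asIdeal (i + 1)) : ℚ) ≤ 2 := by
      exact_mod_cast torsionCodim_three_le h₁ h₃ L _
    split_ifs with hi
    · have h16 : (Nat.card (lowerRamificationGroup K w.asIdeal (i + 1)) : ℚ) ≤ 16 := by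
        exact_mod_cast card_lowerRamificationGroup_le w h₁ h₃ (by rw [B.ord_two]; exact hpos)
          heq (by omega)
      have := mul_le_mul h16 hcod (by positivity) (by norm_num)
      linarith
    · have h2 : (Nat.card (lowerRamificationGroup K w.asIdeal (i + 1)) : ℚ) ≤ 2 := by
        have hfix : ∀ σ ∈ lowerRamificationGroup K w.asIdeal (i + 1),
            W.FixesAbscissae L σ := fun σ hσ ↦ by
          by_contra hnot
          exact hi (Finset.mem_range.2 (Nat.le_floor ((hbound _ (by omega) σ hσ).1 hnot)))
        exact_mod_cast Subgroup.card_le_two_of_forall _ fun σ hσ τ hτ ↦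
          heq σ τ (hfix σ hσ) (hfix τ hτ)
      have := mul_le_mul h2 hcod (by positivity) (by norm_num)
      linarith
  have hsupp : Function.support (fun i : ℕ ↦
      (Nat.card (lowerRamificationGroup K w.asIdeal (i + 1)) : ℚ)
      / Nat.card (lowerRamificationGroup K w.asIdeal 0)
      * torsionCodim L W 3 (lowerRamificationGroup K w.asIdeal (i + 1))) ⊆
      (Finset.range ⌊N₂⌋₊ : Finset ℕ) := by
    intro i hi
    rw [Function.mem_support] at hi
    rw [Finset.coe_range, Set.mem_Iio]
    by_contra hlt
    apply hi
    have hbot : lowerRamificationGroup K w.asIdeal (i + 1) = ⊥ := by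
      rw [Subgroup.eq_bot_iff_forall]
      intro σ hσ
      by_contra hσ1
      have hb := hbound _ (by omega) σ hσ
      have hle : ((i + 1 : ℕ) : ℚ) ≤ N₂ := by
        by_cases hf : W.FixesAbscissae L σ
        · exact hb.2 hf hσ1
        · exact (hb.1 hf).trans hN₁₂
      exact hlt (Nat.le_floor hle)
    rw [hbot, torsionCodim_bot, Nat.cast_zero, mul_zero]
  rw [swanTerm, finsum_eq_sum_of_support_subset _ hsupp]
  refine (Finset.sum_le_sum fun i _ ↦ hterm i).trans_lt ?_
  rw [← Finset.sum_div, div_lt_iff₀ hpos, Finset.sum_add_distrib, Finset.sum_ite_mem,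
    Finset.inter_eq_right.2 (Finset.range_mono (Nat.floor_le_floor hN₁₂)), Finset.sum_const,
    Finset.sum_const, Finset.card_range, Finset.card_range, nsmul_eq_mul, nsmul_eq_mul]
  have f₁ := Nat.floor_le hN₁
  have f₂ := Nat.floor_le (hN₁.trans hN₁₂)
  linarith

end WeierstrassCurve

/-! ### The wild part of the conductor exponent -/

namespace WeierstrassCurve

open Valuation

variable {K : Type*} [Field K] [NumberField K] {W : WeierstrassCurve K}
  (v : HeightOneSpectrum (𝓞 K))

/-- The wild part of the conductor exponent vanishes at odd places if the `2`-torsion is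
rational. -/
lemma wildConductorExponent_eq_zero (hv : (2 : 𝓞 K) ∉ v.asIdeal) (h₁ : W.a₁ = 0) (h₃ : W.a₃ = 0)
    {A B : K} (ha₂ : W.a₂ = B - A) (ha₄ : W.a₄ = -(A * B)) (ha₆ : W.a₆ = 0) :
    W.wildConductorExponent v = 0 := by
  have hbot := divisionField_two_eq_bot two_ne_zero h₁ h₃ ha₂ ha₄ ha₆
  rw [wildConductorExponent, auxiliaryPrime, if_neg hv]
  have : Subsingleton Gal(divisionField W 2/K) := by
    rw [hbot]
    exact ((IntermediateField.botEquiv K (AlgebraicClosure K)).autCongr).toEquiv.subsingleton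
  exact swanTerm_eq_zero_of_subsingleton 2 _ _

/-- The wild part of the conductor exponent at an unramified place above `2`. -/
lemma wildConductorExponent_lt_three (hv : (2 : 𝓞 K) ∈ v.asIdeal) (h₁ : W.a₁ = 0)
    (h₃ : W.a₃ = 0) (h2 : (v.valuation K).ord 2 = 1) (x₀ : K)
    (hc₂ : (v.valuation K).OrdGE 0 (W.a₂ + 3 * x₀))
    (hc₄ : (v.valuation K).OrdGE 1 (3 * x₀ ^ 2 + 2 * W.a₂ * x₀ + W.a₄))
    (hc₆ : x₀ ^ 3 + W.a₂ * x₀ ^ 2 + W.a₄ * x₀ + W.a₆ ≠ 0 ∧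
      (v.valuation K).ord (x₀ ^ 3 + W.a₂ * x₀ ^ 2 + W.a₄ * x₀ + W.a₆) = 0) :
    W.wildConductorExponent v < 3 := by
  classical
  rw [wildConductorExponent, auxiliaryPrime, if_pos hv]
  have := divisionField_three_finiteDimensional h₁ h₃
  have := divisionField_normal (W := W) 3
  have : NumberField (divisionField W 3) := NumberField.of_module_finite K _
  have : IsGalois K (divisionField W 3) := { }
  have hp := (Ideal.nonempty_primesOver (S := 𝓞 (divisionField W 3)) v.asIdeal).some.2
  have : (primeAbove v (divisionField W 3)).LiesOver v.asIdeal := hp.2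
  let w : HeightOneSpectrum (𝓞 (divisionField W 3)) :=
    ⟨primeAbove v (divisionField W 3), hp.1, Ideal.ne_bot_of_liesOver_of_ne_bot v.ne_bot _⟩
  have : w.asIdeal.LiesOver v.asIdeal := hp.2
  exact swanTerm_lt_three h₁ h₃ v w
    (@eq_one_of_forall_map_eq K _ W 3 (fun _ _ ↦ Classical.propDecidable _)) h2 x₀ hc₂ hc₄ hc₆

end WeierstrassCurve

/-! ### Criteria for the reduction type -/

namespace WeierstrassCurve

open IsDiscreteValuationRing HeightOneSpectrum

section Local

variable {R : Type*} [CommRing R] [IsDomain R] [IsDiscreteValuationRing R]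
  {K : Type*} [Field K] [Algebra R K] [IsFractionRing R K] {W : WeierstrassCurve K}

/-- Minimality is automatic: in multiplicative notation no integral model has a discriminant of
value above `1`. -/
lemma hasGoodReduction_of_isIntegral [IsIntegral R W]
    (hΔ : (maximalIdeal R).valuation K W.Δ = 1) : W.HasGoodReduction R := by
  refine { val_Δ_maximal := ⟨by simpa, fun C _ _ ↦ ?_⟩, goodReduction := hΔ }
  refine (valuation_Δ_aux R (C • W)).2.trans ?_
  change 1 ≤ (valuation_Δ_aux R ((1 : VariableChange K) • W) : WithZero (Multiplicative ℤ))
  rw [one_smul, valuation_Δ_aux_eq_of_isIntegral, hΔ]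

/-- When `c₄` is a unit, a change of variables to another integral model multiplies it by `u⁻¹ ^ 4`,
which must be integral. Hence `u⁻¹` is integral, and `u⁻¹ ^ 12` cannot increase the value of the
discriminant. -/
lemma hasMultiplicativeReduction_of_isIntegral [IsIntegral R W]
    (hΔ : (maximalIdeal R).valuation K W.Δ < 1) (hc : (maximalIdeal R).valuation K W.c₄ = 1) :
    W.HasMultiplicativeReduction R := by
  refine { val_Δ_maximal := ⟨by simpa, fun C hC _ ↦ ?_⟩,
           badReduction := hΔ, multiplicativeReduction := hc }
  change (valuation_Δ_aux R (C • W) : WithZero (Multiplicative ℤ)) ≤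
    (valuation_Δ_aux R ((1 : VariableChange K) • W) : WithZero (Multiplicative ℤ))
  rw [one_smul, valuation_Δ_aux_eq_of_isIntegral, valuation_Δ_aux_eq_of_isIntegral,
    variableChange_Δ, map_mul, map_pow]
  have hu : (maximalIdeal R).valuation K (C • W).c₄ ≤ 1 := by
    rw [← integralModel_c₄_eq R (C • W)]
    exact valuation_le_one _ _
  rw [variableChange_c₄, map_mul, map_pow, hc, mul_one,
    pow_le_one_iff_of_nonneg zero_le (by norm_num)] at hu
  exact mul_le_of_le_one_left zero_le (pow_le_one₀ zero_le hu)

end Local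

section Global

variable {K : Type*} [Field K] [NumberField K] {W : WeierstrassCurve K}
  {v : HeightOneSpectrum (𝓞 K)}

lemma valuation_maximalIdeal_le_one_iff (x : v.adicCompletion K) :
    (maximalIdeal (v.adicCompletionIntegers K)).valuation (v.adicCompletion K) x ≤ 1 ↔
      Valued.v x ≤ 1 := by
  refine ⟨fun h ↦ ?_, fun h ↦ ?_⟩
  · obtain ⟨y, rfl⟩ := exists_lift_of_le_one h
    exact y.2
  · exact valuation_le_one (maximalIdeal (v.adicCompletionIntegers K)) ⟨x, h⟩

/-- Reduction types are phrased with the valuation attached to the maximal ideal of the completed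
integers, while orders are computed with `v`. Both have the same unit ball, so comparisons with `1`
transfer. -/
lemma isEquiv_valuation_maximalIdeal :
    ((maximalIdeal (v.adicCompletionIntegers K)).valuation (v.adicCompletion K)).IsEquiv
      (Valued.v : Valuation (v.adicCompletion K) _) :=
  Valuation.isEquiv_of_val_le_one fun {x} ↦ valuation_maximalIdeal_le_one_iff x

lemma isIntegral_baseChange (h₁ : v.valuation K W.a₁ ≤ 1) (h₂ : v.valuation K W.a₂ ≤ 1)
    (h₃ : v.valuation K W.a₃ ≤ 1) (h₄ : v.valuation K W.a₄ ≤ 1) (h₆ : v.valuation K W.a₆ ≤ 1) :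
    IsIntegral (v.adicCompletionIntegers K) (W.baseChange (v.adicCompletion K)) := by
  have key : ∀ x : K, v.valuation K x ≤ 1 → ∃ y : v.adicCompletionIntegers K,
      algebraMap _ (v.adicCompletion K) y = algebraMap K _ x := fun x hx ↦
    ⟨⟨algebraMap K _ x, by
      rw [mem_adicCompletionIntegers]
      exact (valuedAdicCompletion_eq_valuation' v x).trans_le hx⟩, rfl⟩
  exact isIntegral_of_exists_lift _ (key _ h₁) (key _ h₂) (key _ h₃) (key _ h₄) (key _ h₆)

lemma hasGoodReductionAt_of_variableChange (C : VariableChange K)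
    (h₁ : v.valuation K (C • W).a₁ ≤ 1) (h₂ : v.valuation K (C • W).a₂ ≤ 1)
    (h₃ : v.valuation K (C • W).a₃ ≤ 1) (h₄ : v.valuation K (C • W).a₄ ≤ 1)
    (h₆ : v.valuation K (C • W).a₆ ≤ 1) (hΔ : v.valuation K (C • W).Δ = 1) :
    W.HasGoodReductionAt v := by
  refine ⟨C.map (algebraMap K (v.adicCompletion K)), ?_⟩
  rw [baseChange, map_variableChange]
  have : IsIntegral (v.adicCompletionIntegers K)
      ((C • W).map (algebraMap K (v.adicCompletion K))) := isIntegral_baseChange h₁ h₂ h₃ h₄ h₆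
  refine hasGoodReduction_of_isIntegral ?_
  rw [isEquiv_valuation_maximalIdeal.eq_one_iff_eq_one, map_Δ]
  exact (valuedAdicCompletion_eq_valuation' v _).trans hΔ

lemma hasMultiplicativeReductionAt_of_c₄
    (h₁ : v.valuation K W.a₁ ≤ 1) (h₂ : v.valuation K W.a₂ ≤ 1)
    (h₃ : v.valuation K W.a₃ ≤ 1) (h₄ : v.valuation K W.a₄ ≤ 1)
    (h₆ : v.valuation K W.a₆ ≤ 1) (hΔ : v.valuation K W.Δ < 1) (hc : v.valuation K W.c₄ = 1) :
    W.HasMultiplicativeReductionAt v := by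
  refine ⟨1, ?_⟩
  have := isIntegral_baseChange h₁ h₂ h₃ h₄ h₆
  rw [one_smul]
  refine hasMultiplicativeReduction_of_isIntegral ?_ ?_
  · rw [isEquiv_valuation_maximalIdeal.lt_one_iff_lt_one, baseChange, map_Δ]
    exact (valuedAdicCompletion_eq_valuation' v _).trans_lt hΔ
  · rw [isEquiv_valuation_maximalIdeal.eq_one_iff_eq_one, baseChange, map_c₄]
    exact (valuedAdicCompletion_eq_valuation' v _).trans hc

/-- The order of the discriminant at a place of good reduction is divisible by `12`. -/
lemma HasGoodReductionAt.exists_ord_eq (h : W.HasGoodReductionAt v) (h0 : W.Δ ≠ 0) :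
    ∃ n : ℤ, (v.valuation K).ord W.Δ = 12 * n := by
  obtain ⟨C, hC⟩ := h
  have hΔ := hC.goodReduction
  rw [isEquiv_valuation_maximalIdeal.eq_one_iff_eq_one, variableChange_Δ, baseChange, map_Δ,
    map_mul, map_pow] at hΔ
  have e : Valued.v (algebraMap K (v.adicCompletion K) W.Δ) = v.valuation K W.Δ :=
    valuedAdicCompletion_eq_valuation' v _
  rw [e] at hΔ
  have hu : (Valued.v (C.u⁻¹ : v.adicCompletion K) : WithZero (Multiplicative ℤ)) ≠ 0 := by simp
  refine ⟨WithZero.log (Valued.v (C.u⁻¹ : v.adicCompletion K)), ?_⟩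
  have := congrArg WithZero.log hΔ
  rw [Units.val_inv_eq_inv_val,
    WithZero.log_mul (pow_ne_zero _ hu) ((v.valuation K).ne_zero_iff.2 h0), WithZero.log_pow,
    WithZero.log_one] at this
  rw [Valuation.ord, neg_eq_of_add_eq_zero_left this]
  simp

/-- The `j`-invariant is integral at a place of good reduction. -/
lemma HasGoodReductionAt.valuation_le (h : W.HasGoodReductionAt v) :
    v.valuation K W.c₄ ^ 3 ≤ v.valuation K W.Δ := by
  obtain ⟨C, hC⟩ := h
  have hΔ := hC.goodReduction
  have hc : (maximalIdeal (v.adicCompletionIntegers K)).valuation (v.adicCompletion K)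
      (C • W.baseChange (v.adicCompletion K)).c₄ ≤ 1 := by
    rw [← integralModel_c₄_eq (v.adicCompletionIntegers K)
      (C • W.baseChange (v.adicCompletion K))]
    exact valuation_le_one _ _
  rw [isEquiv_valuation_maximalIdeal.eq_one_iff_eq_one, variableChange_Δ, baseChange, map_Δ,
    map_mul, map_pow] at hΔ
  rw [valuation_maximalIdeal_le_one_iff, variableChange_c₄, baseChange, map_c₄,
    map_mul, map_pow] at hc
  have e : ∀ x, Valued.v (algebraMap K (v.adicCompletion K) x) = v.valuation K x :=
    valuedAdicCompletion_eq_valuation' v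
  rw [e] at hΔ hc
  by_contra! hlt
  have hu : (Valued.v (C.u⁻¹.1 : v.adicCompletion K) : WithZero (Multiplicative ℤ)) ≠ 0 := by simp
  have h3 := pow_le_one₀ (n := 3) zero_le hc
  rw [mul_pow, ← pow_mul, ← hΔ] at h3
  exact ((mul_lt_mul_iff_right₀ (pow_pos (zero_lt_iff.2 hu) _)).2 hlt).not_ge h3

/-- The `j`-invariant is not integral at a place of multiplicative reduction. -/
lemma HasMultiplicativeReductionAt.valuation_lt (h : W.HasMultiplicativeReductionAt v) :
    v.valuation K W.Δ < v.valuation K W.c₄ ^ 3 := by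
  obtain ⟨C, hC⟩ := h
  have hΔ := hC.badReduction
  have hc := hC.multiplicativeReduction
  rw [isEquiv_valuation_maximalIdeal.lt_one_iff_lt_one, variableChange_Δ, baseChange, map_Δ,
    map_mul, map_pow] at hΔ
  rw [isEquiv_valuation_maximalIdeal.eq_one_iff_eq_one, variableChange_c₄, baseChange, map_c₄,
    map_mul, map_pow] at hc
  have e : ∀ x, Valued.v (algebraMap K (v.adicCompletion K) x) = v.valuation K x :=
    valuedAdicCompletion_eq_valuation' v
  rw [e] at hΔ hc
  by_contra! hle
  refine hΔ.not_ge (le_of_eq_of_le ?_ (mul_le_mul_right hle _))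
  rw [← one_pow 3, ← hc, mul_pow, ← pow_mul]

end Global

end WeierstrassCurve

/-! ### Arithmetic of the maximal real subfield of a cyclotomic field -/

namespace IsDedekindDomain.HeightOneSpectrum

open Valuation

lemma ord_eq_one_of_eq_span {R K : Type*} [CommRing R] [IsDedekindDomain R] [Field K]
    [Algebra R K] [IsFractionRing R K] {v : HeightOneSpectrum R} {x : R}
    (hx : v.asIdeal = Ideal.span {x}) : (v.valuation K).ord (algebraMap R K x) = 1 := by
  have hx0 : x ≠ 0 := by
    rintro rfl
    exact v.ne_bot (by simpa using hx)
  rw [ord, valuation_of_algebraMap, v.intValuation_singleton hx0 hx]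
  simp

variable {K L : Type*} [Field K] [Field L] [Algebra K L]

lemma liesOver_span_of_mem (w : Ideal (𝓞 K)) [w.IsPrime] {p : ℕ} [Fact p.Prime]
    (hp : (p : 𝓞 K) ∈ w) : w.LiesOver (Ideal.span {(p : ℤ)}) := by
  rw [Ideal.liesOver_iff]
  refine Ideal.IsMaximal.eq_of_le (Int.ideal_span_isMaximal_of_prime p) Ideal.IsPrime.ne_top' ?_
  rw [Ideal.span_singleton_le_iff_mem, Ideal.mem_comap, algebraMap_int_eq, map_natCast]
  exact hp

lemma liesOver_of_liesOver (v : Ideal (𝓞 K)) (w : Ideal (𝓞 L)) [w.IsPrime] [w.LiesOver v] {p : ℕ}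
    [Fact p.Prime] (hp : (p : 𝓞 K) ∈ v) : w.LiesOver (Ideal.span {(p : ℤ)}) := by
  refine liesOver_span_of_mem w ?_
  have := (Ideal.mem_of_liesOver w v _).1 hp
  rwa [map_natCast] at this

variable [NumberField K] [NumberField L]

/-- A prime number unramified in an extension is unramified at every place of the base field. -/
lemma ord_natCast_eq_one (v : HeightOneSpectrum (𝓞 K)) (w : Ideal (𝓞 L)) [w.IsPrime]
    [w.LiesOver v.asIdeal] {p : ℕ} [hp : Fact p.Prime] (hv : (p : 𝓞 K) ∈ v.asIdeal)
    (hw : w.ramificationIdx ℤ = 1) : (v.valuation K).ord p = 1 := by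
  have := liesOver_of_liesOver v.asIdeal w hv
  have hp0 : (Ideal.span {(p : ℤ)}).map (algebraMap ℤ (𝓞 L)) ≠ ⊥ := by
    rw [Ideal.map_span, Set.image_singleton, map_natCast, Ne, Ideal.span_singleton_eq_bot]
    exact Nat.cast_ne_zero.2 hp.out.ne_zero
  -- If `p` were in `v ^ 2`, it would be in `w ^ 2`, against ramification index `1` over `ℤ`.
  have hnot : (p : 𝓞 K) ∉ v.asIdeal ^ 2 := by
    intro h
    have h1 : (p : 𝓞 L) ∈ w ^ 2 := by
      have h2 : Ideal.map (algebraMap (𝓞 K) (𝓞 L)) (v.asIdeal ^ 2) ≤ w ^ 2 := by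
        rw [Ideal.map_pow]
        refine Ideal.pow_right_mono (Ideal.map_le_iff_le_comap.2 ?_) 2
        exact (Ideal.over_def w v.asIdeal).le
      have := h2 (Ideal.mem_map_of_mem _ h)
      rwa [map_natCast] at this
    have hw0 : w ≠ ⊥ := Ideal.ne_bot_of_liesOver_of_ne_bot v.ne_bot _
    rw [Ideal.IsDedekindDomain.ramificationIdx_eq_multiplicity (Ideal.span {(p : ℤ)}) w hp0] at hw
    have hfin : FiniteMultiplicity w ((Ideal.span {(p : ℤ)}).map (algebraMap ℤ (𝓞 L))) :=
      FiniteMultiplicity.of_prime_left (Ideal.prime_of_isPrime hw0 inferInstance) hp0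
    refine hfin.not_pow_dvd_of_multiplicity_lt (m := 2) (by omega) ?_
    rw [Ideal.dvd_iff_le, Ideal.map_span, Set.image_singleton, map_natCast,
      Ideal.span_singleton_le_iff_mem]
    exact h1
  have hpK : (p : K) ≠ 0 := Nat.cast_ne_zero.2 hp.out.ne_zero
  have h1 := (v.ordGE_one_iff_mem (K := K) _).2 hv
  have h2 := mt (v.ordGE_iff_mem_pow (K := K) _ 2).1 hnot
  rw [map_natCast] at h1 h2
  have h3 := h1.le_ord hpK
  have h4 : ¬ (2 : ℚ) ≤ (v.valuation K).ord p := fun h ↦ h2 (Or.inr (by exact_mod_cast h))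
  obtain ⟨n, hn⟩ := exists_int_ord (w := v.valuation K) (p : K)
  rw [hn] at h3 h4 ⊢
  have h3' : 1 ≤ n := by exact_mod_cast h3
  have h4' : ¬ 2 ≤ n := by exact_mod_cast h4
  exact_mod_cast (by omega : n = 1)

end IsDedekindDomain.HeightOneSpectrum

namespace Frey

open Valuation HeightOneSpectrum

variable {F : Type*} [Field F] [NumberField F] {r : ℕ} {ζ : F}

section

variable [NeZero r]

lemma isIntegral_theta (hζ : IsPrimitiveRoot ζ r) (k : ℕ) : IsIntegral ℤ (theta hζ k) := by
  have h : ∀ x : F, x ^ r = 1 → IsIntegral ℤ x := fun x hx ↦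
    IsIntegral.of_pow (Nat.pos_of_ne_zero (NeZero.ne r)) (hx ▸ isIntegral_one)
  have h1 : (ζ ^ k) ^ r = 1 := by rw [← pow_mul, mul_comm, pow_mul, hζ.pow_eq_one, one_pow]
  refine (isIntegral_algebraMap_iff
    (algebraMap (maximalRealSubfield F) F).injective).1 ?_
  exact (h _ h1).add (h _ (by rw [inv_pow, h1, inv_one]))

/-- The algebraic integer `ζ ^ k + ζ ^ (-k)`. -/
def thetaInt (hζ : IsPrimitiveRoot ζ r) (k : ℕ) : 𝓞 (maximalRealSubfield F) :=
  ⟨theta hζ k, isIntegral_theta hζ k⟩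

lemma algebraMap_thetaInt (hζ : IsPrimitiveRoot ζ r) (k : ℕ) :
    algebraMap (𝓞 (maximalRealSubfield F)) (maximalRealSubfield F) (thetaInt hζ k) =
      theta hζ k := rfl

lemma coe_theta (hζ : IsPrimitiveRoot ζ r) (k : ℕ) :
    algebraMap (maximalRealSubfield F) F (theta hζ k) = ζ ^ k + (ζ ^ k)⁻¹ := rfl

lemma theta_eq_theta_one (hζ : IsPrimitiveRoot ζ r) {k : ℕ} (hk : k.Coprime r) :
    theta hζ k = theta (hζ.pow_of_coprime k hk) 1 :=
  Subtype.ext (by simp [theta])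

lemma thetaInt_eq_thetaInt_one (hζ : IsPrimitiveRoot ζ r) {k : ℕ} (hk : k.Coprime r) :
    thetaInt hζ k = thetaInt (hζ.pow_of_coprime k hk) 1 :=
  RingOfIntegers.ext (theta_eq_theta_one hζ hk)

end

variable [hr : Fact r.Prime] [IsCyclotomicExtension {r} ℚ F] (h2 : 2 < r)
  (hζ : IsPrimitiveRoot ζ r)

include h2 in
omit hr in
lemma finrank_over_maximalRealSubfield :
    Module.finrank (maximalRealSubfield F) F = 2 := by
  have := IsCyclotomicExtension.Rat.isCMField F (S := {r}) ⟨r, rfl, h2⟩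
  exact Algebra.IsQuadraticExtension.finrank_eq_two (maximalRealSubfield F) F

include h2 in
lemma finrank_maximalRealSubfield : Module.finrank ℚ (maximalRealSubfield F) = (r - 1) / 2 := by
  have h := Module.finrank_mul_finrank ℚ (maximalRealSubfield F) F
  rw [finrank_over_maximalRealSubfield h2, IsCyclotomicExtension.Rat.finrank r F,
    Nat.totient_prime hr.out] at h
  omega

include h2

/-- The factorization `2 - θ = (ζ - 1) (ζ⁻¹ - 1)` has both factors of norm `r` over `ℚ`. For an
element of the quadratic subfield, the norm from `F` is the square of its own norm. -/
lemma absNorm_two_sub_thetaInt_one :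
    Ideal.absNorm (Ideal.span {2 - thetaInt hζ 1}) = r := by
  rw [Ideal.absNorm_span_singleton]
  have hirr := Polynomial.cyclotomic.irreducible_rat hr.out.pos
  have e : algebraMap (maximalRealSubfield F) F (2 - theta hζ 1) = (ζ - 1) * (ζ⁻¹ - 1) := by
    have hζ0 : ζ ≠ 0 := hζ.ne_zero hr.out.ne_zero
    rw [_root_.map_sub, coe_theta, map_ofNat, pow_one]
    field_simp; ring
  have h := Algebra.norm_norm (R := ℚ) (S := maximalRealSubfield F)
    (a := algebraMap (maximalRealSubfield F) F (2 - theta hζ 1))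
  rw [Algebra.norm_algebraMap, finrank_over_maximalRealSubfield h2, map_pow, e, map_mul,
    hζ.norm_sub_one_of_prime_ne_two' hirr h2.ne', hζ.inv.norm_sub_one_of_prime_ne_two' hirr h2.ne',
    ← sq, sq_eq_sq_iff_abs_eq_abs] at h
  have h' := Algebra.coe_norm_int (2 - thetaInt hζ 1)
  change _ = Algebra.norm ℚ (2 - theta hζ 1) at h'
  rw [← h', Nat.abs_cast] at h
  have h'' : |Algebra.norm ℤ (2 - thetaInt hζ 1)| = (r : ℤ) := by exact_mod_cast h
  rw [Int.abs_eq_natAbs] at h''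
  exact_mod_cast h''

omit h2 hr [IsCyclotomicExtension {r} ℚ F] in
lemma isPrime_span_of_absNorm {K : Type*} [Field K] [NumberField K] [hr : Fact r.Prime] {x : 𝓞 K}
    (hx : Ideal.absNorm (Ideal.span {x}) = r) :
    (Ideal.span {x}).IsPrime ∧ x ≠ 0 ∧ (r : 𝓞 K) ∈ Ideal.span {x} := by
  refine ⟨Ideal.isPrime_of_irreducible_absNorm (by rw [hx]; exact hr.out), ?_, ?_⟩
  · rintro rfl
    simp at hx
    exact hr.out.ne_zero hx.symm
  · have := Ideal.absNorm_mem (Ideal.span {x})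
    rwa [hx] at this

omit h2 in
lemma two_sub_thetaInt_one_mem (v : HeightOneSpectrum (𝓞 (maximalRealSubfield F)))
    (hv : (r : 𝓞 (maximalRealSubfield F)) ∈ v.asIdeal) : 2 - thetaInt hζ 1 ∈ v.asIdeal := by
  obtain ⟨w, hw, hwv⟩ := Ideal.nonempty_primesOver (S := 𝓞 F) v.asIdeal
  have := liesOver_of_liesOver v.asIdeal w hv
  rw [Ideal.mem_of_liesOver w v.asIdeal,
    IsCyclotomicExtension.Rat.eq_span_zeta_sub_one_of_liesOver' r F hζ w,
    Ideal.mem_span_singleton]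
  refine ⟨hζ.inv.toInteger - 1, RingOfIntegers.ext ?_⟩
  have hζ0 : ζ ≠ 0 := hζ.ne_zero hr.out.ne_zero
  have e : algebraMap (maximalRealSubfield F) F (2 - theta hζ 1) = (ζ - 1) * (ζ⁻¹ - 1) := by
    rw [_root_.map_sub, coe_theta, map_ofNat, pow_one]
    field_simp; ring
  exact e

/-- The unique place above `r` is generated by `2 - θ`. -/
lemma asIdeal_eq_span_two_sub_thetaInt {k : ℕ} (hk : k.Coprime r)
    (v : HeightOneSpectrum (𝓞 (maximalRealSubfield F)))
    (hv : (r : 𝓞 (maximalRealSubfield F)) ∈ v.asIdeal) :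
    v.asIdeal = Ideal.span {2 - thetaInt hζ k} := by
  rw [thetaInt_eq_thetaInt_one hζ hk]
  obtain ⟨h₁, h₂, -⟩ := isPrime_span_of_absNorm
    (absNorm_two_sub_thetaInt_one h2 (hζ.pow_of_coprime k hk))
  have := h₁.isMaximal (by simpa using h₂)
  refine (this.eq_of_le v.isPrime.ne_top ?_).symm
  rw [Ideal.span_singleton_le_iff_mem]
  exact two_sub_thetaInt_one_mem _ v hv

lemma natCast_mem_of_two_sub_thetaInt_mem {k : ℕ} (hk : k.Coprime r)
    (v : HeightOneSpectrum (𝓞 (maximalRealSubfield F)))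
    (hv : 2 - thetaInt hζ k ∈ v.asIdeal) : (r : 𝓞 (maximalRealSubfield F)) ∈ v.asIdeal := by
  rw [thetaInt_eq_thetaInt_one hζ hk] at hv
  obtain ⟨-, -, h₃⟩ := isPrime_span_of_absNorm
    (absNorm_two_sub_thetaInt_one h2 (hζ.pow_of_coprime k hk))
  exact (Ideal.span_singleton_le_iff_mem _).2 hv h₃

lemma ord_two_sub_theta {k : ℕ} (hk : k.Coprime r)
    (v : HeightOneSpectrum (𝓞 (maximalRealSubfield F)))
    [Decidable ((r : 𝓞 (maximalRealSubfield F)) ∈ v.asIdeal)] :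
    2 - theta hζ k ≠ 0 ∧ (v.valuation (maximalRealSubfield F)).ord (2 - theta hζ k) =
      if (r : 𝓞 (maximalRealSubfield F)) ∈ v.asIdeal then 1 else 0 := by
  have e : algebraMap _ (maximalRealSubfield F) (2 - thetaInt hζ k) = 2 - theta hζ k := by
    rw [_root_.map_sub, map_ofNat]; rfl
  rw [← e]
  split_ifs with hv
  · have := ord_eq_one_of_eq_span (K := maximalRealSubfield F)
      (asIdeal_eq_span_two_sub_thetaInt h2 hζ hk v hv)
    exact ⟨ne_zero_of_ord_ne_zero (by rw [this]; norm_num), this⟩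
  · exact v.ord_eq_zero (mt (natCast_mem_of_two_sub_thetaInt_mem h2 hζ hk v) hv)

/-- The square of the difference is `(2 - θ_{j+k}) (2 - θ_{k-j})`, and the orders of both factors
are known from `ord_two_sub_theta`. -/
lemma ord_theta_sub_theta {j k : ℕ} (hjk : j < k) (hadd : (j + k).Coprime r)
    (hsub : (k - j).Coprime r)
    (v : HeightOneSpectrum (𝓞 (maximalRealSubfield F)))
    [Decidable ((r : 𝓞 (maximalRealSubfield F)) ∈ v.asIdeal)] :
    theta hζ k - theta hζ j ≠ 0 ∧
      (v.valuation (maximalRealSubfield F)).ord (theta hζ k - theta hζ j) =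
      if (r : 𝓞 (maximalRealSubfield F)) ∈ v.asIdeal then 1 else 0 := by
  have e : (theta hζ k - theta hζ j) ^ 2 =
      (2 - theta hζ (j + k)) * (2 - theta hζ (k - j)) := by
    have hζ0 : ζ ≠ 0 := hζ.ne_zero hr.out.ne_zero
    obtain ⟨d, rfl⟩ := Nat.exists_eq_add_of_lt hjk
    refine (algebraMap (maximalRealSubfield F) F).injective ?_
    simp only [map_mul, map_pow, _root_.map_sub, coe_theta, map_ofNat]
    rw [show j + d + 1 - j = d + 1 by omega]
    field_simp
    ring
  have h₁ := ord_two_sub_theta h2 hζ hadd v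
  have h₂ := ord_two_sub_theta h2 hζ hsub v
  have hne : theta hζ k - theta hζ j ≠ 0 := by
    intro h
    rw [h, zero_pow two_ne_zero] at e
    exact mul_ne_zero h₁.1 h₂.1 e.symm
  refine ⟨hne, ?_⟩
  have := congrArg (v.valuation (maximalRealSubfield F)).ord e
  rw [ord_pow, ord_mul h₁.1 h₂.1, h₁.2, h₂.2] at this
  push_cast at this
  linarith

/-- The element `2 + θ` is a unit. -/
lemma ord_two_add_theta {k : ℕ} (hk : k.Coprime r)
    (v : HeightOneSpectrum (𝓞 (maximalRealSubfield F))) :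
    2 + theta hζ k ≠ 0 ∧ (v.valuation (maximalRealSubfield F)).ord (2 + theta hζ k) = 0 := by
  classical
  -- Since `r` is odd, `2 - θ_k` and `2 - θ_{2k}` have the same order at every place.
  have e : (2 + theta hζ k) * (2 - theta hζ k) = 2 - theta hζ (2 * k) := by
    have hζ0 : ζ ≠ 0 := hζ.ne_zero hr.out.ne_zero
    refine (algebraMap (maximalRealSubfield F) F).injective ?_
    simp only [map_mul, map_add, _root_.map_sub, coe_theta, map_ofNat]
    field_simp
    ring
  have h₁ := ord_two_sub_theta h2 hζ hk v
  have h₂ := ord_two_sub_theta h2 hζ (Nat.Coprime.mul_left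
    ((Nat.coprime_primes Nat.prime_two hr.out).2 h2.ne) hk) v
  have hne : 2 + theta hζ k ≠ 0 := by
    intro h
    rw [h, zero_mul] at e
    exact h₂.1 e.symm
  refine ⟨hne, ?_⟩
  have := congrArg (v.valuation (maximalRealSubfield F)).ord e
  rw [ord_mul hne h₁.1, h₁.2, h₂.2] at this
  linarith

/-- The ideal `(ϖ)` is the unique place above `r`. -/
lemma exists_place_of_span_eq {ϖ : 𝓞 (maximalRealSubfield F)}
    (hϖ : Ideal.span {(r : 𝓞 (maximalRealSubfield F))} = Ideal.span {ϖ} ^ ((r - 1) / 2)) :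
    ∃ v₀ : HeightOneSpectrum (𝓞 (maximalRealSubfield F)), v₀.asIdeal = Ideal.span {ϖ} ∧
      ∀ v, (r : 𝓞 (maximalRealSubfield F)) ∈ v.asIdeal ↔ v = v₀ := by
  obtain ⟨ζ, hζ⟩ := IsCyclotomicExtension.exists_isPrimitiveRoot ℚ F (S := {r}) (n := r) rfl
    hr.out.ne_zero
  -- Taking norms gives `r ^ ((r - 1) / 2) = N(ϖ) ^ ((r - 1) / 2)`, so `(ϖ)` has prime norm `r`.
  have h := congrArg Ideal.absNorm hϖ
  rw [Ideal.absNorm_span_natCast, RingOfIntegers.rank, finrank_maximalRealSubfield h2,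
    map_pow] at h
  have h' := Nat.pow_left_injective (by omega : (r - 1) / 2 ≠ 0) h
  obtain ⟨h₁, h₃, h₄⟩ := isPrime_span_of_absNorm h'.symm
  refine ⟨⟨Ideal.span {ϖ}, h₁, by simpa using h₃⟩, rfl, fun v ↦ ⟨fun hv ↦ ?_, ?_⟩⟩
  · ext1
    rw [asIdeal_eq_span_two_sub_thetaInt h2 hζ (Nat.coprime_one_left r) v hv]
    exact (asIdeal_eq_span_two_sub_thetaInt h2 hζ (Nat.coprime_one_left r) ⟨_, h₁, _⟩ h₄).symm
  · rintro rfl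
    exact h₄

/-- The prime number `2` is unramified in `ℚ(ζ)`. -/
lemma ord_two_eq_one (v : HeightOneSpectrum (𝓞 (maximalRealSubfield F)))
    (hv : (2 : 𝓞 (maximalRealSubfield F)) ∈ v.asIdeal) :
    (v.valuation (maximalRealSubfield F)).ord 2 = 1 := by
  obtain ⟨w, hw, hwv⟩ := Ideal.nonempty_primesOver (S := 𝓞 F) v.asIdeal
  have : Fact (Nat.Prime 2) := ⟨Nat.prime_two⟩
  have hv' : ((2 : ℕ) : 𝓞 (maximalRealSubfield F)) ∈ v.asIdeal := by exact_mod_cast hv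
  have := liesOver_of_liesOver v.asIdeal w hv'
  have := ord_natCast_eq_one v w hv' (IsCyclotomicExtension.Rat.ramificationIdx_eq_of_not_dvd
    (m := r) 2 F w fun h ↦ h2.ne ((Nat.prime_dvd_prime_iff_eq Nat.prime_two hr.out).1 h))
  exact_mod_cast this

end Frey

/-! ### The conductor exponents of `Y ^ 2 = X (X - A) (X + B)` -/

namespace WeierstrassCurve

open Valuation HeightOneSpectrum

/-- The Weierstrass curve `Y ^ 2 = X (X - A) (X + B)`. -/
def ofRoots {K : Type*} [Field K] (A B : K) : WeierstrassCurve K :=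
  { a₁ := 0, a₂ := B - A, a₃ := 0, a₄ := -(A * B), a₆ := 0 }

section

variable {K : Type*} [Field K] (A B : K)

lemma Δ_ofRoots : (ofRoots A B).Δ = 2 ^ 4 * (A * B * (A + B)) ^ 2 := by
  simp only [ofRoots, Δ, b₂, b₄, b₆, b₈]; ring

lemma c₄_ofRoots : (ofRoots A B).c₄ = 2 ^ 4 * (A ^ 2 + A * B + B ^ 2) := by
  simp only [ofRoots, c₄, b₂, b₄]; ring

end

variable {K : Type*} [Field K] [NumberField K] {A B : K} {v : HeightOneSpectrum (𝓞 K)}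

lemma ord_Δ_ofRoots (hA : A ≠ 0) (hB : B ≠ 0) (hAB : A + B ≠ 0) :
    (ofRoots A B).Δ ≠ 0 ∧ (v.valuation K).ord (ofRoots A B).Δ =
      4 * (v.valuation K).ord 2 + 2 * ((v.valuation K).ord A + (v.valuation K).ord B +
        (v.valuation K).ord (A + B)) := by
  have h2 : (2 : K) ≠ 0 := two_ne_zero
  rw [Δ_ofRoots]
  refine ⟨by positivity, ?_⟩
  rw [ord_mul (by positivity) (by positivity), ord_pow, ord_pow, ord_mul (by positivity) hAB,
    ord_mul hA hB]
  norm_num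

lemma ordGE_c₄_ofRoots {q : ℚ} (hA : (v.valuation K).OrdGE q A) (hB : (v.valuation K).OrdGE q B) :
    (v.valuation K).OrdGE (4 * (v.valuation K).ord 2 + 2 * q) (ofRoots A B).c₄ := by
  rw [c₄_ofRoots]
  refine OrdGE.mul (OrdGE.of_eq (by rw [ord_pow]; norm_num)) ?_
  rw [sq, sq, two_mul]
  exact ((hA.mul hA).add (hA.mul hB)).add (hB.mul hB)

/-- A change of variables alters the discriminant by a twelfth power, so good reduction forces its
order to be a multiple of `12`. -/
lemma not_hasGoodReductionAt_ofRoots (hA : A ≠ 0) (hB : B ≠ 0) (hAB : A + B ≠ 0)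
    (h : ∀ n : ℤ, 4 * (v.valuation K).ord 2 + 2 * ((v.valuation K).ord A +
      (v.valuation K).ord B + (v.valuation K).ord (A + B)) ≠ 12 * n) :
    ¬ (ofRoots A B).HasGoodReductionAt v := by
  intro hgood
  obtain ⟨h0, hord⟩ := ord_Δ_ofRoots (v := v) hA hB hAB
  obtain ⟨n, hn⟩ := hgood.exists_ord_eq h0
  exact h n (hord.symm.trans hn)

/-- Multiplicative reduction means a non-integral `j`-invariant, that is `ord Δ > 3 ord c₄`. The
hypothesis contradicts this through the lower bound for `c₄`. -/
lemma not_hasMultiplicativeReductionAt_ofRoots {q : ℚ} (hA : (v.valuation K).OrdGE q A)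
    (hB : (v.valuation K).OrdGE q B) (hA0 : A ≠ 0) (hB0 : B ≠ 0) (hAB : A + B ≠ 0)
    (h : 4 * (v.valuation K).ord 2 + 2 * ((v.valuation K).ord A +
      (v.valuation K).ord B + (v.valuation K).ord (A + B)) ≤
      3 * (4 * (v.valuation K).ord 2 + 2 * q)) :
    ¬ (ofRoots A B).HasMultiplicativeReductionAt v := by
  intro hmult
  obtain ⟨h0, hord⟩ := ord_Δ_ofRoots (v := v) hA0 hB0 hAB
  have hlt := hmult.valuation_lt
  have hc0 : (ofRoots A B).c₄ ≠ 0 := by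
    intro h
    rw [h, map_zero, zero_pow three_ne_zero] at hlt
    exact not_lt_zero hlt
  have hc := (ordGE_c₄_ofRoots hA hB).le_ord hc0
  rw [← map_pow, lt_iff_not_ge, ← ord_le_ord_iff h0 (pow_ne_zero 3 hc0), hord, ord_pow,
    not_le] at hlt
  push_cast at hlt
  linarith

/-- Dividing the roots by `u ^ 2` makes all their differences units. -/
lemma hasGoodReductionAt_ofRoots (h2 : (v.valuation K).ord 2 = 0) {u : K} (hu : u ≠ 0)
    (hA0 : A ≠ 0) (hB0 : B ≠ 0) (hAB0 : A + B ≠ 0)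
    (hA : (v.valuation K).ord A = 2 * (v.valuation K).ord u)
    (hB : (v.valuation K).ord B = 2 * (v.valuation K).ord u)
    (hAB : (v.valuation K).ord (A + B) = 2 * (v.valuation K).ord u) :
    (ofRoots A B).HasGoodReductionAt v := by
  have hu' : ∀ n : ℕ, (v.valuation K).OrdGE (-(n * (v.valuation K).ord u)) (u⁻¹ ^ n) := fun n ↦
    OrdGE.of_eq (by rw [ord_pow, ord_inv, mul_neg])
  refine hasGoodReductionAt_of_variableChange ⟨Units.mk0 u hu, 0, 0, 0⟩ ?_ ?_ ?_ ?_ ?_ ?_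
  · simp [variableChange_a₁, ofRoots]
  · rw [← ordGE_zero_iff]
    have := ((hu' 2).mul ((OrdGE.of_eq hB).sub (OrdGE.of_eq hA))).mono (r := 0) (by simp)
    simpa [variableChange_a₂, ofRoots] using this
  · simp [variableChange_a₃, ofRoots]
  · rw [← ordGE_zero_iff]
    have := ((hu' 4).mul ((OrdGE.of_eq hA).mul (OrdGE.of_eq hB)).neg).mono (r := 0)
      (by push_cast; linarith)
    simpa [variableChange_a₄, ofRoots] using this
  · simp [variableChange_a₆, ofRoots]
  · obtain ⟨h0, hord⟩ := ord_Δ_ofRoots (v := v) hA0 hB0 hAB0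
    rw [variableChange_Δ, ← ord_eq_zero_iff (mul_ne_zero (by simp [hu]) h0),
      ord_mul (by simp [hu]) h0, hord, Units.val_inv_eq_inv_val, ord_pow, ord_inv, Units.val_mk0,
      hA, hB, hAB, h2]
    push_cast
    ring

lemma multiplicative_ofRoots (h2 : (v.valuation K).ord 2 = 0)
    (hA0 : A ≠ 0) (hB0 : B ≠ 0) (hAB0 : A + B ≠ 0)
    (hA : (v.valuation K).OrdGE 0 A) (hB : (v.valuation K).OrdGE 0 B)
    (hc : A ^ 2 + A * B + B ^ 2 ≠ 0 ∧ (v.valuation K).ord (A ^ 2 + A * B + B ^ 2) = 0)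
    (hpos : 0 < (v.valuation K).ord A + (v.valuation K).ord B + (v.valuation K).ord (A + B)) :
    (ofRoots A B).HasMultiplicativeReductionAt v ∧ ¬ (ofRoots A B).HasGoodReductionAt v := by
  obtain ⟨h0, hord⟩ := ord_Δ_ofRoots (v := v) hA0 hB0 hAB0
  have hc₄ : v.valuation K (ofRoots A B).c₄ = 1 := by
    have h20 : (2 : K) ^ 4 ≠ 0 := pow_ne_zero 4 two_ne_zero
    rw [c₄_ofRoots, ← ord_eq_zero_iff (mul_ne_zero h20 hc.1), ord_mul h20 hc.1, hc.2, ord_pow, h2]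
    norm_num
  have hΔ : v.valuation K (ofRoots A B).Δ < 1 := by
    rw [← ord_pos_iff h0, hord, h2]
    linarith
  refine ⟨hasMultiplicativeReductionAt_of_c₄ ?_ ?_ ?_ ?_ ?_ hΔ hc₄, fun h ↦ ?_⟩
  · simp [ofRoots]
  · exact ordGE_zero_iff.1 (hB.sub hA)
  · simp [ofRoots]
  · have := (hA.mul hB).neg
    rw [add_zero] at this
    exact ordGE_zero_iff.1 this
  · simp [ofRoots]
  · have := h.valuation_le
    rw [hc₄, one_pow] at this
    exact hΔ.not_ge this

open Classical in
lemma conductorExponent_ofRoots_eq_zero (h : (ofRoots A B).HasGoodReductionAt v) :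
    (ofRoots A B).conductorExponent v = 0 := by
  rw [conductorExponent, if_pos h]

/-- The conductor exponent at an odd place of multiplicative reduction. -/
lemma conductorExponent_ofRoots_eq_one (h2 : (v.valuation K).ord 2 = 0)
    (hA0 : A ≠ 0) (hB0 : B ≠ 0) (hAB0 : A + B ≠ 0)
    (hA : (v.valuation K).OrdGE 0 A) (hB : (v.valuation K).OrdGE 0 B)
    (hc : A ^ 2 + A * B + B ^ 2 ≠ 0 ∧ (v.valuation K).ord (A ^ 2 + A * B + B ^ 2) = 0)
    (hpos : 0 < (v.valuation K).ord A + (v.valuation K).ord B + (v.valuation K).ord (A + B)) :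
    (ofRoots A B).conductorExponent v = 1 := by
  obtain ⟨h₁, h₂⟩ := multiplicative_ofRoots h2 hA0 hB0 hAB0 hA hB hc hpos
  rw [conductorExponent, if_neg h₂, if_pos h₁]

/-- The conductor exponent at an odd place of additive reduction of type `I₀*`. -/
lemma conductorExponent_ofRoots_eq_two (hv : (2 : 𝓞 K) ∉ v.asIdeal)
    (hA : (v.valuation K).ord A = 1) (hB : (v.valuation K).ord B = 1)
    (hAB : (v.valuation K).ord (A + B) = 1) :
    (ofRoots A B).conductorExponent v = 2 := by
  have h2 : (v.valuation K).ord 2 = 0 := by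
    rw [← map_ofNat (algebraMap (𝓞 K) K) 2]
    exact (v.ord_eq_zero hv).2
  have hne : ∀ {x : K}, (v.valuation K).ord x = 1 → x ≠ 0 := fun h ↦
    ne_zero_of_ord_ne_zero (by rw [h]; exact one_ne_zero)
  rw [conductorExponent, if_neg, if_neg, wildConductorExponent_eq_zero v hv rfl rfl rfl rfl rfl]
  · simp
  · refine not_hasMultiplicativeReductionAt_ofRoots (OrdGE.of_eq hA) (OrdGE.of_eq hB) (hne hA)
      (hne hB) (hne hAB) ?_
    rw [h2, hA, hB, hAB]
    norm_num
  · refine not_hasGoodReductionAt_ofRoots (hne hA) (hne hB) (hne hAB) fun n hn ↦ ?_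
    rw [h2, hA, hB, hAB] at hn
    have : (6 : ℤ) = 12 * n := by exact_mod_cast (by linarith : (6 : ℚ) = 12 * n)
    omega

/-- The conductor exponent at an unramified place above `2`. -/
lemma conductorExponent_ofRoots_of_two_mem (h2 : (v.valuation K).ord 2 = 1)
    (hv : (2 : 𝓞 K) ∈ v.asIdeal) (hA0 : A ≠ 0) (hB0 : B ≠ 0) (hAB0 : A + B ≠ 0)
    (hA : (v.valuation K).ord A = 0) (hB : (v.valuation K).ord B = 0)
    (hAB : (v.valuation K).ord (A + B) = 0) :
    (ofRoots A B).conductorExponent v = 2 ∨ (ofRoots A B).conductorExponent v = 3 ∨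
      (ofRoots A B).conductorExponent v = 4 := by
  have hwild : (ofRoots A B).wildConductorExponent v < 3 := by
    have hgA := OrdGE.of_eq hA
    have hgB := OrdGE.of_eq hB
    have hg2 := OrdGE.of_eq h2
    -- Modulo `2`, the derivative of the cubic is `x ^ 2 - A B`, so this `x₀` makes the linear
    -- coefficient of the shifted cubic even. The constant one is congruent to `(A + B) x₀ ^ 2`, a
    -- unit.
    obtain ⟨x₀, hx₀⟩ := v.exists_sq_sub (K := K) hv (a := A * B) (by simpa using hgA.mul hgB)
    have hx0 : x₀ ≠ 0 ∧ (v.valuation K).ord x₀ = 0 := by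
      have h := ord_eq_of_sub (mul_ne_zero hA0 hB0) hx₀
        (by rw [ord_mul hA0 hB0, hA, hB]; norm_num)
      rw [ord_pow, ord_mul hA0 hB0, hA, hB] at h
      refine ⟨fun h0 ↦ h.1 (by rw [h0, zero_pow two_ne_zero]), ?_⟩
      have := h.2
      push_cast at this
      linarith
    have hgx := OrdGE.of_eq hx0.2
    refine wildConductorExponent_lt_three v hv rfl rfl h2 x₀ ?_ ?_ ?_
    · have := (ordGE_ofNat (w := v.valuation K) 3).mul hgx
      rw [add_zero] at this
      exact (hgB.sub hgA).add this
    · have e : 3 * x₀ ^ 2 + 2 * (B - A) * x₀ + -(A * B) =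
          3 * (x₀ ^ 2 - A * B) + 2 * (A * B) + 2 * ((B - A) * x₀) := by ring
      change (v.valuation K).OrdGE 1 (3 * x₀ ^ 2 + 2 * (B - A) * x₀ + -(A * B))
      rw [e]
      refine ((((ordGE_ofNat 3).mul hx₀).mono (by norm_num)).add
        ((hg2.mul (hgA.mul hgB)).mono (by norm_num))).add
        ((hg2.mul ((hgB.sub hgA).mul hgx)).mono (by norm_num))
    · have e : x₀ ^ 3 + (B - A) * x₀ ^ 2 + -(A * B) * x₀ + 0 =
          (A + B) * x₀ ^ 2 + (x₀ * (x₀ ^ 2 - A * B) - 2 * (A * x₀ ^ 2)) := by ring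
      change x₀ ^ 3 + (B - A) * x₀ ^ 2 + -(A * B) * x₀ + 0 ≠ 0 ∧
        (v.valuation K).ord (x₀ ^ 3 + (B - A) * x₀ ^ 2 + -(A * B) * x₀ + 0) = 0
      rw [e]
      have hx2 : x₀ ^ 2 ≠ 0 := pow_ne_zero 2 hx0.1
      have hord : (v.valuation K).ord ((A + B) * x₀ ^ 2) = 0 := by
        rw [ord_mul hAB0 hx2, hAB, ord_pow, hx0.2]; norm_num
      have := ord_add_eq (q := 1) (mul_ne_zero hAB0 hx2)
        (((hgx.mul hx₀).mono (by norm_num)).sub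
          ((hg2.mul (hgA.mul (hgx.pow 2 two_ne_zero))).mono (by norm_num)))
        (by rw [hord]; norm_num)
      rwa [hord] at this
  rw [conductorExponent, if_neg, if_neg]
  · have := (Nat.floor_lt' (n := 3) three_ne_zero).2 (by exact_mod_cast hwild)
    omega
  · refine not_hasMultiplicativeReductionAt_ofRoots (OrdGE.of_eq hA) (OrdGE.of_eq hB) hA0 hB0
      hAB0 ?_
    rw [h2, hA, hB, hAB]
    norm_num
  · refine not_hasGoodReductionAt_ofRoots hA0 hB0 hAB0 fun n hn ↦ ?_
    rw [h2, hA, hB, hAB] at hn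
    have : (4 : ℤ) = 12 * n := by exact_mod_cast (by linarith : (4 : ℚ) = 12 * n)
    omega

end WeierstrassCurve

/-! ### Divisibility of the values `f_k(a, b)` -/

namespace IsDedekindDomain.HeightOneSpectrum

open Valuation

variable {K : Type*} [Field K] (v : HeightOneSpectrum (𝓞 K))

lemma intCast_mem_iff {p : ℕ} [Fact p.Prime] (hp : (p : 𝓞 K) ∈ v.asIdeal) (n : ℤ) :
    (n : 𝓞 K) ∈ v.asIdeal ↔ (p : ℤ) ∣ n := by
  have := liesOver_span_of_mem v.asIdeal hp
  rw [← Ideal.mem_span_singleton, Ideal.mem_of_liesOver v.asIdeal (Ideal.span {(p : ℤ)}),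
    algebraMap_int_eq, eq_intCast]

lemma notMem_of_isCoprime {a b : ℤ} (hab : IsCoprime a b) (ha : (a : 𝓞 K) ∈ v.asIdeal) :
    (b : 𝓞 K) ∉ v.asIdeal := by
  intro hb
  obtain ⟨x, y, hxy⟩ := hab
  refine v.isPrime.ne_top ((Ideal.eq_top_iff_one _).2 ?_)
  have := v.asIdeal.add_mem (v.asIdeal.mul_mem_left (x : 𝓞 K) ha)
    (v.asIdeal.mul_mem_left (y : 𝓞 K) hb)
  rwa [← Int.cast_mul, ← Int.cast_mul, ← Int.cast_add, hxy, Int.cast_one] at this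

variable [NumberField K]

lemma notMem_of_ord_eq_zero {x : 𝓞 K} (hx : algebraMap (𝓞 K) K x ≠ 0)
    (h : (v.valuation K).ord (algebraMap (𝓞 K) K x) = 0) : x ∉ v.asIdeal := fun hmem ↦ by
  have := ((v.ordGE_one_iff_mem (K := K) x).2 hmem).le_ord hx
  rw [h] at this
  norm_num at this

lemma ord_sq_add_mul {x y z : K} (hx : x ≠ 0) (hx0 : (v.valuation K).ord x = 0)
    (hy : (v.valuation K).OrdGE 1 y) (hz : (v.valuation K).OrdGE 0 z) :
    x ^ 2 + y * z ≠ 0 ∧ (v.valuation K).ord (x ^ 2 + y * z) = 0 := by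
  have h : (v.valuation K).ord (x ^ 2) = 0 := by rw [ord_pow, hx0, mul_zero]
  have := ord_add_eq (q := 1) (pow_ne_zero 2 hx) (by simpa using hy.mul hz) (by rw [h]; norm_num)
  rwa [h] at this

end IsDedekindDomain.HeightOneSpectrum

namespace Frey

open Valuation HeightOneSpectrum WeierstrassCurve

variable {F : Type*} [Field F] [NumberField F] {r : ℕ} {ζ : F}

/-- The value `f_k(a, b)` as an algebraic integer. -/
def fInt [NeZero r] (hζ : IsPrimitiveRoot ζ r) (k : ℕ) (a b : ℤ) : 𝓞 (maximalRealSubfield F) :=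
  (a : 𝓞 (maximalRealSubfield F)) ^ 2 + thetaInt hζ k * a * b + (b : 𝓞 (maximalRealSubfield F)) ^ 2

lemma algebraMap_fInt [NeZero r] (hζ : IsPrimitiveRoot ζ r) (k : ℕ) (a b : ℤ) :
    algebraMap (𝓞 (maximalRealSubfield F)) (maximalRealSubfield F) (fInt hζ k a b) =
      f hζ k a b := by
  simp only [fInt, f, map_add, map_mul, map_pow, map_intCast, algebraMap_thetaInt]

/-- Each of `a`, `b` is `0` or `±1` and they do not both vanish, so the form takes the value `1` or
`2 ± t`. -/
lemma quadratic_ne_zero {Q : Type*} [CommRing Q] [IsDomain Q] {a b t : Q}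
    (ha : a * (a ^ 2 - 1) = 0) (hb : b * (b ^ 2 - 1) = 0) (hab : a = 0 → b ≠ 0)
    (h₁ : 2 - t ≠ 0) (h₂ : 2 + t ≠ 0) : a ^ 2 + t * a * b + b ^ 2 ≠ 0 := by
  intro h
  rcases mul_eq_zero.1 ha with ha | ha
  · refine hab ha (pow_eq_zero_iff two_ne_zero |>.1 ?_)
    rw [ha] at h
    linear_combination h
  rcases mul_eq_zero.1 hb with hb | hb
  · refine hab (pow_eq_zero_iff two_ne_zero |>.1 ?_) hb
    rw [hb] at h
    linear_combination h
  have : (a * b - 1) * (a * b + 1) = 0 := by linear_combination b ^ 2 * ha + hb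
  rcases mul_eq_zero.1 this with hab | hab
  · exact h₂ (by linear_combination h - ha - hb - t * hab)
  · exact h₁ (by linear_combination h - ha - hb - t * hab)

lemma six_dvd_mul_sq_sub_one (a : ℤ) : (6 : ℤ) ∣ a * (a ^ 2 - 1) := by
  have h : a % 6 = 0 ∨ a % 6 = 1 ∨ a % 6 = 2 ∨ a % 6 = 3 ∨ a % 6 = 4 ∨ a % 6 = 5 := by omega
  rw [Int.dvd_iff_emod_eq_zero]
  rcases h with h | h | h | h | h | h <;> simp [Int.mul_emod, Int.sub_emod, pow_two, h]

variable [hr : Fact r.Prime] [IsCyclotomicExtension {r} ℚ F] (h2 : 2 < r)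
  (hζ : IsPrimitiveRoot ζ r) {k : ℕ} (v : HeightOneSpectrum (𝓞 (maximalRealSubfield F)))

include h2

/-- Since `6 ∣ x (x ^ 2 - 1)`, residue characteristics `2` and `3` are treated together: integers
reduce to `0` or `±1`, and `2 ± θ_k` do not vanish away from `r`. -/
lemma fInt_notMem_of_six_mem (hk : k.Coprime r) {a b : ℤ} (hab : IsCoprime a b)
    (h6 : (6 : 𝓞 (maximalRealSubfield F)) ∈ v.asIdeal)
    (hrv : (r : 𝓞 (maximalRealSubfield F)) ∉ v.asIdeal) : fInt hζ k a b ∉ v.asIdeal := by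
  have h₁ := mt (natCast_mem_of_two_sub_thetaInt_mem h2 hζ hk v) hrv
  have h₂ : 2 + thetaInt hζ k ∉ v.asIdeal := by
    have h := ord_two_add_theta h2 hζ hk v
    have e : algebraMap _ (maximalRealSubfield F) (2 + thetaInt hζ k) = 2 + theta hζ k := by
      rw [map_add, map_ofNat]; rfl
    rw [← e] at h
    exact v.notMem_of_ord_eq_zero h.1 h.2
  have hcube : ∀ x : ℤ, (x : 𝓞 (maximalRealSubfield F)) *
      ((x : 𝓞 (maximalRealSubfield F)) ^ 2 - 1) ∈ v.asIdeal := fun x ↦ by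
    obtain ⟨m, hm⟩ := six_dvd_mul_sq_sub_one x
    have := v.asIdeal.mul_mem_right (m : 𝓞 (maximalRealSubfield F)) h6
    convert this using 1
    exact_mod_cast hm
  have hcop := v.notMem_of_isCoprime hab
  simp only [← Ideal.Quotient.eq_zero_iff_mem, fInt, map_add, _root_.map_sub, map_mul, map_pow,
    map_ofNat, map_one] at h₁ h₂ hcube hcop ⊢
  exact quadratic_ne_zero (hcube a) (hcube b) hcop h₁ h₂

omit [IsCyclotomicExtension {r} ℚ F] h2 in
lemma f_eq_sub (a b : ℤ) : f hζ k a b =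
    (a + b : maximalRealSubfield F) ^ 2 - (2 - theta hζ k) * (a * b) := by
  rw [f]; ring

/-- In `(a + b) ^ 2 - (2 - θ) a b`, the first term is a unit at `r` and the second has positive
order. -/
lemma ord_f_of_not_dvd (hk : k.Coprime r) {a b : ℤ} (hab : ¬ (r : ℤ) ∣ a + b)
    (hrv : (r : 𝓞 (maximalRealSubfield F)) ∈ v.asIdeal) :
    f hζ k a b ≠ 0 ∧ (v.valuation (maximalRealSubfield F)).ord (f hζ k a b) = 0 := by
  classical
  have h₁ := v.ord_eq_zero (K := maximalRealSubfield F) (mt (v.intCast_mem_iff hrv _).1 hab)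
  rw [map_intCast, Int.cast_add] at h₁
  have h₂ := (ord_two_sub_theta h2 hζ hk v).2
  rw [if_pos hrv] at h₂
  have h₃ := ((OrdGE.of_eq h₂).mul ((ord_int_nonneg a).mul (ord_int_nonneg b))).neg
  have := v.ord_sq_add_mul (z := 1) h₁.1 h₁.2 (h₃.mono (by norm_num)) ordGE_one
  rwa [mul_one, ← sub_eq_add_neg, ← f_eq_sub] at this

/-- Now `(a + b) ^ 2` has order at least `2`. Coprimality makes both `a` and `b` prime to `r`, so
`(2 - θ) a b` has order exactly `1` and dominates. -/
lemma ord_f_of_dvd (hk : k.Coprime r) {a b : ℤ} (hcop : IsCoprime a b) (hab : (r : ℤ) ∣ a + b)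
    (hrv : (r : 𝓞 (maximalRealSubfield F)) ∈ v.asIdeal) :
    f hζ k a b ≠ 0 ∧ (v.valuation (maximalRealSubfield F)).ord (f hζ k a b) = 1 := by
  classical
  have hmem := (v.intCast_mem_iff hrv _).2 hab
  have ha : (a : 𝓞 (maximalRealSubfield F)) ∉ v.asIdeal := fun ha ↦ by
    refine v.notMem_of_isCoprime hcop ha ?_
    have := v.asIdeal.sub_mem hmem ha
    rwa [Int.cast_add, add_sub_cancel_left] at this
  have hb : (b : 𝓞 (maximalRealSubfield F)) ∉ v.asIdeal := fun hb ↦ by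
    refine v.notMem_of_isCoprime hcop.symm hb ?_
    have := v.asIdeal.sub_mem hmem hb
    rwa [Int.cast_add, add_sub_cancel_right] at this
  have h₁ := (v.ordGE_one_iff_mem (K := maximalRealSubfield F) _).2 hmem
  have ha' := v.ord_eq_zero (K := maximalRealSubfield F) ha
  have hb' := v.ord_eq_zero (K := maximalRealSubfield F) hb
  rw [map_intCast] at h₁ ha' hb'
  rw [Int.cast_add] at h₁
  have h₂ := ord_two_sub_theta h2 hζ hk v
  rw [if_pos hrv] at h₂
  have hne : -((2 - theta hζ k) * (a * b)) ≠ 0 :=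
    neg_ne_zero.2 (mul_ne_zero h₂.1 (mul_ne_zero ha'.1 hb'.1))
  have hord : (v.valuation (maximalRealSubfield F)).ord (-((2 - theta hζ k) * (a * b))) = 1 := by
    rw [ord_neg, ord_mul h₂.1 (mul_ne_zero ha'.1 hb'.1), ord_mul ha'.1 hb'.1, h₂.2, ha'.2, hb'.2]
    norm_num
  have := ord_add_eq hne (h₁.pow 2 two_ne_zero) (by rw [hord]; norm_num)
  rwa [hord, neg_add_eq_sub, ← f_eq_sub] at this

omit [IsCyclotomicExtension {r} ℚ F] h2 in
/-- Two of the values `f_k(a, b)` have no common prime divisor outside of `r`. -/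
lemma fInt_notMem_of_mem {j : ℕ} {a b : ℤ} (hcop : IsCoprime a b)
    (h : thetaInt hζ k - thetaInt hζ j ∉ v.asIdeal) (hj : fInt hζ j a b ∈ v.asIdeal) :
    fInt hζ k a b ∉ v.asIdeal := by
  intro hk
  have hsub := v.asIdeal.sub_mem hk hj
  rw [show fInt hζ k a b - fInt hζ j a b = (thetaInt hζ k - thetaInt hζ j) * (a * b) by
    simp only [fInt]; ring] at hsub
  have hmem : ∀ x y : ℤ, IsCoprime x y → (x : 𝓞 (maximalRealSubfield F)) ∈ v.asIdeal →
      (x : 𝓞 (maximalRealSubfield F)) ^ 2 + thetaInt hζ j * x * y + y ^ 2 ∉ v.asIdeal := by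
    intro x y hxy hx hsum
    refine v.notMem_of_isCoprime hxy hx (v.isPrime.mem_of_pow_mem 2 ?_)
    have := v.asIdeal.sub_mem hsum (v.asIdeal.mul_mem_right
      ((x : 𝓞 (maximalRealSubfield F)) + thetaInt hζ j * y) hx)
    convert this using 1
    ring
  rcases v.isPrime.mem_or_mem ((v.isPrime.mem_or_mem hsub).resolve_left h) with ha | hb
  · exact hmem a b hcop ha hj
  · refine hmem b a hcop.symm hb ?_
    rw [fInt] at hj
    convert hj using 1
    ring

end Frey

/-! ### Local conductor exponents of the Frey curve -/

namespace Frey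

open Valuation HeightOneSpectrum WeierstrassCurve

variable {F : Type*} [Field F] [NumberField F] {r : ℕ} {ζ : F}
  [hr : Fact r.Prime] [IsCyclotomicExtension {r} ℚ F] (h2 : 2 < r)
  (hζ : IsPrimitiveRoot ζ r) {k₁ k₂ k₃ : ℕ} (hk₁ : 1 ≤ k₁) (hk₁₂ : k₁ < k₂) (hk₂₃ : k₂ < k₃)
  (hk₃ : k₃ ≤ (r - 1) / 2) (a b : ℤ)
  (v : HeightOneSpectrum (𝓞 (maximalRealSubfield F)))

local notation "K⁺" => maximalRealSubfield F

include h2 hk₁ hk₁₂ hk₂₃ hk₃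

open Classical in
/-- The orders of the roots of the Frey curve and of their difference. -/
lemma exists_curve_eq_ofRoots (h₁ : f hζ k₁ a b ≠ 0) (h₂ : f hζ k₂ a b ≠ 0)
    (h₃ : f hζ k₃ a b ≠ 0) :
    ∃ A B : K⁺, curve hζ k₁ k₂ k₃ a b = ofRoots A B ∧ A ≠ 0 ∧ B ≠ 0 ∧ A + B ≠ 0 ∧
      (v.valuation K⁺).ord A =
        (if (r : 𝓞 K⁺) ∈ v.asIdeal then 1 else 0) + (v.valuation K⁺).ord (f hζ k₁ a b) ∧
      (v.valuation K⁺).ord B =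
        (if (r : 𝓞 K⁺) ∈ v.asIdeal then 1 else 0) + (v.valuation K⁺).ord (f hζ k₂ a b) ∧
      (v.valuation K⁺).ord (A + B) =
        (if (r : 𝓞 K⁺) ∈ v.asIdeal then 1 else 0) + (v.valuation K⁺).ord (f hζ k₃ a b) := by
  have hcop : ∀ {m : ℕ}, 0 < m → m < r → m.Coprime r := fun h h' ↦
    (Nat.coprime_of_lt_prime h.ne' h' hr.out).symm
  have hα := ord_theta_sub_theta h2 hζ hk₂₃ (hcop (by omega) (by omega))
    (hcop (by omega) (by omega)) v
  have hβ := ord_theta_sub_theta h2 hζ (hk₁₂.trans hk₂₃) (hcop (by omega) (by omega))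
    (hcop (by omega) (by omega)) v
  have hγ := ord_theta_sub_theta h2 hζ hk₁₂ (hcop (by omega) (by omega))
    (hcop (by omega) (by omega)) v
  have hα0 := hα.1
  have hβ0 : theta hζ k₁ - theta hζ k₃ ≠ 0 := by
    rw [← neg_sub]; exact neg_ne_zero.2 hβ.1
  have hγ0 := hγ.1
  -- The forms `f_k` span a two-dimensional space, generated by `a ^ 2 + b ^ 2` and `a b`. The
  -- coefficients `α`, `β`, `γ` are the resulting relation: `α + β + γ = 0` and `α θ_{k₁} + β θ_{k₂}
  -- + γ θ_{k₃} = 0`.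
  have hsum : (theta hζ k₃ - theta hζ k₂) * f hζ k₁ a b +
      (theta hζ k₁ - theta hζ k₃) * f hζ k₂ a b =
      -((theta hζ k₂ - theta hζ k₁) * f hζ k₃ a b) := by
    simp only [f]; ring
  refine ⟨_, _, rfl, mul_ne_zero hα0 h₁, mul_ne_zero hβ0 h₂, ?_, ?_, ?_, ?_⟩
  · rw [hsum]
    exact neg_ne_zero.2 (mul_ne_zero hγ0 h₃)
  · rw [ord_mul hα0 h₁, hα.2]
  · rw [ord_mul hβ0 h₂, ord_sub_comm, hβ.2]
  · rw [hsum, ord_neg, ord_mul hγ0 h₃, hγ.2]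

lemma coprime_of_mem {k : ℕ} (hk : k = k₁ ∨ k = k₂ ∨ k = k₃) : k.Coprime r :=
  (Nat.coprime_of_lt_prime (by omega) (by omega) hr.out).symm

lemma theta_sub_theta_notMem (hrv : (r : 𝓞 K⁺) ∉ v.asIdeal) :
    thetaInt hζ k₃ - thetaInt hζ k₂ ∉ v.asIdeal ∧ thetaInt hζ k₃ - thetaInt hζ k₁ ∉ v.asIdeal ∧
      thetaInt hζ k₂ - thetaInt hζ k₁ ∉ v.asIdeal := by
  classical
  have key : ∀ {j k : ℕ}, 1 ≤ j → j < k → k ≤ (r - 1) / 2 →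
      thetaInt hζ k - thetaInt hζ j ∉ v.asIdeal := fun {j k} hj hjk hk ↦ by
    have h := ord_theta_sub_theta h2 hζ hjk
      (Nat.coprime_of_lt_prime (by omega) (by omega) hr.out).symm
      (Nat.coprime_of_lt_prime (by omega) (by omega) hr.out).symm v
    rw [if_neg hrv] at h
    have e : algebraMap _ K⁺ (thetaInt hζ k - thetaInt hζ j) = theta hζ k - theta hζ j := by
      rw [_root_.map_sub]; rfl
    rw [← e] at h
    exact v.notMem_of_ord_eq_zero h.1 h.2
  exact ⟨key (by omega) hk₂₃ hk₃, key hk₁ (by omega) hk₃, key hk₁ hk₁₂ (by omega)⟩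

variable {a b}

/-- The conductor exponents of the Frey curve above `2`. -/
lemma conductorExponent_curve_of_two_mem (hcop : IsCoprime a b) (hv : (2 : 𝓞 K⁺) ∈ v.asIdeal)
    (hrv : (r : 𝓞 K⁺) ∉ v.asIdeal) :
    (curve hζ k₁ k₂ k₃ a b).conductorExponent v = 2 ∨
      (curve hζ k₁ k₂ k₃ a b).conductorExponent v = 3 ∨
      (curve hζ k₁ k₂ k₃ a b).conductorExponent v = 4 := by
  classical
  have h6 : (6 : 𝓞 K⁺) ∈ v.asIdeal := by
    have := v.asIdeal.mul_mem_left 3 hv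
    norm_num at this
    exact this
  have hk := fun {k} ↦ coprime_of_mem (k := k) h2 hk₁ hk₁₂ hk₂₃ hk₃
  have hf : ∀ k, (k = k₁ ∨ k = k₂ ∨ k = k₃) →
      f hζ k a b ≠ 0 ∧ (v.valuation K⁺).ord (f hζ k a b) = 0 := fun k h ↦ by
    rw [← algebraMap_fInt]
    exact v.ord_eq_zero (fInt_notMem_of_six_mem h2 hζ v (hk h) hcop h6 hrv)
  obtain ⟨h₁, e₁⟩ := hf k₁ (by tauto)
  obtain ⟨h₂, e₂⟩ := hf k₂ (by tauto)
  obtain ⟨h₃, e₃⟩ := hf k₃ (by tauto)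
  obtain ⟨A, B, hW, hA, hB, hAB, oA, oB, oAB⟩ :=
    exists_curve_eq_ofRoots h2 hζ hk₁ hk₁₂ hk₂₃ hk₃ a b v h₁ h₂ h₃
  rw [if_neg hrv, zero_add] at oA oB oAB
  rw [hW]
  exact conductorExponent_ofRoots_of_two_mem (ord_two_eq_one h2 v hv) hv hA hB hAB
    (oA.trans e₁) (oB.trans e₂) (oAB.trans e₃)

/-- The conductor exponent of the Frey curve at the place above `r`. -/
lemma conductorExponent_curve_of_natCast_mem (hcop : IsCoprime a b)
    (hrv : (r : 𝓞 K⁺) ∈ v.asIdeal) (hv : (2 : 𝓞 K⁺) ∉ v.asIdeal) :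
    (curve hζ k₁ k₂ k₃ a b).conductorExponent v = if (r : ℤ) ∣ a + b then 0 else 2 := by
  classical
  have hk := fun {k} ↦ coprime_of_mem (k := k) h2 hk₁ hk₁₂ hk₂₃ hk₃
  have hf : ∀ k, (k = k₁ ∨ k = k₂ ∨ k = k₃) →
      f hζ k a b ≠ 0 ∧ (v.valuation K⁺).ord (f hζ k a b) =
        if (r : ℤ) ∣ a + b then 1 else 0 := fun k h ↦ by
    split_ifs with hab
    · exact ord_f_of_dvd h2 hζ v (hk h) hcop hab hrv
    · exact ord_f_of_not_dvd h2 hζ v (hk h) hab hrv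
  obtain ⟨h₁, e₁⟩ := hf k₁ (by tauto)
  obtain ⟨h₂, e₂⟩ := hf k₂ (by tauto)
  obtain ⟨h₃, e₃⟩ := hf k₃ (by tauto)
  obtain ⟨A, B, hW, hA, hB, hAB, oA, oB, oAB⟩ :=
    exists_curve_eq_ofRoots h2 hζ hk₁ hk₁₂ hk₂₃ hk₃ a b v h₁ h₂ h₃
  rw [if_pos hrv] at oA oB oAB
  rw [hW]
  split_ifs at e₁ e₂ e₃ ⊢ with hab
  · have h1 := Nat.coprime_one_left r
    -- The uniformizer `2 - θ_1` serves as scaling factor: `A`, `B` and `A + B` all have order `1 +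
    -- 1 = 2`.
    have hu := ord_two_sub_theta h2 hζ h1 v
    rw [if_pos hrv] at hu
    have h20 : (v.valuation K⁺).ord 2 = 0 := by
      rw [← map_ofNat (algebraMap (𝓞 K⁺) K⁺) 2]
      exact (v.ord_eq_zero hv).2
    refine conductorExponent_ofRoots_eq_zero
      (hasGoodReductionAt_ofRoots h20 hu.1 hA hB hAB ?_ ?_ ?_)
    · rw [oA, e₁, hu.2]; norm_num
    · rw [oB, e₂, hu.2]; norm_num
    · rw [oAB, e₃, hu.2]; norm_num
  · exact conductorExponent_ofRoots_eq_two hv (by rw [oA, e₁, add_zero])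
      (by rw [oB, e₂, add_zero]) (by rw [oAB, e₃, add_zero])

/-- Reduction of the Frey curve at places not dividing `f_{k₁} f_{k₂} f_{k₃}` or `2 r`. -/
lemma hasGoodReductionAt_curve (hv : (2 : 𝓞 K⁺) ∉ v.asIdeal) (hrv : (r : 𝓞 K⁺) ∉ v.asIdeal)
    (h : fInt hζ k₁ a b * fInt hζ k₂ a b * fInt hζ k₃ a b ∉ v.asIdeal) :
    (curve hζ k₁ k₂ k₃ a b).HasGoodReductionAt v := by
  classical
  have hm₃ : fInt hζ k₃ a b ∉ v.asIdeal := fun h' ↦ h (v.asIdeal.mul_mem_left _ h')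
  have hm₂ : fInt hζ k₂ a b ∉ v.asIdeal := fun h' ↦
    h (v.asIdeal.mul_mem_right _ (v.asIdeal.mul_mem_left _ h'))
  have hm₁ : fInt hζ k₁ a b ∉ v.asIdeal := fun h' ↦
    h (v.asIdeal.mul_mem_right _ (v.asIdeal.mul_mem_right _ h'))
  have hf : ∀ {k}, fInt hζ k a b ∉ v.asIdeal →
      f hζ k a b ≠ 0 ∧ (v.valuation K⁺).ord (f hζ k a b) = 0 := fun h ↦ by
    rw [← algebraMap_fInt]; exact v.ord_eq_zero h
  obtain ⟨A, B, hW, hA, hB, hAB, oA, oB, oAB⟩ :=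
    exists_curve_eq_ofRoots h2 hζ hk₁ hk₁₂ hk₂₃ hk₃ a b v
    (hf hm₁).1 (hf hm₂).1 (hf hm₃).1
  rw [if_neg hrv, zero_add] at oA oB oAB
  have h20 : (v.valuation K⁺).ord 2 = 0 := by
    rw [← map_ofNat (algebraMap (𝓞 K⁺) K⁺) 2]
    exact (v.ord_eq_zero hv).2
  rw [hW]
  refine hasGoodReductionAt_ofRoots h20 one_ne_zero hA hB hAB ?_ ?_ ?_
  · rw [oA, (hf hm₁).2, ord_one, mul_zero]
  · rw [oB, (hf hm₂).2, ord_one, mul_zero]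
  · rw [oAB, (hf hm₃).2, ord_one, mul_zero]

/-- The conductor exponent at the primes dividing `f_{k₁} f_{k₂} f_{k₃}` but not `2 r`. -/
lemma conductorExponent_curve_eq_one (hcop : IsCoprime a b) (hv : (2 : 𝓞 K⁺) ∉ v.asIdeal)
    (hrv : (r : 𝓞 K⁺) ∉ v.asIdeal)
    (h₁ : f hζ k₁ a b ≠ 0) (h₂ : f hζ k₂ a b ≠ 0) (h₃ : f hζ k₃ a b ≠ 0)
    (h : fInt hζ k₁ a b * fInt hζ k₂ a b * fInt hζ k₃ a b ∈ v.asIdeal) :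
    (curve hζ k₁ k₂ k₃ a b).conductorExponent v = 1 := by
  classical
  obtain ⟨A, B, hW, hA, hB, hAB, oA, oB, oAB⟩ :=
    exists_curve_eq_ofRoots h2 hζ hk₁ hk₁₂ hk₂₃ hk₃ a b v h₁ h₂ h₃
  rw [if_neg hrv, zero_add] at oA oB oAB
  have h20 : (v.valuation K⁺).ord 2 = 0 := by
    rw [← map_ofNat (algebraMap (𝓞 K⁺) K⁺) 2]
    exact (v.ord_eq_zero hv).2
  obtain ⟨hα, hβ, hγ⟩ := theta_sub_theta_notMem h2 hζ hk₁ hk₁₂ hk₂₃ hk₃ v hrv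
  have hneg : ∀ {x y : 𝓞 K⁺}, x - y ∉ v.asIdeal → y - x ∉ v.asIdeal := fun h h' ↦ by
    rw [← neg_sub, neg_mem_iff] at h'; exact h h'
  have h0 : ∀ {k} {x : K⁺}, x ≠ 0 → (v.valuation K⁺).ord x = (v.valuation K⁺).ord (f hζ k a b) →
      fInt hζ k a b ∉ v.asIdeal → (v.valuation K⁺).ord x = 0 := fun hx e h ↦ by
    rw [e, ← algebraMap_fInt]; exact (v.ord_eq_zero h).2
  have h1 : ∀ {k} {x : K⁺}, x ≠ 0 → f hζ k a b ≠ 0 →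
      (v.valuation K⁺).ord x = (v.valuation K⁺).ord (f hζ k a b) →
      fInt hζ k a b ∈ v.asIdeal → 1 ≤ (v.valuation K⁺).ord x := fun hx hf e h ↦ by
    rw [← v.ordGE_one_iff_mem (K := K⁺), algebraMap_fInt] at h
    rw [e]; exact h.le_ord hf
  rw [hW]
  -- Exactly one of `A`, `B`, `A + B` has positive order. In each case `A ^ 2 + A B + B ^ 2` is the
  -- square of a unit plus a multiple of that element, so `c₄` is a unit.
  rcases v.isPrime.mem_or_mem h with h | hm
  · rcases v.isPrime.mem_or_mem h with hm | hm
    · have o₁ := h1 hA h₁ oA hm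
      have o₂ := h0 hB oB (fInt_notMem_of_mem hζ v hcop hγ hm)
      have o₃ := h0 hAB oAB (fInt_notMem_of_mem hζ v hcop hβ hm)
      refine conductorExponent_ofRoots_eq_one h20 hA hB hAB (Or.inr (by linarith))
        (OrdGE.of_eq o₂) ?_ (by linarith)
      rw [show A ^ 2 + A * B + B ^ 2 = B ^ 2 + A * (A + B) by ring]
      exact v.ord_sq_add_mul hB o₂ (Or.inr o₁) (OrdGE.of_eq o₃)
    · have o₂ := h1 hB h₂ oB hm
      have o₁ := h0 hA oA (fInt_notMem_of_mem hζ v hcop (hneg hγ) hm)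
      have o₃ := h0 hAB oAB (fInt_notMem_of_mem hζ v hcop hα hm)
      refine conductorExponent_ofRoots_eq_one h20 hA hB hAB (OrdGE.of_eq o₁)
        (Or.inr (by linarith)) ?_ (by linarith)
      rw [show A ^ 2 + A * B + B ^ 2 = A ^ 2 + B * (A + B) by ring]
      exact v.ord_sq_add_mul hA o₁ (Or.inr o₂) (OrdGE.of_eq o₃)
  · have o₃ := h1 hAB h₃ oAB hm
    have o₁ := h0 hA oA (fInt_notMem_of_mem hζ v hcop (hneg hβ) hm)
    have o₂ := h0 hB oB (fInt_notMem_of_mem hζ v hcop (hneg hα) hm)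
    refine conductorExponent_ofRoots_eq_one h20 hA hB hAB (OrdGE.of_eq o₁) (OrdGE.of_eq o₂) ?_
      (by linarith)
    rw [show A ^ 2 + A * B + B ^ 2 = A ^ 2 + (A + B) * B by ring]
    exact v.ord_sq_add_mul hA o₁ (Or.inr o₃) (OrdGE.of_eq o₂)

end Frey

/-! ### From local exponents to the conductor -/

namespace IsDedekindDomain.HeightOneSpectrum

open Valuation

variable {K : Type*} [Field K]

lemma mul_mul_pow_mem_iff (v : HeightOneSpectrum (𝓞 K)) (μ : (𝓞 K)ˣ) {e : 𝓞 K}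
    (he : e ∉ v.asIdeal) (c : 𝓞 K) {p : ℕ} (hp : p ≠ 0) :
    μ * e * c ^ p ∈ v.asIdeal ↔ c ∈ v.asIdeal := by
  have := v.isPrime
  refine ⟨fun h ↦ ?_, fun h ↦ v.asIdeal.mul_mem_left _ (Ideal.pow_mem_of_mem _ h _ (by omega))⟩
  rcases v.isPrime.mem_or_mem h with h | h
  · rcases v.isPrime.mem_or_mem h with h | h
    · exact absurd (Ideal.eq_top_of_isUnit_mem _ h μ.isUnit) v.isPrime.ne_top
    · exact absurd h he
  · exact v.isPrime.mem_of_pow_mem _ h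

variable [NumberField K]

lemma finite_setOf_mem {x : 𝓞 K} (hx : x ≠ 0) :
    {v : HeightOneSpectrum (𝓞 K) | x ∈ v.asIdeal}.Finite := by
  have := Ideal.finite_factors (R := 𝓞 K) (I := Ideal.span {x}) (by simpa using hx)
  simpa [Ideal.dvd_span_singleton] using this

/-- This merges the three factors of the conductor formula into one product over all places, so that
it can be compared with `conductor` place by place. Nonvanishing of `x` and `y` makes the supports
finite. -/
lemma finprod_mul_mul {M : Type*} [CommMonoid M] {v₀ : HeightOneSpectrum (𝓞 K)} {x y : 𝓞 K}
    (hx : x ≠ 0) (hy : y ≠ 0) (f g h : HeightOneSpectrum (𝓞 K) → M) :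
    ∏ᶠ v, (∏ᶠ (_ : x ∈ v.asIdeal), f v) * (∏ᶠ (_ : v = v₀), g v) * (∏ᶠ (_ : y ∈ v.asIdeal), h v) =
      (∏ᶠ (v) (_ : x ∈ v.asIdeal), f v) * g v₀ * ∏ᶠ (v) (_ : y ∈ v.asIdeal), h v := by
  have hsupp : ∀ (q : HeightOneSpectrum (𝓞 K) → Prop) (f : HeightOneSpectrum (𝓞 K) → M),
      {v | q v}.Finite → Function.HasFiniteMulSupport fun v ↦ ∏ᶠ (_ : q v), f v :=
    fun q f hq ↦ hq.subset fun v hv ↦ by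
      by_contra hn
      refine hv ?_
      have : ¬ q v := hn
      simp [this]
  have h₁ := hsupp _ f (finite_setOf_mem hx)
  have h₂ := hsupp (· = v₀) g (Set.finite_singleton v₀)
  have h₃ := hsupp _ h (finite_setOf_mem hy)
  rw [finprod_mul_distrib (show Function.HasFiniteMulSupport fun v ↦
    (∏ᶠ (_ : x ∈ v.asIdeal), f v) * ∏ᶠ (_ : v = v₀), g v from h₁.mul h₂) h₃,
    finprod_mul_distrib h₁ h₂, finprod_cond_eq_left]

end IsDedekindDomain.HeightOneSpectrum

end

theorem mainTheorem10
    (r : ℕ) [Fact r.Prime] (hr : 7 ≤ r)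
    (F : Type*) [Field F] [NumberField F] [IsCyclotomicExtension {r} ℚ F]
    (ζ : F) (hζ : IsPrimitiveRoot ζ r)
    (k₁ k₂ k₃ : ℕ) (hk₁ : 1 ≤ k₁) (hk₁₂ : k₁ < k₂) (hk₂₃ : k₂ < k₃) (hk₃ : k₃ ≤ (r - 1) / 2)
    (ϖ : 𝓞 (maximalRealSubfield F))
    (hϖ : Ideal.span {(r : 𝓞 (maximalRealSubfield F))} = Ideal.span {ϖ} ^ ((r - 1) / 2))
    (p : ℕ) (hp : p.Prime)
    (a b : ℤ) (hab : IsCoprime a b) (c : 𝓞 (maximalRealSubfield F))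
    (μ : (𝓞 (maximalRealSubfield F))ˣ)
    (hsol :
      (¬ (r : ℤ) ∣ a + b ∧
        Frey.f hζ k₁ a b * Frey.f hζ k₂ a b * Frey.f hζ k₃ a b =
          ((μ * c ^ p : 𝓞 (maximalRealSubfield F)) : maximalRealSubfield F)) ∨
      ((r : ℤ) ∣ a + b ∧
        Frey.f hζ k₁ a b * Frey.f hζ k₂ a b * Frey.f hζ k₃ a b =
          ((μ * ϖ ^ 3 * c ^ p : 𝓞 (maximalRealSubfield F)) : maximalRealSubfield F))) :
    (Frey.curve hζ k₁ k₂ k₃ a b).IsElliptic ∧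
    (∃ s : HeightOneSpectrum (𝓞 (maximalRealSubfield F)) → ℕ,
      (∀ v, s v = 2 ∨ s v = 3 ∨ s v = 4) ∧
      (Frey.curve hζ k₁ k₂ k₃ a b).conductor =
        (∏ᶠ (v : HeightOneSpectrum (𝓞 (maximalRealSubfield F)))
            (_ : (2 : 𝓞 (maximalRealSubfield F)) ∈ v.asIdeal), v.asIdeal ^ s v) *
          Ideal.span {ϖ} ^ (if (r : ℤ) ∣ a + b then 0 else 2) *
          (∏ᶠ (v : HeightOneSpectrum (𝓞 (maximalRealSubfield F)))
            (_ : c ∈ v.asIdeal), v.asIdeal)) ∧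
    (∀ v : HeightOneSpectrum (𝓞 (maximalRealSubfield F)),
      (3 : 𝓞 (maximalRealSubfield F)) ∈ v.asIdeal →
        (Frey.curve hζ k₁ k₂ k₃ a b).HasGoodReductionAt v) := by
  classical
  have hr2 : 2 < r := by omega
  have hp0 := hp.ne_zero
  obtain ⟨v₀, hv₀, hrv⟩ := Frey.exists_place_of_span_eq hr2 hϖ
  have hrv₀ := (hrv v₀).2 rfl
  have hk := fun {k} ↦ Frey.coprime_of_mem (r := r) (k := k) hr2 hk₁ hk₁₂ hk₂₃ hk₃
  -- The bound `7 ≤ r` enters here, applied to `2` and `6`.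
  have hsmall : ∀ m : ℤ, 0 < m → m < r → (m : 𝓞 (maximalRealSubfield F)) ∉ v₀.asIdeal :=
    fun m h h' hm ↦ (Int.le_of_dvd h ((v₀.intCast_mem_iff hrv₀ m).1 hm)).not_gt h'
  have h2v₀ : (2 : 𝓞 (maximalRealSubfield F)) ∉ v₀.asIdeal := by
    exact_mod_cast hsmall 2 (by norm_num) (by omega)
  have h6v₀ : (6 : 𝓞 (maximalRealSubfield F)) ∉ v₀.asIdeal := by
    exact_mod_cast hsmall 6 (by norm_num) (by omega)
  have hf : ∀ k, (k = k₁ ∨ k = k₂ ∨ k = k₃) → Frey.f hζ k a b ≠ 0 ∧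
      (v₀.valuation (maximalRealSubfield F)).ord (Frey.f hζ k a b) =
        if (r : ℤ) ∣ a + b then 1 else 0 := fun k h ↦ by
    split_ifs with hdvd
    · exact Frey.ord_f_of_dvd hr2 hζ v₀ (hk h) hab hdvd hrv₀
    · exact Frey.ord_f_of_not_dvd hr2 hζ v₀ (hk h) hdvd hrv₀
  obtain ⟨h₁, e₁⟩ := hf k₁ (by tauto)
  obtain ⟨h₂, e₂⟩ := hf k₂ (by tauto)
  obtain ⟨h₃, e₃⟩ := hf k₃ (by tauto)
  set P := Frey.fInt hζ k₁ a b * Frey.fInt hζ k₂ a b * Frey.fInt hζ k₃ a b with hP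
  have hPf : algebraMap _ (maximalRealSubfield F) P =
      Frey.f hζ k₁ a b * Frey.f hζ k₂ a b * Frey.f hζ k₃ a b := by
    rw [hP, map_mul, map_mul, Frey.algebraMap_fInt, Frey.algebraMap_fInt, Frey.algebraMap_fInt]
  have hP0 : P ≠ 0 := fun h ↦ by
    rw [h, map_zero] at hPf
    exact mul_ne_zero (mul_ne_zero h₁ h₂) h₃ hPf.symm
  obtain ⟨n, hn, hPn⟩ : ∃ n : ℕ, n = (if (r : ℤ) ∣ a + b then 3 else 0) ∧
      P = μ * ϖ ^ n * c ^ p := by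
    rcases hsol with ⟨hdvd, h⟩ | ⟨hdvd, h⟩
    · exact ⟨0, by rw [if_neg hdvd],
        RingOfIntegers.ext (by rw [pow_zero, mul_one]; exact hPf.trans h)⟩
    · exact ⟨3, by rw [if_pos hdvd], RingOfIntegers.ext (hPf.trans h)⟩
  have hc0 : c ≠ 0 := by
    rintro rfl
    rw [zero_pow hp0, mul_zero] at hPn
    exact hP0 hPn
  have hϖv : ∀ v : HeightOneSpectrum (𝓞 (maximalRealSubfield F)), ϖ ∈ v.asIdeal → v = v₀ := by
    intro v hv
    rw [← Ideal.span_singleton_le_iff_mem, ← hv₀] at hv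
    exact (HeightOneSpectrum.ext (v₀.isMaximal.eq_of_le v.isPrime.ne_top hv)).symm
  have hPc : ∀ v, v ≠ v₀ → (P ∈ v.asIdeal ↔ c ∈ v.asIdeal) := fun v hv ↦ by
    rw [hPn]
    exact v.mul_mul_pow_mem_iff μ (fun h ↦ hv (hϖv v (v.isPrime.mem_of_pow_mem _ h))) c hp0
  -- The three values `f_k(a, b)` contribute total order exactly `n` at `v₀`, which `ϖ ^ n` already
  -- accounts for.
  have hcv₀ : c ∉ v₀.asIdeal := by
    intro hc
    have hPmem : P ∈ v₀.asIdeal ^ (n + 1) := by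
      rw [hPn, pow_succ, hv₀]
      refine Ideal.mul_mem_mul (Ideal.mul_mem_left _ _ (Ideal.pow_mem_pow
        (Ideal.mem_span_singleton_self ϖ) n)) ?_
      rw [← hv₀]
      exact Ideal.pow_mem_of_mem _ hc _ hp.pos
    have hge := ((v₀.ordGE_iff_mem_pow (K := maximalRealSubfield F) P _).2 hPmem)
    rw [hPf] at hge
    have := hge.le_ord (mul_ne_zero (mul_ne_zero h₁ h₂) h₃)
    rw [Valuation.ord_mul (mul_ne_zero h₁ h₂) h₃, Valuation.ord_mul h₁ h₂, e₁, e₂, e₃, hn] at this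
    split_ifs at this <;> norm_num at this
  have h6 : ∀ v : HeightOneSpectrum (𝓞 (maximalRealSubfield F)),
      (6 : 𝓞 (maximalRealSubfield F)) ∈ v.asIdeal → v ≠ v₀ ∧ P ∉ v.asIdeal := by
    intro v hv
    have hne : v ≠ v₀ := fun h ↦ h6v₀ (h ▸ hv)
    have hnot : ∀ k, (k = k₁ ∨ k = k₂ ∨ k = k₃) → Frey.fInt hζ k a b ∉ v.asIdeal := fun k h ↦
      Frey.fInt_notMem_of_six_mem hr2 hζ v (hk h) hab hv (mt (hrv v).1 hne)
    refine ⟨hne, fun h ↦ ?_⟩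
    rcases v.isPrime.mem_or_mem h with h | h
    · rcases v.isPrime.mem_or_mem h with h | h
      · exact hnot k₁ (by tauto) h
      · exact hnot k₂ (by tauto) h
    · exact hnot k₃ (by tauto) h
  have h2v : ∀ v : HeightOneSpectrum (𝓞 (maximalRealSubfield F)),
      (2 : 𝓞 (maximalRealSubfield F)) ∈ v.asIdeal → (6 : 𝓞 (maximalRealSubfield F)) ∈ v.asIdeal :=
    fun v hv ↦ by
      have := v.asIdeal.mul_mem_left 3 hv
      norm_num at this
      exact this
  refine ⟨?_, ?_, fun v hv ↦ ?_⟩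
  · obtain ⟨A, B, hW, hA, hB, hAB, -⟩ :=
      Frey.exists_curve_eq_ofRoots hr2 hζ hk₁ hk₁₂ hk₂₃ hk₃ a b v₀ h₁ h₂ h₃
    rw [hW]
    exact ⟨(WeierstrassCurve.ord_Δ_ofRoots (v := v₀) hA hB hAB).1.isUnit⟩
  -- Only places above `2` enter the product; the value `2` elsewhere merely satisfies the
  -- constraint on `s`.
  · refine ⟨fun v ↦ if (2 : 𝓞 (maximalRealSubfield F)) ∈ v.asIdeal then
      (Frey.curve hζ k₁ k₂ k₃ a b).conductorExponent v else 2, fun v ↦ ?_, ?_⟩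
    · dsimp only
      split_ifs with hv
      · exact Frey.conductorExponent_curve_of_two_mem hr2 hζ hk₁ hk₁₂ hk₂₃ hk₃ v hab hv
          (mt (hrv v).1 (h6 v (h2v v hv)).1)
      · exact Or.inl rfl
    · rw [← hv₀, ← HeightOneSpectrum.finprod_mul_mul two_ne_zero hc0 _
        (fun v ↦ v.asIdeal ^ (if (r : ℤ) ∣ a + b then 0 else 2)), WeierstrassCurve.conductor]
      refine finprod_congr fun v ↦ ?_
      by_cases hv : (2 : 𝓞 (maximalRealSubfield F)) ∈ v.asIdeal
      · obtain ⟨hne, hPv⟩ := h6 v (h2v v hv)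
        rw [hPc v hne] at hPv
        simp only [hv, hne, hPv, finprod_true, finprod_false, if_true, mul_one]
      · by_cases hv' : v = v₀
        · subst hv'
          simp only [hv, hcv₀, finprod_true, finprod_false, one_mul, mul_one]
          rw [Frey.conductorExponent_curve_of_natCast_mem hr2 hζ hk₁ hk₁₂ hk₂₃ hk₃ v hab hrv₀ hv]
        · have hrv' := mt (hrv v).1 hv'
          by_cases hc : c ∈ v.asIdeal
          · simp only [hv, hv', hc, finprod_true, finprod_false, one_mul]
            rw [Frey.conductorExponent_curve_eq_one hr2 hζ hk₁ hk₁₂ hk₂₃ hk₃ v hab hv hrv' h₁ h₂ h₃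
              ((hPc v hv').2 hc), pow_one]
          · simp only [hv, hv', hc, finprod_false, one_mul]
            rw [WeierstrassCurve.conductorExponent,
              if_pos (Frey.hasGoodReductionAt_curve hr2 hζ hk₁ hk₁₂ hk₂₃ hk₃ v
              hv hrv' (mt (hPc v hv').1 hc)), pow_zero]
  · have hv6 : (6 : 𝓞 (maximalRealSubfield F)) ∈ v.asIdeal := by
      have := v.asIdeal.mul_mem_left 2 hv
      norm_num at this
      exact this
    have hv2 : (2 : 𝓞 (maximalRealSubfield F)) ∉ v.asIdeal := fun h ↦ by
      refine v.isPrime.ne_top ((Ideal.eq_top_iff_one _).2 ?_)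
      have := v.asIdeal.sub_mem hv h
      norm_num at this
      exact this
    obtain ⟨hne, hPv⟩ := h6 v hv6
    exact Frey.hasGoodReductionAt_curve hr2 hζ hk₁ hk₁₂ hk₂₃ hk₃ v hv2 (mt (hrv v).1 hne) hPv
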